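/- Let $k$ be a field and $\mathcal{T}$ a $k$-linear triangulated category with ($k$-linear) suspension $S$. Let $\operatorname{mod}\mathcal{T}$ be the category of finitely presented functors $F:\mathcal{T}^{op}\to\operatorname{Mod}k$, i.e. those admitting an exact sequence $\operatorname{Hom}(?,X)\to\operatorname{Hom}(?,Y)\to F\to 0$ with $X,Y\in\mathcal{T}$. Then $\operatorname{mod}\mathcal{T}$ is an abelian Frobenius category (enough projectives, enough injectives, projective $=$ injective). Let $\underline{\operatorname{mod}}\,\mathcal{T}$ be its stable category (morphisms modulo those factoring through injectives), with its standard suspension (the cokernel of a monomorphism into an injective) and its standard triangles (induced by short exact sequences). Conventions. Powers $S^d$, $d\in\mathbf{Z}$, are triangle functors with commutation $S^dS\cong SS^d$ equal to $(-1)^d$ times the canonical one. A Serre functor of a $k$-linear triangulated category with finite-dimensional $\operatorname{Hom}$-spaces is a triangle functor $\nu$ with $k$-linear isomorphisms $D\operatorname{Hom}(X,Y)\cong\operatorname{Hom}(Y,\nu X)$, natural in $X$ and $Y$ ($D=\operatorname{Hom}_k(?,k)$); its canonical triangle structure is the one for which the resulting pairings $\langle\,,\rangle:\operatorname{Hom}(X,Y)\times\operatorname{Hom}(Y,\nu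 X)\to k$ satisfy $\langle Sf,Sg\rangle=-\langle f,g\rangle$ (where $Sg$ is composed with $S\nu X\cong\nu SX$). The category is Calabi–Yau of CY-dimension $d$ if its $\operatorname{Hom}$-spaces are finite-dimensional and it has a Serre functor $\nu$, with its canonical triangle structure, which is an equivalence and is isomorphic to $S^d$ as a triangle functor. (1) For every $d\in\mathbf{Z}$, if $\mathcal{T}$ is Calabi–Yau of CY-dimension $d$, then $\underline{\operatorname{mod}}\,\mathcal{T}$ is Calabi–Yau of CY-dimension $3d-1$. The same implication holds if, in both places, Serre functors are allowed to carry an arbitrary triangle structure instead of the canonical one. (2) If the suspension of $\mathcal{T}$ has finite order $n$ (the least $n\geq 1$ such that $S^n$ is isomorphic to the identity as a triangle functor), then the suspension of $\underline{\operatorname{mod}}\,\mathcal{T}$ has finite order, and this order divides $3n$. The same holds if, in both places, the order is taken up to isomorphism of plain functors. -/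

import Mathlib

open CategoryTheory CategoryTheory.Limits

universe w v u

noncomputable section

namespace CYMod

/-! ### Categories with a suspension and a class of triangles; triangle functors -/

/-- The data of a triangulated category: a suspension (an autoequivalence) and the class of
distinguished triangles `X ⟶ Y ⟶ Z ⟶ S X`. -/
structure TriData (C : Type u) [Category.{v} C] where
  /-- the suspension -/
  S : C ≌ C
  /-- the distinguished triangles -/
  dist : ∀ {X Y Z : C}, (X ⟶ Y) → (Y ⟶ Z) → (Z ⟶ S.functor.obj X) → Prop

/-- The suspension and the distinguished triangles of a (pre)triangulated category of Mathlib. -/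
def TriData.ofPretriangulated (T : Type u) [Category.{v} T] [HasZeroObject T] [HasShift T ℤ]
    [Preadditive T] [∀ n : ℤ, (shiftFunctor T n).Additive] [Pretriangulated T] : TriData T where
  S := shiftEquiv T (1 : ℤ)
  dist {X Y Z} f g h :=
    Pretriangulated.Triangle.mk (X := X) (Y := Y) (Z := Z) f g h ∈
      (Pretriangulated.distinguishedTriangles : Set (Pretriangulated.Triangle T))

section TriangleFunctors

variable {C : Type u} [Category.{v} C]

/-- An endofunctor together with an isomorphism which commutes it with the suspension.
It is a triangle functor if moreover `SFunctor.IsTriangle` holds. -/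
structure SFunctor (𝒯 : TriData C) where
  /-- the underlying functor -/
  F : C ⥤ C
  /-- the commutation `F (S X) ≅ S (F X)` -/
  φ : 𝒯.S.functor ⋙ F ≅ F ⋙ 𝒯.S.functor

namespace SFunctor

variable {𝒯 : TriData C}

/-- `(F, φ)` is a triangle functor: it sends distinguished triangles `(f, g, h)` to
distinguished triangles `(F f, F g, φ ∘ F h)`. -/
def IsTriangle (A : SFunctor 𝒯) : Prop :=
  ∀ ⦃X Y Z : C⦄ (f : X ⟶ Y) (g : Y ⟶ Z) (h : Z ⟶ 𝒯.S.functor.obj X), 𝒯.dist f g h →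
    𝒯.dist (A.F.map f) (A.F.map g) (A.F.map h ≫ A.φ.hom.app X)

/-- `A` and `B` are isomorphic as triangle functors: there is a natural isomorphism of the
underlying functors which is compatible with the commutations with the suspension. -/
def Isomorphic (A B : SFunctor 𝒯) : Prop :=
  ∃ α : A.F ≅ B.F, ∀ X : C,
    A.φ.hom.app X ≫ 𝒯.S.functor.map (α.hom.app X) =
      α.hom.app (𝒯.S.functor.obj X) ≫ B.φ.hom.app X

/-- The identity triangle functor. -/
def id (𝒯 : TriData C) : SFunctor 𝒯 where
  F := 𝟭 C
  φ := 𝒯.S.functor.rightUnitor ≪≫ 𝒯.S.functor.leftUnitor.symm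

/-- The composite triangle functor, `A` first, then `B`. -/
def comp (A B : SFunctor 𝒯) : SFunctor 𝒯 where
  F := A.F ⋙ B.F
  φ := (Functor.associator _ _ _).symm ≪≫ Functor.isoWhiskerRight A.φ B.F ≪≫
    Functor.associator _ _ _ ≪≫ Functor.isoWhiskerLeft A.F B.φ ≪≫ (Functor.associator _ _ _).symm

/-- The powers `Aⁿ`, `n : ℕ`. -/
def npow (A : SFunctor 𝒯) : ℕ → SFunctor 𝒯
  | 0 => SFunctor.id 𝒯
  | n + 1 => (npow A n).comp A

variable [Preadditive C]

/-- The negative of an isomorphism of functors. -/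
def negIso {F G : C ⥤ C} (e : F ≅ G) : F ≅ G where
  hom := -e.hom
  inv := -e.inv
  hom_inv_id := by simp
  inv_hom_id := by simp

/-- The suspension as a triangle functor: the commutation `S (S X) ≅ S (S X)` is `-1`. -/
def susp (𝒯 : TriData C) : SFunctor 𝒯 where
  F := 𝒯.S.functor
  φ := negIso (Iso.refl _)

/-- The inverse of the suspension as a triangle functor: the commutation is the negative of
the canonical isomorphism `S⁻¹ (S X) ≅ X ≅ S (S⁻¹ X)`. -/
def suspInv (𝒯 : TriData C) : SFunctor 𝒯 where
  F := 𝒯.S.inverse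
  φ := negIso (𝒯.S.unitIso.symm ≪≫ 𝒯.S.counitIso.symm)

/-- The triangle functor `S ^ d`, `d : ℤ`. -/
def suspPow (𝒯 : TriData C) : ℤ → SFunctor 𝒯
  | Int.ofNat n => (susp 𝒯).npow n
  | Int.negSucc n => (suspInv 𝒯).npow (n + 1)

end SFunctor

end TriangleFunctors

/-! ### Serre functors, the Calabi-Yau property, the order of the suspension -/

section CalabiYau

variable (k : Type w) [Field k] {C : Type u} [Category.{v} C] [Preadditive C] [Linear k C]

/-- Isomorphisms `D Hom(X, Y) ≅ Hom(Y, F X)`, natural in `X` and `Y`, where `D = Hom_k(-, k)`. -/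
structure SerreIso (F : C ⥤ C) where
  /-- the isomorphisms -/
  e : ∀ X Y : C, Module.Dual k (X ⟶ Y) ≃ₗ[k] (Y ⟶ F.obj X)
  naturality_right : ∀ {X Y Y' : C} (g : Y' ⟶ Y) (ξ : Module.Dual k (X ⟶ Y)),
    g ≫ e X Y ξ = e X Y' (ξ ∘ₗ Linear.rightComp k X g)
  naturality_left : ∀ {X X' Y : C} (u : X ⟶ X') (ξ : Module.Dual k (X ⟶ Y)),
    e X Y ξ ≫ F.map u = e X' Y (ξ ∘ₗ Linear.leftComp k Y u)

/-- Compatibility of the commutation `ν S ≅ S ν` with the pairings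
`⟨f, g⟩ = e⁻¹(g)(f)`, `f : X ⟶ Y`, `g : Y ⟶ ν X`, of a Serre functor:
`⟨S f, S g⟩ = - ⟨f, g⟩`. The commutation is determined by the pairings through this
condition; it is the canonical structure of a triangle functor on a Serre functor, for which
Serre functors are unique up to isomorphism of triangle functors. -/
def SerreIso.IsCompatible {𝒯 : TriData C} {ν : SFunctor 𝒯} (s : SerreIso k ν.F) : Prop :=
  ∀ ⦃X Y : C⦄ (f : X ⟶ Y) (g : Y ⟶ ν.F.obj X),
    (s.e (𝒯.S.functor.obj X) (𝒯.S.functor.obj Y)).symm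
      (𝒯.S.functor.map g ≫ ν.φ.inv.app X) (𝒯.S.functor.map f) = -((s.e X Y).symm g f)

/-- `C` is Calabi-Yau of CY-dimension `d`: the Hom-spaces are finite-dimensional, there is
a (right) Serre functor `ν`, it is an equivalence, and `ν ≅ S ^ d` as triangle functors,
where `ν` carries its canonical structure of a triangle functor. -/
def IsCalabiYau (𝒯 : TriData C) (d : ℤ) : Prop :=
  (∀ X Y : C, Module.Finite k (X ⟶ Y)) ∧
  ∃ (ν : SFunctor 𝒯) (s : SerreIso k ν.F), ν.IsTriangle ∧ s.IsCompatible ∧ ν.F.IsEquivalence ∧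
    ν.Isomorphic (SFunctor.suspPow 𝒯 d)

/-- The variant of `IsCalabiYau` where a Serre functor may carry any structure of a triangle
functor, whether or not it is compatible with the pairings. -/
def IsWeaklyCalabiYau (𝒯 : TriData C) (d : ℤ) : Prop :=
  (∀ X Y : C, Module.Finite k (X ⟶ Y)) ∧
  ∃ (ν : SFunctor 𝒯) (_ : SerreIso k ν.F), ν.IsTriangle ∧ ν.F.IsEquivalence ∧
    ν.Isomorphic (SFunctor.suspPow 𝒯 d)

/-- The suspension, as a triangle functor, has (finite) order `n`: `n` is the least positive
integer such that `S ^ n` is isomorphic to the identity as a triangle functor. -/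
def HasSuspensionOrder (𝒯 : TriData C) (n : ℕ) : Prop :=
  IsLeast {m : ℕ | 0 < m ∧ (SFunctor.suspPow 𝒯 m).Isomorphic (SFunctor.id 𝒯)} n

/-- The suspension, as a mere functor, has (finite) order `n`: `n` is the least positive
integer such that `S ^ n` is isomorphic to the identity functor. -/
def HasPlainSuspensionOrder (𝒯 : TriData C) (n : ℕ) : Prop :=
  IsLeast {m : ℕ | 0 < m ∧ Nonempty ((SFunctor.suspPow 𝒯 m).F ≅ 𝟭 C)} n

end CalabiYau

/-! ### Frobenius abelian categories and their stable categories -/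

/-- A Frobenius abelian category: abelian, with enough injectives and enough projectives, and
such that an object is projective iff it is injective. -/
class IsFrobeniusAbelian (E : Type u) [Category.{v} E] [Preadditive E] : Prop extends
    IsNormalMonoCategory E, IsNormalEpiCategory E where
  has_finite_products : HasFiniteProducts E
  has_kernels : HasKernels E
  has_cokernels : HasCokernels E
  enough_injectives : EnoughInjectives E
  enough_projectives : EnoughProjectives E
  projective_iff_injective : ∀ X : E, Projective X ↔ Injective X

namespace Stable

variable (E : Type u) [Category.{v} E] [Preadditive E]

/-- The abelian structure of a Frobenius abelian category. -/
@[reducible]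
def abelian [IsFrobeniusAbelian E] : Abelian E :=
  letI := IsFrobeniusAbelian.has_finite_products (E := E)
  letI := IsFrobeniusAbelian.has_kernels (E := E)
  letI := IsFrobeniusAbelian.has_cokernels (E := E)
  { }

attribute [local instance] abelian

instance [IsFrobeniusAbelian E] : EnoughInjectives E := IsFrobeniusAbelian.enough_injectives
instance [IsFrobeniusAbelian E] : EnoughProjectives E := IsFrobeniusAbelian.enough_projectives

/-- Two morphisms are identified in the stable category iff their difference factors through
an injective object. -/
def rel : HomRel E := fun X Y f g =>
  ∃ (J : E) (_ : Injective J) (a : X ⟶ J) (b : J ⟶ Y), f - g = a ≫ b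

variable {E} in
lemma rel_add [IsFrobeniusAbelian E] {X Y : E} {f f' g g' : X ⟶ Y} (hf : rel E f f')
    (hg : rel E g g') : rel E (f + g) (f' + g') := by
  obtain ⟨J, hJ, a, b, h⟩ := hf
  obtain ⟨J', hJ', a', b', h'⟩ := hg
  refine ⟨J ⊞ J', inferInstance, biprod.lift a a', biprod.desc b b', ?_⟩
  rw [biprod.lift_desc, ← h, ← h']
  abel

variable {E} in
lemma rel_refl [IsFrobeniusAbelian E] {X Y : E} (f : X ⟶ Y) : rel E f f :=
  ⟨Injective.under X, inferInstance, 0, 0, by simp⟩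

instance [IsFrobeniusAbelian E] : Congruence (rel E) where
  equivalence :=
    { refl := fun f => rel_refl f
      symm := by
        rintro f g ⟨J, hJ, a, b, h⟩
        exact ⟨J, hJ, -a, b, by rw [Preadditive.neg_comp, ← h, neg_sub]⟩
      trans := by
        intro f g h h₁ h₂
        obtain ⟨J, hJ, a, b, e⟩ := rel_add h₁ h₂
        refine ⟨J, hJ, a, b, ?_⟩
        rw [← e]
        abel }
  comp_left := by
    rintro X Y Z f g g' ⟨J, hJ, a, b, h⟩
    exact ⟨J, hJ, f ≫ a, b, by rw [← Preadditive.comp_sub, h, Category.assoc]⟩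
  comp_right := by
    rintro X Y Z f f' g ⟨J, hJ, a, b, h⟩
    exact ⟨J, hJ, a, b ≫ g, by rw [← Preadditive.sub_comp, h, Category.assoc]⟩

end Stable

/-- The stable category: the quotient by the ideal of morphisms which factor through an
injective object. -/
abbrev StableCat (E : Type u) [Category.{v} E] [Preadditive E] := Quotient (Stable.rel E)

namespace Stable

attribute [local instance] abelian

variable (E : Type u) [Category.{v} E] [Preadditive E] [IsFrobeniusAbelian E]

instance : Preadditive (StableCat E) :=
  Quotient.preadditive _ (fun _ _ _ _ _ _ h h' => rel_add h h')

/-- The projection to the stable category. -/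
abbrev proj : E ⥤ StableCat E := Quotient.functor (rel E)

instance : (proj E).Additive := Quotient.functor_additive _ _

instance (k : Type w) [Field k] [Linear k E] : Linear k (StableCat E) :=
  Quotient.linear k _ (fun c X Y f g ⟨J, hJ, a, b, h⟩ =>
    ⟨J, hJ, c • a, b, by rw [← smul_sub, h, Linear.smul_comp]⟩)

variable {E}

/-- The chosen sequence `X ⟶ I ⟶ S X` with `I` injective. -/
def injSeq (X : E) : ShortComplex E :=
  ShortComplex.mk (Injective.ι X) (cokernel.π (Injective.ι X)) (cokernel.condition _)

lemma injSeq_shortExact (X : E) : (injSeq X).ShortExact where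
  exact := ShortComplex.exact_of_g_is_cokernel _ (cokernelIsCokernel _)
  mono_f := inferInstanceAs (Mono (Injective.ι X))
  epi_g := (inferInstance : Epi (coequalizer.π (Injective.ι X) 0))

instance (X : E) : Injective (injSeq X).X₂ := inferInstanceAs (Injective (Injective.under X))

/-- A morphism `f` extends to a morphism of short exact sequences. -/
lemma exists_extend {s t : ShortComplex E} (hs : s.ShortExact) [Injective t.X₂]
    (f : s.X₁ ⟶ t.X₁) : ∃ α : s ⟶ t, α.τ₁ = f := by
  have := hs.mono_f
  have := hs.epi_g
  have h : s.f ≫ Injective.factorThru (f ≫ t.f) s.f = f ≫ t.f := Injective.comp_factorThru _ _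
  exact ⟨ShortComplex.Hom.mk f (Injective.factorThru (f ≫ t.f) s.f)
    (hs.exact.desc (Injective.factorThru (f ≫ t.f) s.f ≫ t.g)
      (by rw [← Category.assoc, h, Category.assoc, t.zero, comp_zero]))
    h.symm (by simp), rfl⟩

lemma map_τ₃_eq_zero {s t : ShortComplex E} (hs : s.ShortExact) [Injective t.X₂]
    (α : s ⟶ t) (h : (proj E).map α.τ₁ = 0) : (proj E).map α.τ₃ = 0 := by
  have := hs.mono_f
  have := hs.epi_g
  rw [← (proj E).map_zero, Quotient.functor_map_eq_iff] at h ⊢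
  obtain ⟨J, hJ, u, v, e⟩ := h
  rw [sub_zero] at e
  have hk : s.f ≫ (α.τ₂ - Injective.factorThru u s.f ≫ v ≫ t.f) = 0 := by
    rw [Preadditive.comp_sub, ← α.comm₁₂, Injective.comp_factorThru_assoc, e, Category.assoc,
      sub_self]
  refine ⟨t.X₂, inferInstance, hs.exact.desc _ hk, t.g, ?_⟩
  rw [sub_zero, ← cancel_epi s.g, ← Category.assoc, hs.exact.g_desc, ← α.comm₂₃]
  simp

lemma map_τ₃_eq {s t : ShortComplex E} (hs : s.ShortExact) [Injective t.X₂]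
    (α β : s ⟶ t) (h : (proj E).map α.τ₁ = (proj E).map β.τ₁) :
    (proj E).map α.τ₃ = (proj E).map β.τ₃ := by
  rw [← sub_eq_zero, ← (proj E).map_sub] at h ⊢
  exact map_τ₃_eq_zero hs (α - β) h

lemma map_τ₁_eq_zero {s t : ShortComplex E} [Injective s.X₂] (ht : t.ShortExact)
    (α : s ⟶ t) (h : (proj E).map α.τ₃ = 0) : (proj E).map α.τ₁ = 0 := by
  have := ht.mono_f
  have := ht.epi_g
  rw [← (proj E).map_zero, Quotient.functor_map_eq_iff] at h ⊢
  obtain ⟨J, hJ, u, v, e⟩ := h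
  rw [sub_zero] at e
  have := (IsFrobeniusAbelian.projective_iff_injective J).2 hJ
  have hk : (α.τ₂ - s.g ≫ u ≫ Projective.factorThru v t.g) ≫ t.g = 0 := by
    rw [Preadditive.sub_comp, α.comm₂₃, Category.assoc, Category.assoc,
      Projective.factorThru_comp, e, sub_self]
  refine ⟨s.X₂, inferInstance, s.f, ht.exact.lift _ hk, ?_⟩
  rw [sub_zero, ← cancel_mono t.f, Category.assoc, ht.exact.lift_f, α.comm₁₂]
  simp

/-- A chosen extension of `f : X ⟶ Y` to a morphism between the chosen sequences. -/
def extend {X Y : E} (f : X ⟶ Y) : injSeq X ⟶ injSeq Y :=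
  (exists_extend (t := injSeq Y) (injSeq_shortExact X) f).choose

lemma extend_τ₁ {X Y : E} (f : X ⟶ Y) : (extend f).τ₁ = f :=
  (exists_extend (t := injSeq Y) (injSeq_shortExact X) f).choose_spec

variable (E)

/-- The cokernel of the embedding `X ⟶ I`, as a functor from `E` to the stable category. -/
def suspFunctorAux : E ⥤ StableCat E where
  obj X := (proj E).obj (injSeq X).X₃
  map f := (proj E).map (extend f).τ₃
  map_id X := by
    rw [← (proj E).map_id]
    exact map_τ₃_eq (injSeq_shortExact X) (extend (𝟙 X)) (𝟙 _) (by rw [extend_τ₁]; rfl)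
  map_comp {X Y Z} f g := by
    rw [← (proj E).map_comp]
    exact map_τ₃_eq (injSeq_shortExact X) (extend (f ≫ g)) (extend f ≫ extend g)
      (by rw [ShortComplex.comp_τ₁, extend_τ₁, extend_τ₁, extend_τ₁]; rfl)

/-- The suspension functor of the stable category: it sends `X` to the cokernel of a
monomorphism `X ⟶ I` with `I` injective. -/
def suspFunctor : StableCat E ⥤ StableCat E :=
  CategoryTheory.Quotient.lift (rel E) (suspFunctorAux E) (fun X Y f g h => by
    refine map_τ₃_eq (injSeq_shortExact X) (extend f) (extend g) ?_
    rw [extend_τ₁, extend_τ₁]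
    exact (Quotient.functor_map_eq_iff _ _ _).2 h)

lemma suspFunctor_map {X Y : E} (α : injSeq X ⟶ injSeq Y) :
    (suspFunctor E).map ((proj E).map α.τ₁) = (proj E).map α.τ₃ :=
  map_τ₃_eq (injSeq_shortExact X) (extend (X := X) (Y := Y) α.τ₁) α
    (congrArg (proj E).map (extend_τ₁ (X := X) (Y := Y) α.τ₁))

instance : (suspFunctor E).Faithful where
  map_injective {X Y} f g h := by
    obtain ⟨X⟩ := X
    obtain ⟨Y⟩ := Y
    obtain ⟨f, rfl⟩ := (proj E).map_surjective f
    obtain ⟨g, rfl⟩ := (proj E).map_surjective g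
    have hα := suspFunctor_map E (extend f)
    have hβ := suspFunctor_map E (extend g)
    rw [extend_τ₁] at hα hβ
    have h' : (proj E).map (extend f - extend g).τ₃ = 0 := by
      rw [ShortComplex.sub_τ₃, Functor.map_sub, sub_eq_zero, ← hα, ← hβ]
      exact h
    have := map_τ₁_eq_zero (injSeq_shortExact Y) _ h'
    rwa [ShortComplex.sub_τ₁, Functor.map_sub, sub_eq_zero, extend_τ₁, extend_τ₁] at this

instance : (suspFunctor E).Full where
  map_surjective {X Y} g := by
    obtain ⟨X⟩ := X
    obtain ⟨Y⟩ := Y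
    obtain ⟨g, rfl⟩ := (proj E).map_surjective (X := (injSeq X).X₃) (Y := (injSeq Y).X₃) g
    have := (injSeq_shortExact Y).epi_g
    have := (injSeq_shortExact Y).mono_f
    have := (IsFrobeniusAbelian.projective_iff_injective (injSeq X).X₂).2 inferInstance
    have h : Projective.factorThru ((injSeq X).g ≫ g) (injSeq Y).g ≫ (injSeq Y).g =
      (injSeq X).g ≫ g := Projective.factorThru_comp _ _
    have hk : ((injSeq X).f ≫ Projective.factorThru ((injSeq X).g ≫ g) (injSeq Y).g) ≫
        (injSeq Y).g = 0 := by
      rw [Category.assoc, h, ← Category.assoc, (injSeq X).zero, zero_comp]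
    let α : injSeq X ⟶ injSeq Y :=
      ShortComplex.Hom.mk ((injSeq_shortExact Y).exact.lift _ hk) _ g
        ((injSeq_shortExact Y).exact.lift_f _ hk) h
    exact ⟨(proj E).map α.τ₁, suspFunctor_map E α⟩

instance : (suspFunctor E).EssSurj where
  mem_essImage Y := by
    obtain ⟨Y⟩ := Y
    have : Injective (Projective.over Y) :=
      (IsFrobeniusAbelian.projective_iff_injective _).1 inferInstance
    let s : ShortComplex E := ShortComplex.mk (kernel.ι (Projective.π Y)) (Projective.π Y)
      (kernel.condition _)
    have hs : s.ShortExact :=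
      { exact := ShortComplex.exact_of_f_is_kernel _ (kernelIsKernel _)
        mono_f := inferInstanceAs (Mono (kernel.ι _))
        epi_g := inferInstanceAs (Epi (Projective.π Y)) }
    have : Injective s.X₂ := this
    let K := s.X₁
    have hK := injSeq_shortExact K
    obtain ⟨α, hα⟩ := exists_extend (t := injSeq K) hs (𝟙 K)
    obtain ⟨β, hβ⟩ := exists_extend (s := injSeq K) (t := s) hK (𝟙 K)
    refine ⟨(proj E).obj K, ⟨⟨(proj E).map β.τ₃, (proj E).map α.τ₃, ?_, ?_⟩⟩⟩
    · refine ((proj E).map_comp _ _).symm.trans (Eq.trans ?_ ((proj E).map_id _))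
      refine map_τ₃_eq hK (β ≫ α) (𝟙 _) ?_
      rw [ShortComplex.comp_τ₁, hα, hβ]
      exact congrArg _ (Category.comp_id _)
    · refine ((proj E).map_comp _ _).symm.trans (Eq.trans ?_ ((proj E).map_id _))
      refine map_τ₃_eq hs (α ≫ β) (𝟙 _) ?_
      rw [ShortComplex.comp_τ₁, hα, hβ]
      exact congrArg _ (Category.comp_id _)

instance : (suspFunctor E).IsEquivalence where

/-- The triangulated structure of the stable category. For a short exact sequence
`0 ⟶ A ⟶ B ⟶ C ⟶ 0` of `E` and a morphism `α` from it to the chosen sequence `A ⟶ I ⟶ S A`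
which is the identity on `A`, the triangle `A ⟶ B ⟶ C ⟶ S A` with last morphism `-α₃` is
distinguished, and the distinguished triangles are those isomorphic to such a triangle. -/
def triData : TriData (StableCat E) where
  S := (suspFunctor E).asEquivalence
  dist {X Y Z} f g h :=
    ∃ (s : ShortComplex E) (_ : s.ShortExact) (α : s ⟶ injSeq s.X₁) (_ : α.τ₁ = 𝟙 s.X₁)
      (eX : X ≅ (proj E).obj s.X₁) (eY : Y ≅ (proj E).obj s.X₂) (eZ : Z ≅ (proj E).obj s.X₃),
      f ≫ eY.hom = eX.hom ≫ (proj E).map s.f ∧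
      g ≫ eZ.hom = eY.hom ≫ (proj E).map s.g ∧
      h ≫ (suspFunctor E).map eX.hom = -(eZ.hom ≫ (proj E).map α.τ₃)

end Stable

/-! ### Finitely presented functors -/

section FinitelyPresented

variable (k : Type w) [Field k] (T : Type u) [Category.{v} T] [Preadditive T] [Linear k T]

/-- A functor `F : Tᵒᵖ ⥤ Mod k` is finitely presented if there is an exact sequence
`Hom(-, X) ⟶ Hom(-, Y) ⟶ F ⟶ 0`. -/
def finPres : ObjectProperty (Tᵒᵖ ⥤ ModuleCat.{v} k) := fun F =>
  ∃ (X Y : T) (f : X ⟶ Y), Nonempty (F ≅ cokernel ((linearYoneda k T).map f))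

/-- The category `mod T` of finitely presented functors `Tᵒᵖ ⥤ Mod k`. -/
abbrev ModCat := (finPres k T).FullSubcategory

end FinitelyPresented

end CYMod

end

/-! Write `E` for `mod T` and `σ` for the suspension of its stable category. Representable functors
are projective by Yoneda and injective because `Hom(-, V)` turns distinguished triangles into exact
sequences. Every finitely presented functor is the image of a morphism `f : Y ⟶ Z` between
representables (`exists_image`), so `E` is Frobenius, and its projective-injective objects are the
retracts of representables.

Precomposition with `X ↦ X[-n]` is an exact autoequivalence `shiftMod n` of `E`, hence induces a
triangle functor on the stable category (`stab`). The heart of the proof is that `shiftMod 1`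
induces `σ³`, as triangle functors (`stab_shiftMod_one`). If `F` is the image of `f` in a triangle
`Y ⟶ Z ⟶ W ⟶ Y[1]`, then `0 ⟶ F ⟶ Z ⟶ W ⟶ Y[1] ⟶ F[1] ⟶ 0` is exact with injective middle terms
(representables written as their objects), so `F[1]` is the third cosyzygy of `F`. The sign of
`-f[1]` in the rotated triangle is the sign `(-1)³` of the commutation of `σ³` with `σ`
(`theta_rotate`). Consequently `shiftMod n` induces `σ^(3n)` for every integer `n`
(`cls_stab_shiftMod`), and an isomorphism `S^n ≅ 1` on `T` yields `σ^(3n) ≅ 1`.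

For the Calabi-Yau statement, a Serre functor isomorphic to `S^d` gives nondegenerate cyclic traces
`Hom(P, N P) ⟶ k` on the injective objects `P`, where `N = shiftMod d` (`serreTrace`). For `0 ⟶ F ⟶
I ⟶ C ⟶ 0` with `I` injective, the trace over `I` of `I ⟶ C ⟶ G ⟶ N F ⟶ N I` pairs `Hom(C, G)` with
`Hom(G, N F)`, and this pairing becomes perfect in the stable category. As `C` is `σF`, the functor
`N σ⁻¹`, that is `σ^(3d-1)`, is a Serre functor. The pairing before the twist by `σ⁻¹` is preserved
by `σ` without sign (`natPairing_suspend`); the `-1` in the canonical triangle structure comes from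
the commutation of `σ⁻¹`.

Both arguments use only isomorphisms of plain functors on `T` and produce isomorphisms of triangle
functors on the stable category, so each yields both variants of its statement. -/

noncomputable section

namespace CYMod

section

/-! ### The monoid of isomorphism classes of functors with commutation -/

namespace SFunctor

section

variable {C : Type u} [Category.{v} C] {𝒯 : TriData C}

@[simp] lemma id_F : (SFunctor.id 𝒯).F = 𝟭 C := rfl

@[simp] lemma comp_F (A B : SFunctor 𝒯) : (A.comp B).F = A.F ⋙ B.F := rfl

lemma id_φ_hom_app (X : C) : (SFunctor.id 𝒯).φ.hom.app X = 𝟙 (𝒯.S.functor.obj X) := by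
  simp [SFunctor.id]

lemma comp_φ_hom_app (A B : SFunctor 𝒯) (X : C) :
    (A.comp B).φ.hom.app X = B.F.map (A.φ.hom.app X) ≫ B.φ.hom.app (A.F.obj X) := by
  simp [SFunctor.comp]

namespace Isomorphic

lemma refl (A : SFunctor 𝒯) : A.Isomorphic A :=
  ⟨Iso.refl _, fun X => by simp⟩

lemma symm {A B : SFunctor 𝒯} : A.Isomorphic B → B.Isomorphic A := by
  rintro ⟨α, h⟩
  refine ⟨α.symm, fun X => ?_⟩
  have h := h X
  simp only [Iso.symm_hom]
  rw [← cancel_epi (α.hom.app (𝒯.S.functor.obj X)), Iso.hom_inv_id_app_assoc,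
    ← Category.assoc, ← h, Category.assoc, ← Functor.map_comp, Iso.hom_inv_id_app]
  simp

lemma trans {A B D : SFunctor 𝒯} :
    A.Isomorphic B → B.Isomorphic D → A.Isomorphic D := by
  rintro ⟨α, h⟩ ⟨β, h'⟩
  refine ⟨α ≪≫ β, fun X => ?_⟩
  have h := h X
  have h' := h' X
  simp only [Iso.trans_hom, NatTrans.comp_app, Functor.map_comp, Category.assoc]
  rw [← h', ← Category.assoc, h, Category.assoc]

lemma comp {A A' B B' : SFunctor 𝒯} :
    A.Isomorphic A' → B.Isomorphic B' → (A.comp B).Isomorphic (A'.comp B') := by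
  rintro ⟨α, h⟩ ⟨β, h'⟩
  refine ⟨Functor.isoWhiskerRight α B.F ≪≫ Functor.isoWhiskerLeft A'.F β, fun X => ?_⟩
  have e := congrArg B.F.map (h X)
  have n := β.hom.naturality (A'.φ.hom.app X)
  have n' := B.φ.hom.naturality (α.hom.app X)
  have h' := h' (A'.F.obj X)
  simp only [comp_φ_hom_app, Functor.map_comp, Functor.comp_map, Functor.comp_obj,
    Category.assoc, comp_F, Iso.trans_hom, NatTrans.comp_app, Functor.isoWhiskerRight_hom,
    Functor.isoWhiskerLeft_hom, Functor.whiskerRight_app, Functor.whiskerLeft_app] at *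
  rw [← reassoc_of% n', h', reassoc_of% e, reassoc_of% n]

end Isomorphic

lemma id_comp_isomorphic (A : SFunctor 𝒯) : ((SFunctor.id 𝒯).comp A).Isomorphic A :=
  ⟨Functor.leftUnitor _, fun X => by simp [comp_φ_hom_app, id_φ_hom_app]⟩

lemma comp_id_isomorphic (A : SFunctor 𝒯) : (A.comp (SFunctor.id 𝒯)).Isomorphic A :=
  ⟨Functor.rightUnitor _, fun X => by simp [comp_φ_hom_app, id_φ_hom_app]⟩

lemma comp_assoc_isomorphic (A B D : SFunctor 𝒯) :
    ((A.comp B).comp D).Isomorphic (A.comp (B.comp D)) :=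
  ⟨Functor.associator _ _ _, fun X => by simp [comp_φ_hom_app]⟩

variable (𝒯) in
/-- Isomorphism of functors with commutation, as a setoid. -/
def isoSetoid : Setoid (SFunctor 𝒯) where
  r := Isomorphic
  iseqv := ⟨Isomorphic.refl, Isomorphic.symm, Isomorphic.trans⟩

variable (𝒯) in
/-- Isomorphism classes of functors with commutation. -/
def IsoClass := _root_.Quotient (isoSetoid 𝒯)

/-- The isomorphism class of a functor with commutation. -/
def cls (A : SFunctor 𝒯) : IsoClass 𝒯 := Quotient.mk (isoSetoid 𝒯) A

lemma cls_eq_iff {A B : SFunctor 𝒯} : A.cls = B.cls ↔ A.Isomorphic B :=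
  ⟨fun h => Quotient.exact h, fun h => Quotient.sound (s := isoSetoid 𝒯) h⟩

/-- In this monoid, identities between powers of the suspension as triangle functors become
computations with exponents of a unit, with no associativity isomorphisms to carry along. -/
instance : Monoid (IsoClass 𝒯) where
  one := (SFunctor.id 𝒯).cls
  mul := Quotient.map₂ comp (fun _ _ h _ _ h' => Isomorphic.comp h h')
  mul_assoc := by
    rintro ⟨A⟩ ⟨B⟩ ⟨D⟩
    exact cls_eq_iff.2 (comp_assoc_isomorphic A B D)
  one_mul := by
    rintro ⟨A⟩
    exact cls_eq_iff.2 (id_comp_isomorphic A)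
  mul_one := by
    rintro ⟨A⟩
    exact cls_eq_iff.2 (comp_id_isomorphic A)

lemma cls_comp (A B : SFunctor 𝒯) : (A.comp B).cls = A.cls * B.cls := rfl

lemma cls_id : (SFunctor.id 𝒯).cls = 1 := rfl

lemma cls_npow (A : SFunctor 𝒯) (n : ℕ) : (A.npow n).cls = A.cls ^ n := by
  induction n with
  | zero => rw [pow_zero]; rfl
  | succ n ih => rw [pow_succ, ← ih]; rfl

end

section

variable {C : Type u} [Category.{v} C] [Preadditive C] (𝒯 : TriData C)

lemma susp_φ_hom_app (X : C) : (susp 𝒯).φ.hom.app X = -𝟙 _ := by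
  simp [susp, negIso]
  rfl

lemma suspInv_φ_hom_app (X : C) : (suspInv 𝒯).φ.hom.app X =
    -(𝒯.S.unitInv.app X ≫ 𝒯.S.counitInv.app X) := by
  simp [suspInv, negIso]

lemma susp_comp_φ_hom_app (B : SFunctor 𝒯) [B.F.Additive] (X : C) :
    ((susp 𝒯).comp B).φ.hom.app X = -B.φ.hom.app (𝒯.S.functor.obj X) := by
  rw [comp_φ_hom_app, susp_φ_hom_app]
  let S := 𝒯.S.functor
  change B.F.map (-𝟙 (S.obj (S.obj X))) ≫ (B.φ.hom.app (S.obj X) :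
    B.F.obj (S.obj (S.obj X)) ⟶ S.obj (B.F.obj (S.obj X))) = _
  rw [Functor.map_neg, B.F.map_id, Preadditive.neg_comp, Category.id_comp]

lemma comp_susp_φ_hom_app (A : SFunctor 𝒯) (X : C) :
    (A.comp (susp 𝒯)).φ.hom.app X = -𝒯.S.functor.map (A.φ.hom.app X) := by
  rw [comp_φ_hom_app, susp_φ_hom_app]
  refine (Preadditive.comp_neg _ _).trans ?_
  exact congrArg Neg.neg (Category.comp_id _)

/-- The signs in the commutations of `susp` and `suspInv` cancel; what remains is a triangle
identity of the equivalence. -/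
lemma susp_comp_suspInv [𝒯.S.functor.Additive] :
    ((susp 𝒯).comp (suspInv 𝒯)).Isomorphic (SFunctor.id 𝒯) := by
  refine ⟨𝒯.S.unitIso.symm, fun X => ?_⟩
  have : (suspInv 𝒯).F.Additive := 𝒯.S.inverse_additive
  rw [susp_comp_φ_hom_app, suspInv_φ_hom_app, id_φ_hom_app]
  let S := 𝒯.S.functor
  let R := 𝒯.S.inverse
  let a : R.obj (S.obj (S.obj X)) ⟶ S.obj X := 𝒯.S.unitInv.app (S.obj X)
  let b : S.obj X ⟶ S.obj (R.obj (S.obj X)) := 𝒯.S.counitInv.app (S.obj X)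
  let c : R.obj (S.obj X) ⟶ X := 𝒯.S.unitInv.app X
  change (- -(a ≫ b)) ≫ S.map c = a ≫ 𝟙 _
  have h : b ≫ S.map c = 𝟙 _ := 𝒯.S.counitInv_functor_comp X
  rw [neg_neg, Category.assoc, h]

lemma suspInv_comp_susp [𝒯.S.functor.Additive] :
    ((suspInv 𝒯).comp (susp 𝒯)).Isomorphic (SFunctor.id 𝒯) := by
  refine ⟨𝒯.S.counitIso, fun X => ?_⟩
  rw [comp_susp_φ_hom_app, suspInv_φ_hom_app, id_φ_hom_app]
  let S := 𝒯.S.functor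
  let R := 𝒯.S.inverse
  let a : R.obj (S.obj X) ⟶ X := 𝒯.S.unitInv.app X
  let b : X ⟶ S.obj (R.obj X) := 𝒯.S.counitInv.app X
  let c : S.obj (R.obj X) ⟶ X := 𝒯.S.counit.app X
  let d : S.obj (R.obj (S.obj X)) ⟶ S.obj X := 𝒯.S.counit.app (S.obj X)
  let a' : X ⟶ R.obj (S.obj X) := 𝒯.S.unit.app X
  change (-S.map (-(a ≫ b))) ≫ S.map c = d ≫ 𝟙 _
  have h : b ≫ c = 𝟙 _ := 𝒯.S.counitIso.inv_hom_id_app X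
  have h' : S.map a' ≫ d = 𝟙 _ := 𝒯.S.functor_unitIso_comp X
  have h'' : a ≫ a' = 𝟙 _ := 𝒯.S.unitIso.inv_hom_id_app X
  rw [Functor.map_neg, neg_neg, ← Functor.map_comp, Category.assoc, h, Category.comp_id,
    Category.comp_id]
  rw [← Category.id_comp d, ← S.map_id, ← h'', S.map_comp, Category.assoc, h', Category.comp_id]

/-- The class of the suspension, a unit. -/
def suspUnit [𝒯.S.functor.Additive] : (IsoClass 𝒯)ˣ where
  val := (susp 𝒯).cls
  inv := (suspInv 𝒯).cls
  val_inv := cls_eq_iff.2 (susp_comp_suspInv 𝒯)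
  inv_val := cls_eq_iff.2 (suspInv_comp_susp 𝒯)

lemma cls_suspPow [𝒯.S.functor.Additive] (d : ℤ) :
    (suspPow 𝒯 d).cls = ((suspUnit 𝒯 ^ d : (IsoClass 𝒯)ˣ) : IsoClass 𝒯) := by
  cases d with
  | ofNat n => rw [Int.ofNat_eq_natCast, zpow_natCast, Units.val_pow_eq_pow_val]; exact cls_npow _ _
  | negSucc n =>
    rw [zpow_negSucc, ← inv_pow, Units.val_pow_eq_pow_val]; exact cls_npow _ _

end

section

variable {C : Type u} [Category.{v} C] {𝒯 : TriData C}

lemma IsTriangle.comp {A B : SFunctor 𝒯} (hA : A.IsTriangle) (hB : B.IsTriangle) :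
    (A.comp B).IsTriangle := by
  intro X Y Z f g h hd
  have := hB _ _ _ (hA _ _ _ hd)
  rw [comp_φ_hom_app]
  simpa using this

end

end SFunctor

/-! ### Orders of the suspension -/

/-- The least positive exponent of an element of finite order divides every exponent. -/
lemma exists_isLeast_dvd {M : Type*} [Monoid M] (x : M) {N : ℕ} (hN : 0 < N) (h : x ^ N = 1) :
    ∃ m, IsLeast {m : ℕ | 0 < m ∧ x ^ m = 1} m ∧ m ∣ N :=
  ⟨orderOf x, ⟨⟨orderOf_pos_iff.2 (isOfFinOrder_iff_pow_eq_one.2 ⟨N, hN, h⟩), pow_orderOf_eq_one x⟩,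
    fun _ hm => orderOf_le_of_pow_eq_one hm.1 hm.2⟩, orderOf_dvd_of_pow_eq_one h⟩

section

variable {C : Type u} [Category.{v} C] [Preadditive C] (𝒯 : TriData C)

lemma HasSuspensionOrder.exists_of_isomorphic {N : ℕ} (hN : 0 < N)
    (h : (SFunctor.suspPow 𝒯 N).Isomorphic (SFunctor.id 𝒯)) :
    ∃ m, HasSuspensionOrder 𝒯 m ∧ m ∣ N := by
  have key (m : ℕ) : (SFunctor.suspPow 𝒯 m).Isomorphic (SFunctor.id 𝒯) ↔
      (SFunctor.susp 𝒯).cls ^ m = 1 := by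
    rw [← SFunctor.cls_npow, ← SFunctor.cls_id, SFunctor.cls_eq_iff]; rfl
  obtain ⟨m, hm, hd⟩ := exists_isLeast_dvd _ hN ((key N).1 h)
  refine ⟨m, ?_, hd⟩
  simpa only [HasSuspensionOrder, key] using hm

lemma HasPlainSuspensionOrder.exists_of_iso {N : ℕ} (hN : 0 < N)
    (h : Nonempty ((SFunctor.suspPow 𝒯 N).F ≅ 𝟭 C)) :
    ∃ m, HasPlainSuspensionOrder 𝒯 m ∧ m ∣ N := by
  -- Isomorphism classes of plain endofunctors form a monoid under composition, namely the skeleton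
  -- of a monoidal category; the order argument applies there.
  let := endofunctorMonoidalCategory C
  let x : Skeleton (C ⥤ C) := toSkeleton (SFunctor.susp 𝒯).F
  have hpow (m : ℕ) : toSkeleton (SFunctor.suspPow 𝒯 m).F = x ^ m := by
    induction m with
    | zero => rw [pow_zero]; rfl
    | succ m ih => rw [pow_succ, ← ih]; exact Skeleton.toSkeleton_tensorObj (C := C ⥤ C) _ _
  have key (m : ℕ) : Nonempty ((SFunctor.suspPow 𝒯 m).F ≅ 𝟭 C) ↔ x ^ m = 1 := by
    rw [← hpow]
    exact (toSkeleton_eq_toSkeleton_iff).symm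
  obtain ⟨m, hm, hd⟩ := exists_isLeast_dvd _ hN ((key N).1 h)
  refine ⟨m, ?_, hd⟩
  simpa only [HasPlainSuspensionOrder, key] using hm

end

end

section

/-! ### Short exact sequences with specified terms -/

/-- A short exact sequence `0 ⟶ A ⟶ B ⟶ C ⟶ 0`. -/
structure SES {E : Type u} [Category.{v} E] [Preadditive E] (A B C : E) where
  /-- the monomorphism -/
  f : A ⟶ B
  /-- the epimorphism -/
  g : B ⟶ C
  w : f ≫ g = 0
  shortExact : (ShortComplex.mk f g w).ShortExact

namespace SES

attribute [local instance] Stable.abelian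

variable {E : Type u} [Category.{v} E] [Preadditive E]
variable {A B C A' B' C' : E}

instance (s : SES A B C) : Mono s.f := s.shortExact.mono_f
instance (s : SES A B C) : Epi s.g := s.shortExact.epi_g

/-- The short exact sequence with the sign of the epimorphism changed. -/
def neg (s : SES A B C) : SES A B C where
  f := s.f
  g := -s.g
  w := by rw [Preadditive.comp_neg, s.w, neg_zero]
  shortExact := ShortComplex.shortExact_of_iso
    (ShortComplex.isoMk (S₁ := ShortComplex.mk s.f s.g s.w) (Iso.refl A) (Iso.refl B)
      ⟨-𝟙 C, -𝟙 C, by simp, by simp⟩) s.shortExact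

/-- Change of the middle term along an isomorphism. -/
def changeMiddle (s : SES A B C) (e : B ≅ B') : SES A B' C where
  f := s.f ≫ e.hom
  g := e.inv ≫ s.g
  w := by simp [s.w]
  shortExact := ShortComplex.shortExact_of_iso
    (ShortComplex.isoMk (S₁ := ShortComplex.mk s.f s.g s.w) (Iso.refl A) e (Iso.refl C)) s.shortExact

variable [IsFrobeniusAbelian E]

lemma exists_lift (s : SES A B C) {W : E} (x : W ⟶ B) (h : x ≫ s.g = 0) :
    ∃ y : W ⟶ A, y ≫ s.f = x :=
  ⟨s.shortExact.exact.lift x h, s.shortExact.exact.lift_f x h⟩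

lemma exists_desc (s : SES A B C) {W : E} (x : B ⟶ W) (h : s.f ≫ x = 0) :
    ∃ y : C ⟶ W, s.g ≫ y = x := by
  have : Epi (ShortComplex.mk s.f s.g s.w).g := s.shortExact.epi_g
  exact ⟨s.shortExact.exact.desc x h, s.shortExact.exact.g_desc x h⟩

lemma exists_extend (s : SES A B C) (t : SES A' B' C') [Injective B'] (a : A ⟶ A') :
    ∃ (b : B ⟶ B') (c : C ⟶ C'), s.f ≫ b = a ≫ t.f ∧ s.g ≫ c = b ≫ t.g := by
  have hb := Injective.comp_factorThru (a ≫ t.f) s.f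
  obtain ⟨c, hc⟩ := s.exists_desc (Injective.factorThru (a ≫ t.f) s.f ≫ t.g)
    (by rw [reassoc_of% hb, t.w, comp_zero])
  exact ⟨_, c, hb, hc⟩

/-- A morphism of short exact sequences. -/
def toHom (s : SES A B C) (t : SES A' B' C') {a : A ⟶ A'} {b : B ⟶ B'} {c : C ⟶ C'}
    (h₁ : s.f ≫ b = a ≫ t.f) (h₂ : s.g ≫ c = b ≫ t.g) :
    ShortComplex.mk s.f s.g s.w ⟶ ShortComplex.mk t.f t.g t.w where
  τ₁ := a
  τ₂ := b
  τ₃ := c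
  comm₁₂ := h₁.symm
  comm₂₃ := h₂.symm

/-- The cokernel sequence of a monomorphism. -/
def ofMono {A B : E} (f : A ⟶ B) [Mono f] : SES A B (cokernel f) where
  f := f
  g := cokernel.π f
  w := cokernel.condition f
  shortExact :=
    { exact := ShortComplex.exact_of_g_is_cokernel _ (cokernelIsCokernel f)
      mono_f := inferInstance
      epi_g := inferInstanceAs (Epi (cokernel.π f)) }

/-- The image of a short exact sequence under an exact functor. -/
def map (s : SES A B C) (Φ : E ⥤ E) [Φ.IsEquivalence] [Φ.Additive] :
    SES (Φ.obj A) (Φ.obj B) (Φ.obj C) where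
  f := Φ.map s.f
  g := Φ.map s.g
  w := by rw [← Φ.map_comp, s.w, Φ.map_zero]
  shortExact := s.shortExact.map_of_exact Φ

end SES

namespace Stable

attribute [local instance] abelian

variable {E : Type u} [Category.{v} E] [Preadditive E] [IsFrobeniusAbelian E]

/-- The middle term of the chosen sequence `X ⟶ I ⟶ S X`. -/
def hull (X : E) : E := (injSeq X).X₂

/-- The last term of the chosen sequence `X ⟶ I ⟶ S X`. -/
def cosyzygy (X : E) : E := (injSeq X).X₃

/-- The chosen sequence `X ⟶ I ⟶ S X`. -/
def std (X : E) : SES X (hull X) (cosyzygy X) where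
  f := (injSeq X).f
  g := (injSeq X).g
  w := (injSeq X).zero
  shortExact := injSeq_shortExact X

instance (X : E) : Injective (hull X) := inferInstanceAs (Injective (injSeq X).X₂)

section

variable {A B C A' B' C' : E}

/-! ### Connecting morphisms -/

/-- The connecting morphism `C ⟶ Σ A` of a short exact sequence. -/
def connecting (s : SES A B C) : (proj E).obj C ⟶ (suspFunctor E).obj ((proj E).obj A) :=
  (proj E).map (exists_extend (t := injSeq A) s.shortExact (𝟙 _)).choose.τ₃

/-- Two extensions of the same map to a sequence with injective middle term agree stably on the
third term, so the choice in `connecting` is immaterial. -/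
lemma connecting_eq_of_hom (s : SES A B C) (α : ShortComplex.mk s.f s.g s.w ⟶ injSeq A)
    (hα : α.τ₁ = 𝟙 A) : connecting s = (proj E).map α.τ₃ :=
  map_τ₃_eq s.shortExact _ _
    (by rw [(exists_extend (t := injSeq A) s.shortExact (𝟙 _)).choose_spec]
        exact congrArg _ hα.symm)

/-- Both composites are third components of morphisms from `s` to the standard sequence of `A'` with
first component `a`. All later compatibilities are instances of this one. -/
lemma connecting_naturality (s : SES A B C) (t : SES A' B' C') {a : A ⟶ A'} {b : B ⟶ B'}
    {c : C ⟶ C'} (h₁ : s.f ≫ b = a ≫ t.f) (h₂ : s.g ≫ c = b ≫ t.g) :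
    connecting s ≫ (suspFunctor E).map ((proj E).map a) = (proj E).map c ≫ connecting t := by
  let α := (exists_extend (t := injSeq A) s.shortExact (𝟙 _)).choose
  have hα : α.τ₁ = 𝟙 _ := (exists_extend (t := injSeq A) s.shortExact (𝟙 _)).choose_spec
  let α' := (exists_extend (t := injSeq A') t.shortExact (𝟙 _)).choose
  have hα' : α'.τ₁ = 𝟙 _ := (exists_extend (t := injSeq A') t.shortExact (𝟙 _)).choose_spec
  have h : (suspFunctor E).map ((proj E).map a) = (proj E).map (extend a).τ₃ := rfl
  rw [h]
  refine ((proj E).map_comp α.τ₃ (extend a).τ₃).symm.trans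
    (Eq.trans ?_ ((proj E).map_comp c α'.τ₃))
  refine map_τ₃_eq s.shortExact (α ≫ extend a) (s.toHom t h₁ h₂ ≫ α') ?_
  rw [ShortComplex.comp_τ₁, ShortComplex.comp_τ₁, hα, hα', extend_τ₁]
  exact congrArg _ ((Category.id_comp _).trans (Category.comp_id _).symm)

lemma connecting_naturality_id (s : SES A B C) (t : SES A B' C') {b : B ⟶ B'}
    {c : C ⟶ C'} (h₁ : s.f ≫ b = t.f) (h₂ : s.g ≫ c = b ≫ t.g) :
    connecting s = (proj E).map c ≫ connecting t := by
  rw [← connecting_naturality s t (a := 𝟙 A) (by rw [h₁, Category.id_comp]) h₂, (proj E).map_id,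
    (suspFunctor E).map_id, Category.comp_id]

lemma connecting_std (X : E) : connecting (std X) = 𝟙 _ :=
  (connecting_eq_of_hom (std X) (𝟙 (injSeq X)) rfl).trans ((proj E).map_id _)

instance isIso_connecting_std (X : E) : IsIso (connecting (std X)) := by
  rw [connecting_std]
  exact inferInstanceAs (IsIso (𝟙 ((proj E).obj (cosyzygy X))))

/-- Schanuel's argument: `s` and the standard sequence of `A` map to each other over the identity of
`A`, and the composites are stably the identity on the third terms. -/
instance isIso_connecting (s : SES A B C) [Injective B] : IsIso (connecting s) := by
  obtain ⟨b, c, h₁, h₂⟩ := s.exists_extend (std A) (𝟙 A)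
  obtain ⟨b', c', h₁', h₂'⟩ := (std A).exists_extend s (𝟙 A)
  rw [Category.id_comp] at h₁ h₁'
  have e := connecting_naturality_id s (std A) h₁ h₂
  have e' := connecting_naturality_id (std A) s h₁' h₂'
  have h : (proj E).map c ≫ (proj E).map c' = 𝟙 _ := by
    rw [← (proj E).map_comp]
    refine Eq.trans ?_ ((proj E).map_id _)
    refine map_τ₃_eq s.shortExact (t := ShortComplex.mk s.f s.g s.w)
      (s.toHom s (a := 𝟙 A) (b := b ≫ b') (c := c ≫ c') ?_ ?_) (𝟙 _) rfl
    · rw [reassoc_of% h₁, h₁', Category.id_comp]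
    · rw [reassoc_of% h₂, h₂', Category.assoc]
  have h' : (proj E).map c' ≫ (proj E).map c = 𝟙 _ := by
    have : connecting (std A) ≫ 𝟙 _ = ((proj E).map c' ≫ (proj E).map c) ≫ connecting (std A) := by
      rw [Category.assoc, ← e, ← e', Category.comp_id]
    rw [← cancel_mono (connecting (std A)), ← this, Category.comp_id, Category.id_comp]
  have : IsIso ((proj E).map c) := ⟨_, h, h'⟩
  rw [e]
  infer_instance

/-- Naturality for the morphism `(1, 1, -1)` of sequences. -/
lemma connecting_neg (s : SES A B C) : connecting s.neg = -connecting s := by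
  have h := connecting_naturality_id s s.neg (b := 𝟙 B) (c := -𝟙 C) (Category.comp_id _)
    (by rw [Preadditive.comp_neg, Category.comp_id, Category.id_comp]; rfl)
  rw [h, (proj E).map_neg, (proj E).map_id, Preadditive.neg_comp, Category.id_comp, neg_neg]

lemma connecting_changeMiddle (s : SES A B C) (e : B ≅ B') :
    connecting (s.changeMiddle e) = connecting s := by
  have h := connecting_naturality_id s (s.changeMiddle e) (b := e.hom) (c := 𝟙 C) rfl
    (by rw [Category.comp_id]; exact (e.hom_inv_id_assoc _).symm)
  rw [h, (proj E).map_id, Category.id_comp]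

end

/-- The sum of extensions of `f` and of `g` is an extension of `f + g`, and any extension computes
the suspension. -/
instance : (suspFunctor E).Additive where
  map_add {X Y} f g := by
    obtain ⟨X⟩ := X
    obtain ⟨Y⟩ := Y
    obtain ⟨f, rfl⟩ := (proj E).map_surjective f
    obtain ⟨g, rfl⟩ := (proj E).map_surjective g
    obtain ⟨b, c, h₁, h₂⟩ := (std X).exists_extend (std Y) f
    obtain ⟨b', c', h₁', h₂'⟩ := (std X).exists_extend (std Y) g
    have e := connecting_naturality _ _ h₁ h₂
    have e' := connecting_naturality _ _ h₁' h₂'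
    have e'' := connecting_naturality (std X) (std Y) (a := f + g) (b := b + b') (c := c + c')
      (by rw [Preadditive.comp_add, h₁, h₁', Preadditive.add_comp])
      (by rw [Preadditive.comp_add, h₂, h₂', Preadditive.add_comp])
    rw [(proj E).map_add, (proj E).map_add, Preadditive.add_comp, ← e, ← e',
      ← Preadditive.comp_add, cancel_epi] at e''
    exact e''

/-! ### Distinguished triangles -/

lemma dist_iff {X Y Z : StableCat E} (f : X ⟶ Y) (g : Y ⟶ Z) (h : Z ⟶ (suspFunctor E).obj X) :
    (triData E).dist f g h ↔ ∃ (A B C : E) (s : SES A B C)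
      (eX : X ≅ (proj E).obj A) (eY : Y ≅ (proj E).obj B) (eZ : Z ≅ (proj E).obj C),
      f ≫ eY.hom = eX.hom ≫ (proj E).map s.f ∧
      g ≫ eZ.hom = eY.hom ≫ (proj E).map s.g ∧
      h ≫ (suspFunctor E).map eX.hom = -(eZ.hom ≫ connecting s) := by
  constructor
  · rintro ⟨s, hs, α, hα, eX, eY, eZ, h₁, h₂, h₃⟩
    refine ⟨s.X₁, s.X₂, s.X₃, ⟨s.f, s.g, s.zero, hs⟩, eX, eY, eZ, h₁, h₂, ?_⟩
    rw [connecting_eq_of_hom _ α hα]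
    exact h₃
  · rintro ⟨A, B, C, s, eX, eY, eZ, h₁, h₂, h₃⟩
    obtain ⟨α, hα⟩ := exists_extend (t := injSeq A) s.shortExact (𝟙 _)
    refine ⟨_, s.shortExact, α, hα, eX, eY, eZ, h₁, h₂, ?_⟩
    rw [connecting_eq_of_hom s α hα] at h₃
    exact h₃

lemma dist_of_iso {X Y Z X' Y' Z' : StableCat E} {f : X ⟶ Y} {g : Y ⟶ Z}
    {h : Z ⟶ (suspFunctor E).obj X} {f' : X' ⟶ Y'} {g' : Y' ⟶ Z'}
    {h' : Z' ⟶ (suspFunctor E).obj X'} (eX : X' ≅ X) (eY : Y' ≅ Y) (eZ : Z' ≅ Z)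
    (hf : f' ≫ eY.hom = eX.hom ≫ f) (hg : g' ≫ eZ.hom = eY.hom ≫ g)
    (hh : h' ≫ (suspFunctor E).map eX.hom = eZ.hom ≫ h)
    (hd : (triData E).dist f g h) : (triData E).dist f' g' h' := by
  rw [dist_iff] at hd ⊢
  obtain ⟨A, B, C, s, aX, aY, aZ, h₁, h₂, h₃⟩ := hd
  refine ⟨A, B, C, s, eX ≪≫ aX, eY ≪≫ aY, eZ ≪≫ aZ, ?_, ?_, ?_⟩
  · rw [Iso.trans_hom, Iso.trans_hom, reassoc_of% hf, h₁, Category.assoc]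
  · rw [Iso.trans_hom, Iso.trans_hom, reassoc_of% hg, h₂, Category.assoc]
  · rw [Iso.trans_hom, Iso.trans_hom, Functor.map_comp, reassoc_of% hh, h₃, Category.assoc,
      Preadditive.comp_neg]

section

variable {A B C I D : E}

/-- The mapping cone sequence `B ⟶ C ⊕ I ⟶ D` of a morphism from `A ⟶ B ⟶ C` to `A ⟶ I ⟶ D`
which is the identity on `A`. -/
def cone (s : SES A B C) (t : SES A I D) (b : B ⟶ I) (c : C ⟶ D) (h₁ : s.f ≫ b = t.f)
    (h₂ : s.g ≫ c = b ≫ t.g) : SES B (C ⊞ I) D where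
  f := biprod.lift s.g b
  g := biprod.desc c (-t.g)
  w := by rw [biprod.lift_desc, Preadditive.comp_neg, h₂, add_neg_cancel]
  shortExact := by
    refine ShortComplex.ShortExact.mk' ?_ ?_ ?_
    · rw [ShortComplex.exact_iff_exact_up_to_refinements]
      intro W x hx
      obtain ⟨y, z, rfl⟩ : ∃ y z, x = biprod.lift y z :=
        ⟨x ≫ biprod.fst, x ≫ biprod.snd, by
          apply biprod.hom_ext <;> simp⟩
      replace hx : biprod.lift y z ≫ biprod.desc c (-t.g) = 0 := hx
      rw [biprod.lift_desc, Preadditive.comp_neg, ← sub_eq_add_neg, sub_eq_zero] at hx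
      -- Element chase up to an epimorphism `π`: lift `y` to `b'` in `B`; then `z - b' ≫ b` dies in
      -- `D`, so it comes from some `a` in `A`, and `b' + a ≫ s.f` is the required preimage.
      obtain ⟨W', π, hπ, b', hb⟩ := surjective_up_to_refinements_of_epi s.g y
      obtain ⟨a, ha⟩ := t.exists_lift (π ≫ z - b' ≫ b) (by
        rw [Preadditive.sub_comp, Category.assoc, Category.assoc, ← h₂, ← hx, reassoc_of% hb,
          sub_self])
      refine ⟨W', π, hπ, b' + a ≫ s.f, ?_⟩
      change π ≫ biprod.lift y z = (b' + a ≫ s.f) ≫ biprod.lift s.g b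
      apply biprod.hom_ext
      · simp [hb, s.w]
      · simp [ha, h₁]
    · change Mono (biprod.lift s.g b)
      refine Preadditive.mono_of_cancel_zero _ fun {W} x hx => ?_
      have hx₁ : x ≫ s.g = 0 := by simpa using congrArg (· ≫ biprod.fst) hx
      have hx₂ : x ≫ b = 0 := by simpa using congrArg (· ≫ biprod.snd) hx
      obtain ⟨y, rfl⟩ := s.exists_lift x hx₁
      rw [Category.assoc, h₁] at hx₂
      rw [zero_of_comp_mono _ hx₂, zero_comp]
    · change Epi (biprod.desc c (-t.g))
      have : Epi ((biprod.inr : I ⟶ C ⊞ I) ≫ biprod.desc c (-t.g)) := by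
        rw [biprod.inr_desc]; infer_instance
      exact epi_of_epi biprod.inr _

/-- In the stable category, an injective summand may be dropped. -/
def projBiprodIso (X I : E) [Injective I] : (proj E).obj (X ⊞ I) ≅ (proj E).obj X where
  hom := (proj E).map biprod.fst
  inv := (proj E).map biprod.inl
  hom_inv_id := by
    rw [← Functor.map_comp, ← (proj E).map_id, Quotient.functor_map_eq_iff]
    refine ⟨I, inferInstance, -biprod.snd, biprod.inr, ?_⟩
    rw [sub_eq_iff_eq_add, ← biprod.total, Preadditive.neg_comp]
    abel
  inv_hom_id := by rw [← Functor.map_comp, biprod.inl_fst, (proj E).map_id]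

/-- The morphism `(s.f, inr, -1)` goes from `t` to the cone sequence; the `-1` is forced by the
`-t.g` in the cone. -/
lemma connecting_cone (s : SES A B C) (t : SES A I D) (b : B ⟶ I) (c : C ⟶ D)
    (h₁ : s.f ≫ b = t.f) (h₂ : s.g ≫ c = b ≫ t.g) : connecting (cone s t b c h₁ h₂) =
      -(connecting t ≫ (suspFunctor E).map ((proj E).map s.f)) := by
  have h := connecting_naturality t (cone s t b c h₁ h₂) (a := s.f) (b := biprod.inr)
    (c := -𝟙 _)
    (by
      change _ = s.f ≫ biprod.lift s.g b
      apply biprod.hom_ext <;> simp [s.w, h₁])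
    (by
      change _ = biprod.inr ≫ biprod.desc c (-t.g)
      rw [biprod.inr_desc, Preadditive.comp_neg, Category.comp_id])
  rw [h, (proj E).map_neg, (proj E).map_id, Preadditive.neg_comp, Category.id_comp, neg_neg]

end

/-- The negative of an isomorphism. -/
@[simps]
def negIso {C : Type*} [Category* C] [Preadditive C] {X Y : C} (e : X ≅ Y) : X ≅ Y where
  hom := -e.hom
  inv := -e.inv

/-- Rotation of distinguished triangles. -/
lemma dist_rotate {X Y Z : StableCat E} {f : X ⟶ Y} {g : Y ⟶ Z} {h : Z ⟶ (suspFunctor E).obj X}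
    (hd : (triData E).dist f g h) : (triData E).dist g h (-(suspFunctor E).map f) := by
  rw [dist_iff] at hd
  obtain ⟨A, B, C, s, eX, eY, eZ, h₁, h₂, h₃⟩ := hd
  obtain ⟨b, c, hb, hc⟩ := s.exists_extend (std A) (𝟙 A)
  rw [Category.id_comp] at hb
  -- Stably the summand `hull A` vanishes, so the cone sequence `B ⟶ C ⊞ hull A ⟶ cosyzygy A`
  -- represents the rotated triangle.
  let t := cone s (std A) b c hb hc
  -- The sign compensates the minus in the last morphism of a distinguished triangle and makes the
  -- square with `h` and `c` commute.
  let e₃ : (suspFunctor E).obj X ≅ (proj E).obj (cosyzygy A) :=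
    negIso ((suspFunctor E).mapIso eX ≪≫ (asIso (connecting (std A))).symm)
  let p : (proj E).obj (C ⊞ hull A) ≅ (proj E).obj C := projBiprodIso _ _
  have e := connecting_naturality_id s (std A) hb hc
  rw [dist_iff]
  refine ⟨_, _, _, t, eY, eZ ≪≫ p.symm, e₃, ?_, ?_, ?_⟩
  · rw [Iso.trans_hom, Iso.symm_hom, ← Category.assoc, Iso.comp_inv_eq, h₂, Category.assoc]
    congr 1
    refine Eq.trans ?_ ((proj E).map_comp _ _)
    exact congrArg _ (biprod.lift_fst _ _).symm
  · have : p.inv ≫ (proj E).map t.g = (proj E).map c :=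
      ((proj E).map_comp _ _).symm.trans (congrArg _ (biprod.inl_desc _ _))
    rw [Iso.trans_hom, Iso.symm_hom, Category.assoc, this, negIso_hom, Iso.trans_hom,
      Iso.symm_hom, asIso_inv, Functor.mapIso_hom, Preadditive.comp_neg, reassoc_of% h₃,
      Preadditive.neg_comp, neg_neg, Category.assoc, e, Category.assoc, IsIso.hom_inv_id,
      Category.comp_id]
  · rw [connecting_cone, negIso_hom, Iso.trans_hom, Iso.symm_hom, asIso_inv, Functor.mapIso_hom,
      Preadditive.neg_comp_neg, Category.assoc, IsIso.inv_hom_id_assoc, ← Functor.map_comp, ← h₁,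
      Functor.map_comp, Preadditive.neg_comp]

/-- Three rotations give the triangle with morphisms `-σf, -σg, -σh`. Multiplying the middle object
by `-1` removes the first two signs; the third is the sign in the commutation of `susp`. -/
lemma susp_isTriangle : (SFunctor.susp (triData E)).IsTriangle := by
  intro X Y Z f g h hd
  have hd' := dist_rotate (dist_rotate (dist_rotate hd))
  rw [SFunctor.susp_φ_hom_app]
  let σ := suspFunctor E
  let h₀ : Z ⟶ σ.obj X := h
  change (triData E).dist (σ.map f) (σ.map g) (σ.map h₀ ≫ (-𝟙 (σ.obj (σ.obj X))))
  refine dist_of_iso (Iso.refl _) (negIso (Iso.refl _)) (Iso.refl _) ?_ ?_ ?_ hd'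
  · simp only [negIso_hom, Iso.refl_hom, Preadditive.comp_neg, Category.comp_id, Category.id_comp]
    rfl
  · simp only [negIso_hom, Iso.refl_hom, Preadditive.neg_comp_neg, Category.comp_id,
      Category.id_comp]
    rfl
  · change (σ.map h₀ ≫ (-𝟙 (σ.obj (σ.obj X)))) ≫ σ.map (𝟙 (σ.obj X)) = 𝟙 (σ.obj Z) ≫ (-σ.map h₀)
    rw [σ.map_id, Preadditive.comp_neg, Category.comp_id, Category.comp_id, Category.id_comp]

end Stable

end

section

namespace SFunctor

variable {E : Type u} [Category.{v} E] [Preadditive E] [IsFrobeniusAbelian E]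

lemma IsTriangle.of_isomorphic {A B : SFunctor (Stable.triData E)} (hA : A.IsTriangle)
    (h : A.Isomorphic B) : B.IsTriangle := by
  obtain ⟨α, hα⟩ := h
  intro X Y Z f g h hd
  refine Stable.dist_of_iso (α.symm.app X) (α.symm.app Y) (α.symm.app Z) (α.inv.naturality f)
    (α.inv.naturality g) ?_ (hA f g h hd)
  have hα := hα X
  have n := α.inv.naturality h
  let σ := Stable.suspFunctor E
  let a : A.F.obj X ⟶ B.F.obj X := α.hom.app X
  let a' : B.F.obj X ⟶ A.F.obj X := α.inv.app X
  let b : A.F.obj (σ.obj X) ⟶ B.F.obj (σ.obj X) := α.hom.app (σ.obj X)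
  let b' : B.F.obj (σ.obj X) ⟶ A.F.obj (σ.obj X) := α.inv.app (σ.obj X)
  let c : B.F.obj Z ⟶ A.F.obj Z := α.inv.app Z
  let φ : A.F.obj (σ.obj X) ⟶ σ.obj (A.F.obj X) := A.φ.hom.app X
  let ψ : B.F.obj (σ.obj X) ⟶ σ.obj (B.F.obj X) := B.φ.hom.app X
  let h' : Z ⟶ σ.obj X := h
  change (B.F.map h' ≫ ψ) ≫ σ.map a' = c ≫ A.F.map h' ≫ φ
  replace hα : φ ≫ σ.map a = b ≫ ψ := hα
  replace n : B.F.map h' ≫ b' = c ≫ A.F.map h' := n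
  have ha : a ≫ a' = 𝟙 _ := α.hom_inv_id_app X
  have hb : b' ≫ b = 𝟙 _ := α.inv_hom_id_app (σ.obj X)
  rw [← reassoc_of% n, Category.assoc]
  congr 1
  rw [← Category.id_comp ψ, ← hb, Category.assoc, Category.assoc, ← reassoc_of% hα,
    ← Functor.map_comp, ha, σ.map_id, Category.comp_id]

end SFunctor

namespace Stable

attribute [local instance] abelian

variable {E : Type u} [Category.{v} E] [Preadditive E] [IsFrobeniusAbelian E]

/-! ### Exact autoequivalences induce triangle functors of the stable category -/

instance injective_obj (Φ : E ⥤ E) [Φ.IsEquivalence] (X : E) [Injective X] : Injective (Φ.obj X) :=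
  Adjunction.map_injective Φ.asEquivalence.symm.toAdjunction X inferInstance

section

variable (Φ Ψ : E ⥤ E) [Φ.IsEquivalence] [Φ.Additive] [Ψ.IsEquivalence] [Ψ.Additive]

/-- The functor induced on the stable category. -/
def stabFunctor : StableCat E ⥤ StableCat E :=
  CategoryTheory.Quotient.lift (rel E) (Φ ⋙ proj E) (by
    rintro X Y f g ⟨J, hJ, a, b, h⟩
    refine (Quotient.functor_map_eq_iff _ _ _).2 ⟨Φ.obj J, injective_obj Φ J, Φ.map a, Φ.map b, ?_⟩
    rw [← Φ.map_sub, h, Φ.map_comp])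

instance : (stabFunctor Φ).Additive where
  map_add {X Y} f g := by
    obtain ⟨X⟩ := X
    obtain ⟨Y⟩ := Y
    obtain ⟨f, rfl⟩ := (proj E).map_surjective f
    obtain ⟨g, rfl⟩ := (proj E).map_surjective g
    rw [← (proj E).map_add]
    refine (congrArg (proj E).map (Φ.map_add (f := f) (g := g))).trans ((proj E).map_add)

/-- The connecting morphism of the image of a short exact sequence. -/
def stabConnecting {A B C : E} (s : SES A B C) : (stabFunctor Φ).obj ((proj E).obj C) ⟶
    (suspFunctor E).obj ((stabFunctor Φ).obj ((proj E).obj A)) :=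
  connecting (s.map Φ)

instance {A B C : E} (s : SES A B C) [Injective B] : IsIso (stabConnecting Φ s) :=
  isIso_connecting (s.map Φ)

/-- The commutation of the induced functor with the suspension, on an object. -/
def stabComm (X : E) : (stabFunctor Φ).obj ((suspFunctor E).obj ((proj E).obj X)) ≅
    (suspFunctor E).obj ((stabFunctor Φ).obj ((proj E).obj X)) :=
  (stabFunctor Φ).mapIso (asIso (connecting (std X))).symm ≪≫ asIso (stabConnecting Φ (std X))

/-- The commutation is defined through the standard sequence; comparison with that sequence gives
the formula for every short exact sequence, which characterises the commutation. -/
lemma stabComm_spec {A B C : E} (s : SES A B C) :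
    (stabFunctor Φ).map (connecting s) ≫ (stabComm Φ A).hom = stabConnecting Φ s := by
  obtain ⟨b, c, hb, hc⟩ := s.exists_extend (std A) (𝟙 A)
  rw [Category.id_comp] at hb
  have e := connecting_naturality_id s (std A) hb hc
  have e' : stabConnecting Φ s = (stabFunctor Φ).map ((proj E).map c) ≫ stabConnecting Φ (std A) :=
    connecting_naturality_id (s.map Φ) ((std A).map Φ) (b := Φ.map b) (c := Φ.map c)
    ((Φ.map_comp _ _).symm.trans (congrArg Φ.map hb))
    ((Φ.map_comp _ _).symm.trans ((congrArg Φ.map hc).trans (Φ.map_comp _ _)))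
  rw [e', e, stabComm, Iso.trans_hom, Functor.mapIso_hom, Iso.symm_hom, asIso_inv,
    ← Functor.map_comp_assoc, Category.assoc, IsIso.hom_inv_id, Category.comp_id, asIso_hom]

lemma stabComm_naturality {X Y : E} (f : X ⟶ Y) :
    (stabFunctor Φ).map ((suspFunctor E).map ((proj E).map f)) ≫ (stabComm Φ Y).hom =
      (stabComm Φ X).hom ≫ (suspFunctor E).map ((stabFunctor Φ).map ((proj E).map f)) := by
  obtain ⟨b, c, hb, hc⟩ := (std X).exists_extend (std Y) f
  have e := connecting_naturality _ _ hb hc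
  have e' : stabConnecting Φ (std X) ≫ (suspFunctor E).map ((stabFunctor Φ).map ((proj E).map f)) =
      (stabFunctor Φ).map ((proj E).map c) ≫ stabConnecting Φ (std Y) :=
    connecting_naturality ((std X).map Φ) ((std Y).map Φ) (a := Φ.map f) (b := Φ.map b)
    (c := Φ.map c) ((Φ.map_comp _ _).symm.trans ((congrArg Φ.map hb).trans (Φ.map_comp _ _)))
    ((Φ.map_comp _ _).symm.trans ((congrArg Φ.map hc).trans (Φ.map_comp _ _)))
  rw [← cancel_epi ((stabFunctor Φ).map (connecting (std X))), ← Functor.map_comp_assoc, e,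
    ← Category.assoc _ (stabComm Φ X).hom, stabComm_spec, Functor.map_comp, Category.assoc,
    stabComm_spec]
  exact e'.symm

/-- The functor with commutation induced on the stable category. -/
def stab : SFunctor (triData E) where
  F := stabFunctor Φ
  φ := Quotient.natIsoLift (rel E)
    (F := suspFunctor E ⋙ stabFunctor Φ) (G := stabFunctor Φ ⋙ suspFunctor E)
    (NatIso.ofComponents (fun X => stabComm Φ X) (fun f => stabComm_naturality Φ f))

/-- An equivalence preserves short exact sequences, and `stabComm_spec` matches their connecting
morphisms. -/
lemma stab_isTriangle : (stab Φ).IsTriangle := by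
  intro X Y Z f g h hd
  obtain ⟨X⟩ := X
  obtain ⟨A, B, C, s, eX, eY, eZ, h₁, h₂, h₃⟩ := (dist_iff (X := (proj E).obj X) f g h).1 hd
  let N := stabFunctor Φ
  let X' : StableCat E := (proj E).obj X
  let h' : Z ⟶ (suspFunctor E).obj X' := h
  let eX' : X' ≅ (proj E).obj A := eX
  let f' : X' ⟶ Y := f
  refine (dist_iff (X := N.obj X') (N.map f') (N.map g) (N.map h' ≫ (stabComm Φ X).hom)).2
    ⟨_, _, _, s.map Φ, N.mapIso eX', N.mapIso eY, N.mapIso eZ, ?_, ?_, ?_⟩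
  · exact (N.map_comp f' eY.hom).symm.trans ((congrArg N.map h₁).trans (N.map_comp _ _))
  · exact (N.map_comp _ _).symm.trans ((congrArg N.map h₂).trans (N.map_comp _ _))
  · obtain ⟨a, ha⟩ := (proj E).map_surjective eX'.hom
    have n : (stabComm Φ X).hom ≫ (suspFunctor E).map (N.map eX'.hom) =
        N.map ((suspFunctor E).map eX'.hom) ≫ (stabComm Φ A).hom := by
      rw [← ha]; exact (stabComm_naturality Φ a).symm
    have h₃' : h' ≫ (suspFunctor E).map eX'.hom = -(eZ.hom ≫ connecting s) := h₃
    have : (N.map h' ≫ (stabComm Φ X).hom) ≫ (suspFunctor E).map (N.map eX'.hom) =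
        -(N.map eZ.hom ≫ N.map (connecting s) ≫ (stabComm Φ A).hom) := by
      rw [Category.assoc, n, ← Functor.map_comp_assoc, h₃', Functor.map_neg, Functor.map_comp,
        Preadditive.neg_comp, Category.assoc]
    exact this.trans (congrArg (fun x => -(N.map eZ.hom ≫ x)) (stabComm_spec Φ s))

/-- Compatibility with the suspension can be tested after composing with the isomorphism `connecting
(std X)`, where it becomes naturality of connecting morphisms. -/
lemma comm_of_connecting {M N : StableCat E ⥤ StableCat E} (η : M ⟶ N) (X : E)
    {φ : M.obj ((suspFunctor E).obj ((proj E).obj X)) ⟶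
      (suspFunctor E).obj (M.obj ((proj E).obj X))}
    {ψ : N.obj ((suspFunctor E).obj ((proj E).obj X)) ⟶
      (suspFunctor E).obj (N.obj ((proj E).obj X))}
    {d : M.obj ((proj E).obj (cosyzygy X)) ⟶ (suspFunctor E).obj (M.obj ((proj E).obj X))}
    {d' : N.obj ((proj E).obj (cosyzygy X)) ⟶ (suspFunctor E).obj (N.obj ((proj E).obj X))}
    (h₁ : M.map (connecting (std X)) ≫ φ = d) (h₂ : N.map (connecting (std X)) ≫ ψ = d')
    (h : d ≫ (suspFunctor E).map (η.app ((proj E).obj X)) =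
      η.app ((proj E).obj (cosyzygy X)) ≫ d') :
    φ ≫ (suspFunctor E).map (η.app ((proj E).obj X)) =
      η.app ((suspFunctor E).obj ((proj E).obj X)) ≫ ψ := by
  rw [← cancel_epi (M.map (connecting (std X))), reassoc_of% h₁, η.naturality_assoc, h₂, h]

/-- The functor induced by the identity is the identity. -/
def stabFunctorId : stabFunctor (𝟭 E) ≅ 𝟭 (StableCat E) :=
  Quotient.natIsoLift (rel E) (F := stabFunctor (𝟭 E)) (G := 𝟭 _)
    (NatIso.ofComponents (fun X => (proj E).mapIso (Iso.refl X)) (fun f => by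
      refine ((proj E).map_comp _ _).symm.trans (Eq.trans ?_ ((proj E).map_comp _ _))
      exact congrArg _ ((Category.comp_id _).trans (Category.id_comp _).symm)))

lemma stab_id : (stab (𝟭 E)).Isomorphic (SFunctor.id (triData E)) := by
  refine ⟨stabFunctorId, fun X => ?_⟩
  obtain ⟨X⟩ := X
  rw [SFunctor.id_φ_hom_app]
  exact comm_of_connecting (stabFunctorId (E := E)).hom X (stabComm_spec (𝟭 E) (std X))
    (Category.comp_id _) (connecting_naturality ((std X).map (𝟭 E)) (std X) (a := 𝟙 X)
      (b := 𝟙 _) (c := 𝟙 _) ((Category.comp_id _).trans (Category.id_comp _).symm)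
      ((Category.comp_id _).trans (Category.id_comp _).symm))

/-- The functor induced by a composition is the composition of the induced functors. -/
def stabFunctorComp : stabFunctor (Φ ⋙ Ψ) ≅ stabFunctor Φ ⋙ stabFunctor Ψ :=
  Quotient.natIsoLift (rel E) (F := stabFunctor (Φ ⋙ Ψ)) (G := stabFunctor Φ ⋙ stabFunctor Ψ)
    (NatIso.ofComponents (fun X => (proj E).mapIso (Iso.refl (Ψ.obj (Φ.obj X)))) (fun f => by
      refine ((proj E).map_comp _ _).symm.trans (Eq.trans ?_ ((proj E).map_comp _ _))
      exact congrArg _ ((Category.comp_id _).trans (Category.id_comp _).symm)))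

lemma stab_comp : (stab (Φ ⋙ Ψ)).Isomorphic ((stab Φ).comp (stab Ψ)) := by
  refine ⟨stabFunctorComp Φ Ψ, fun X => ?_⟩
  obtain ⟨X⟩ := X
  rw [SFunctor.comp_φ_hom_app]
  have h : (stabFunctor Ψ).map ((stabFunctor Φ).map (connecting (std X))) ≫
      (stabFunctor Ψ).map (stabComm Φ X).hom ≫ (stabComm Ψ (Φ.obj X)).hom =
        connecting (((std X).map Φ).map Ψ) :=
    (Category.assoc _ _ _).symm.trans (((congrArg (· ≫ _) (((stabFunctor Ψ).map_comp _ _).symm.trans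
      (congrArg (stabFunctor Ψ).map (stabComm_spec Φ (std X)))))).trans
      (stabComm_spec Ψ ((std X).map Φ)))
  exact comm_of_connecting (stabFunctorComp Φ Ψ).hom X (stabComm_spec (Φ ⋙ Ψ) (std X)) h
    (connecting_naturality ((std X).map (Φ ⋙ Ψ)) (((std X).map Φ).map Ψ) (a := 𝟙 _)
      (b := 𝟙 _) (c := 𝟙 _) ((Category.comp_id _).trans (Category.id_comp _).symm)
      ((Category.comp_id _).trans (Category.id_comp _).symm))

variable {Φ Ψ}

/-- The isomorphism induced on the stable category. -/
def stabFunctorIso (e : Φ ≅ Ψ) : stabFunctor Φ ≅ stabFunctor Ψ :=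
  Quotient.natIsoLift (rel E) (F := stabFunctor Φ) (G := stabFunctor Ψ)
    (NatIso.ofComponents (fun X => (proj E).mapIso (e.app X)) (fun {X Y} f => by
      refine ((proj E).map_comp _ _).symm.trans (Eq.trans ?_ ((proj E).map_comp _ _))
      exact congrArg _ (e.hom.naturality f)))

lemma stab_isomorphic (e : Φ ≅ Ψ) : (stab Φ).Isomorphic (stab Ψ) := by
  refine ⟨stabFunctorIso e, fun X => ?_⟩
  obtain ⟨X⟩ := X
  exact comm_of_connecting (stabFunctorIso e).hom X (stabComm_spec Φ (std X))
    (stabComm_spec Ψ (std X)) (connecting_naturality ((std X).map Φ) ((std X).map Ψ)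
      (a := e.hom.app X) (b := e.hom.app _) (c := e.hom.app _) (e.hom.naturality _)
      (e.hom.naturality _))

end

end Stable

end

section

open Opposite

/-! ### Presentations of functors -/

section Pointwise

variable {k : Type w} [Field k] {T : Type u} [Category.{v} T] {M N : Tᵒᵖ ⥤ ModuleCat.{v} k} {A : T}

lemma epi_iff_app_surjective {g : M ⟶ N} :
    Epi g ↔ ∀ A, Function.Surjective (g.app (op A)).hom := by
  rw [NatTrans.epi_iff_epi_app]
  exact ⟨fun h A => (ModuleCat.epi_iff_surjective _).1 (h (op A)),
    fun h A => (ModuleCat.epi_iff_surjective _).2 (h A.unop)⟩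

lemma mono_iff_app_injective {g : M ⟶ N} :
    Mono g ↔ ∀ A, Function.Injective (g.app (op A)).hom := by
  rw [NatTrans.mono_iff_mono_app]
  exact ⟨fun h A => (ModuleCat.mono_iff_injective _).1 (h (op A)),
    fun h A => (ModuleCat.mono_iff_injective _).2 (h A.unop)⟩

lemma exists_of_exact {S : ShortComplex (Tᵒᵖ ⥤ ModuleCat.{v} k)} (hS : S.Exact)
    (x : S.X₂.obj (op A)) (hx : (S.g.app (op A)).hom x = 0) :
    ∃ x', (S.f.app (op A)).hom x' = x :=
  (ShortComplex.moduleCat_exact_iff _).1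
    (hS.map ((evaluation Tᵒᵖ (ModuleCat.{v} k)).obj (op A))) x hx

end Pointwise

section Presentations

variable {k : Type w} [Field k] {T : Type u} [Category.{v} T] [Preadditive T] [Linear k T]

/-- The value of a morphism from a representable functor at an element. -/
def ev {Y : T} {M : Tᵒᵖ ⥤ ModuleCat.{v} k} (p : (linearYoneda k T).obj Y ⟶ M) {A : T}
    (a : A ⟶ Y) : M.obj (op A) :=
  (p.app (op A)).hom a

variable {M N : Tᵒᵖ ⥤ ModuleCat.{v} k} {X Y A B : T}

lemma ev_add (p : (linearYoneda k T).obj Y ⟶ M) (a b : A ⟶ Y) :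
    ev p (a + b) = ev p a + ev p b :=
  (p.app (op A)).hom.map_add a b

lemma ev_sub (p : (linearYoneda k T).obj Y ⟶ M) (a b : A ⟶ Y) :
    ev p (a - b) = ev p a - ev p b :=
  (p.app (op A)).hom.map_sub a b

lemma ev_zero (p : (linearYoneda k T).obj Y ⟶ M) : ev p (0 : A ⟶ Y) = 0 :=
  (p.app (op A)).hom.map_zero

lemma ev_comp (p : (linearYoneda k T).obj Y ⟶ M) (b : B ⟶ A) (a : A ⟶ Y) :
    ev p (b ≫ a) = (M.map b.op).hom (ev p a) :=
  congrArg (fun f => f.hom a) (p.naturality b.op)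

lemma ev_comp_app (p : (linearYoneda k T).obj Y ⟶ M) (g : M ⟶ N) (a : A ⟶ Y) :
    ev (p ≫ g) a = (g.app (op A)).hom (ev p a) := rfl

lemma ev_map_comp (c : X ⟶ Y) (p : (linearYoneda k T).obj Y ⟶ M) (a : A ⟶ X) :
    ev ((linearYoneda k T).map c ≫ p) a = ev p (a ≫ c) := rfl

lemma ev_eq_map (p : (linearYoneda k T).obj Y ⟶ M) (a : A ⟶ Y) :
    ev p a = (M.map a.op).hom (ev p (𝟙 Y)) := by
  rw [← ev_comp, Category.comp_id]

lemma ev_ext {p q : (linearYoneda k T).obj Y ⟶ M} (h : ev p (𝟙 Y) = ev q (𝟙 Y)) : p = q := by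
  have h' {A : T} (a : A ⟶ Y) : ev p a = ev q a := by rw [ev_eq_map p, ev_eq_map q, h]
  ext A a
  exact h' (A := A.unop) a

/-- `p` exhibits `M` as the cokernel of `Hom(-, X) ⟶ Hom(-, Y)`. -/
structure IsPresentation (f : X ⟶ Y) (p : (linearYoneda k T).obj Y ⟶ M) : Prop where
  surj : ∀ {A : T} (m : M.obj (op A)), ∃ a : A ⟶ Y, ev p a = m
  exact : ∀ {A : T} (a : A ⟶ Y), ev p a = 0 ↔ ∃ b : A ⟶ X, b ≫ f = a

variable (M) in
lemma finPres_iff : finPres k T M ↔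
    ∃ (X Y : T) (f : X ⟶ Y) (p : (linearYoneda k T).obj Y ⟶ M), IsPresentation f p := by
  constructor
  · rintro ⟨X, Y, f, ⟨e⟩⟩
    let S := ShortComplex.mk ((linearYoneda k T).map f) (cokernel.π _) (cokernel.condition _)
    have hS : S.Exact := ShortComplex.exact_of_g_is_cokernel _ (cokernelIsCokernel _)
    have hinj (A : T) : Function.Injective (e.inv.app (op A)).hom :=
      mono_iff_app_injective.1 inferInstance A
    refine ⟨X, Y, f, cokernel.π _ ≫ e.inv, fun {A} m => ?_, fun {A} a => ⟨fun h => ?_, ?_⟩⟩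
    · have hπ : Epi (cokernel.π ((linearYoneda k T).map f) ≫ e.inv) := inferInstance
      exact epi_iff_app_surjective.1 hπ A m
    · rw [ev_comp_app] at h
      obtain ⟨b, hb⟩ := exists_of_exact hS (A := A) a (hinj A (h.trans (map_zero _).symm))
      exact ⟨b, hb⟩
    · rintro ⟨b, rfl⟩
      rw [← ev_map_comp, ← Category.assoc, cokernel.condition, zero_comp]
      rfl
  · rintro ⟨X, Y, f, p, hp⟩
    have w : (linearYoneda k T).map f ≫ p = 0 :=
      ev_ext (by rw [ev_map_comp, (hp.exact _).2 ⟨𝟙 X, rfl⟩]; rfl)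
    let d : cokernel ((linearYoneda k T).map f) ⟶ M := cokernel.desc _ p w
    have hd : cokernel.π _ ≫ d = p := cokernel.π_desc _ _ _
    have hsurj : Epi d := epi_iff_app_surjective.2 fun A m => by
      obtain ⟨a, rfl⟩ := hp.surj m
      exact ⟨ev (cokernel.π _) a, by rw [← ev_comp_app, hd]⟩
    have hinj : Mono d := mono_iff_app_injective.2 fun A => by
      rw [injective_iff_map_eq_zero]
      intro z hz
      have hπ : Epi (cokernel.π ((linearYoneda k T).map f)) := inferInstance
      obtain ⟨a, rfl⟩ := epi_iff_app_surjective.1 hπ A z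
      obtain ⟨b, rfl⟩ := (hp.exact (A := A) a).1 (by rw [← hd]; exact hz)
      change ev (cokernel.π ((linearYoneda k T).map f)) (b ≫ f) = 0
      rw [← ev_map_comp, cokernel.condition]
      rfl
    have : IsIso d := isIso_of_mono_of_epi d
    exact ⟨X, Y, f, ⟨(asIso d).symm⟩⟩

/-- Yoneda's lemma. Functors on `Tᵒᵖ` are not assumed linear here; linearity of `a ↦ M(a) m` holds
because `M` is a quotient of a representable functor. -/
lemma exists_ev_id_eq (hM : finPres k T M) (m : M.obj (op A)) :
    ∃ p : (linearYoneda k T).obj A ⟶ M, ev p (𝟙 A) = m := by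
  obtain ⟨X, Y, f, p, hp⟩ := (finPres_iff M).1 hM
  obtain ⟨a, rfl⟩ := hp.surj m
  exact ⟨(linearYoneda k T).map a ≫ p, by rw [ev_map_comp, Category.id_comp]⟩

variable (k) in
lemma finPres_linearYoneda (X : T) : finPres k T ((linearYoneda k T).obj X) :=
  (finPres_iff _).2 ⟨X, X, 0, 𝟙 _, fun m => ⟨m, rfl⟩, fun a => ⟨fun h => ⟨0, by
    rw [comp_zero]; exact h.symm⟩, by rintro ⟨b, rfl⟩; rw [comp_zero]; exact ev_zero _⟩⟩

instance : (finPres k T).IsClosedUnderIsomorphisms where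
  of_iso := by
    rintro M N e ⟨X, Y, f, ⟨e'⟩⟩
    exact ⟨X, Y, f, ⟨e.symm ≪≫ e'⟩⟩

lemma exists_lift_presentation {M N : Tᵒᵖ ⥤ ModuleCat.{v} k} (g : M ⟶ N) {Y X' Y' : T}
    (p : (linearYoneda k T).obj Y ⟶ M) {f' : X' ⟶ Y'} {p' : (linearYoneda k T).obj Y' ⟶ N}
    (hp' : IsPresentation f' p') : ∃ c : Y ⟶ Y', (linearYoneda k T).map c ≫ p' = p ≫ g := by
  obtain ⟨c, hc⟩ := hp'.surj (ev (p ≫ g) (𝟙 Y))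
  exact ⟨c, ev_ext (by rw [ev_map_comp, Category.id_comp, hc])⟩

end Presentations

/-! ### Finitely presented functors are closed under kernels, cokernels and finite products. -/

section Abelian

variable {k : Type w} [Field k] {T : Type u} [Category.{v} T] [Preadditive T] [Linear k T]
variable [HasZeroObject T] [HasShift T ℤ] [∀ n : ℤ, (shiftFunctor T n).Additive]
  [Pretriangulated T]

open Pretriangulated ZeroObject

lemma exists_weakKernel {B D : T} (h : B ⟶ D) :
    ∃ (W : T) (u : W ⟶ B), ∀ {A : T} (a : A ⟶ B), a ≫ h = 0 ↔ ∃ b : A ⟶ W, b ≫ u = a := by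
  obtain ⟨W, u, δ, hd⟩ := distinguished_cocone_triangle₁ h
  refine ⟨W, u, fun a => ⟨fun ha => ?_, ?_⟩⟩
  · obtain ⟨b, hb⟩ := Triangle.coyoneda_exact₂ _ hd a ha
    exact ⟨b, hb.symm⟩
  · rintro ⟨b, rfl⟩
    rw [Category.assoc]
    exact (congrArg (b ≫ ·) (comp_distTriang_mor_zero₁₂ _ hd)).trans comp_zero

lemma exists_weakPullback {B B' D : T} (h : B ⟶ D) (h' : B' ⟶ D) :
    ∃ (W : T) (u : W ⟶ B), ∀ {A : T} (a : A ⟶ B),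
      (∃ a' : A ⟶ B', a' ≫ h' = a ≫ h) ↔ ∃ b : A ⟶ W, b ≫ u = a := by
  obtain ⟨W, u, hu⟩ := exists_weakKernel (biprod.desc h (-h'))
  refine ⟨W, u ≫ biprod.fst, fun a => ⟨?_, ?_⟩⟩
  · rintro ⟨a', ha'⟩
    obtain ⟨b, hb⟩ := (hu (biprod.lift a a')).1 (by simp [ha'])
    exact ⟨b, by rw [← Category.assoc, hb, biprod.lift_fst]⟩
  · rintro ⟨b, rfl⟩
    have h₀ := (hu (b ≫ u)).2 ⟨b, rfl⟩
    refine ⟨b ≫ u ≫ biprod.snd, ?_⟩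
    rw [biprod.desc_eq, Preadditive.comp_add, Preadditive.comp_neg, Preadditive.comp_neg,
      ← sub_eq_add_neg, sub_eq_zero] at h₀
    simpa using h₀.symm

instance : (finPres k T).ContainsZero where
  exists_zero := by
    refine ⟨(linearYoneda k T).obj 0, ?_, finPres_linearYoneda k 0⟩
    rw [IsZero.iff_id_eq_zero]
    exact ev_ext ((isZero_zero T).eq_of_tgt _ _)

/-- The relations of the cokernel are those of `N` together with the images of the generators of
`M`. -/
instance : (finPres k T).IsClosedUnderCokernels where
  cokernels_le := by
    rintro Q ⟨g, c, hc, hM, hN⟩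
    rename_i M N
    obtain ⟨X, Y, f, p, hp⟩ := (finPres_iff _).1 hM
    obtain ⟨X', Y', f', p', hp'⟩ := (finPres_iff _).1 hN
    obtain ⟨a, ha⟩ := exists_lift_presentation g p hp'
    have hw : g ≫ c.π = 0 := c.condition
    have : Epi c.π := Cofork.IsColimit.epi hc
    have hS : (ShortComplex.mk g c.π hw).Exact :=
      ShortComplex.exact_of_g_is_cokernel _ (IsColimit.ofIsoColimit hc (Cofork.ext (Iso.refl _)))
    refine (finPres_iff c.pt).2 ⟨X' ⊞ Y, Y', biprod.desc f' a, p' ≫ c.π, ?_, ?_⟩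
    · intro A m
      obtain ⟨n, rfl⟩ := epi_iff_app_surjective.1 this A m
      obtain ⟨b, rfl⟩ := hp'.surj n
      exact ⟨b, rfl⟩
    · intro A b
      constructor
      · intro h
        obtain ⟨m, hm⟩ := exists_of_exact hS (A := A) (ev p' b) h
        obtain ⟨y, rfl⟩ := hp.surj m
        have : ev p' (b - y ≫ a) = 0 := by
          rw [ev_sub, sub_eq_zero, ← hm, ← ev_map_comp, ha]
          rfl
        obtain ⟨x, hx⟩ := (hp'.exact _).1 this
        exact ⟨biprod.lift x y, by rw [biprod.lift_desc, hx, sub_add_cancel]⟩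
      · rintro ⟨b, rfl⟩
        rw [biprod.desc_eq, Preadditive.comp_add, ev_add, ev_comp_app, ev_comp_app,
          ← Category.assoc, ← Category.assoc, (hp'.exact _).2 ⟨_, rfl⟩, map_zero, zero_add,
          ← ev_map_comp, ha, ← ev_comp_app, Category.assoc, hw, comp_zero]
        rfl

/-- Triangles provide weak pullbacks. The weak pullback `W` of `a` and `f'` covers the elements of
`M` which die in `N`; the weak pullback `W'` of `W ⟶ Y` and `f` covers the relations among them. -/
instance : (finPres k T).IsClosedUnderKernels where
  kernels_le := by
    rintro K ⟨g, c, hc, hM, hN⟩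
    rename_i M N
    obtain ⟨X, Y, f, p, hp⟩ := (finPres_iff _).1 hM
    obtain ⟨X', Y', f', p', hp'⟩ := (finPres_iff _).1 hN
    obtain ⟨a, ha⟩ := exists_lift_presentation g p hp'
    have hw : c.ι ≫ g = 0 := c.condition
    have : Mono c.ι := Fork.IsLimit.mono hc
    have hS : (ShortComplex.mk c.ι g hw).Exact :=
      ShortComplex.exact_of_f_is_kernel _ (IsLimit.ofIsoLimit hc (Fork.ext (Iso.refl _)))
    have hinj := mono_iff_app_injective.1 this
    obtain ⟨W, q, hq⟩ := exists_weakPullback a f'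
    obtain ⟨W', q', hq'⟩ := exists_weakPullback q f
    have h₀ : ((linearYoneda k T).map q ≫ p) ≫ g = 0 := by
      rw [Category.assoc, ← ha]
      refine ev_ext ?_
      rw [ev_map_comp, ev_map_comp, Category.id_comp]
      obtain ⟨b, hb⟩ := (hq q).2 ⟨𝟙 W, Category.id_comp q⟩
      rw [(hp'.exact _).2 ⟨b, hb⟩]
      rfl
    obtain ⟨r, hr⟩ : ∃ r : (linearYoneda k T).obj W ⟶ c.pt, r ≫ c.ι =
      (linearYoneda k T).map q ≫ p := ⟨hc.lift (KernelFork.ofι _ h₀), Fork.IsLimit.lift_ι hc⟩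
    have hr' {A : T} (d : A ⟶ W) : (c.ι.app (op A)).hom (ev r d) = ev p (d ≫ q) := by
      rw [← ev_comp_app, hr, ev_map_comp]
    refine (finPres_iff c.pt).2 ⟨W', W, q', r, ?_, ?_⟩
    · intro A m
      obtain ⟨y, hy⟩ := hp.surj ((c.ι.app (op A)).hom m)
      have : ev p' (y ≫ a) = 0 := by
        rw [← ev_map_comp, ha, ev_comp_app, hy]
        exact congrArg (fun f => (f.app (op A)).hom m) hw
      obtain ⟨d, rfl⟩ := (hq y).1 ((hp'.exact _).1 this)
      exact ⟨d, hinj A (by rw [hr', hy])⟩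
    · intro A d
      rw [← hq', ← hp.exact, ← hr']
      exact ⟨fun h => by rw [h, map_zero], fun h => hinj A (h.trans (map_zero _).symm)⟩

lemma finPres_biprod {M N : Tᵒᵖ ⥤ ModuleCat.{v} k} (hM : finPres k T M) (hN : finPres k T N) :
    finPres k T (M ⊞ N) := by
  obtain ⟨X, Y, f, p, hp⟩ := (finPres_iff _).1 hM
  obtain ⟨X', Y', f', p', hp'⟩ := (finPres_iff _).1 hN
  let q : (linearYoneda k T).obj (Y ⊞ Y') ⟶ M ⊞ N :=
    biprod.lift ((linearYoneda k T).map biprod.fst ≫ p) ((linearYoneda k T).map biprod.snd ≫ p')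
  have h₁ {A : T} (a : A ⟶ Y ⊞ Y') :
      ((biprod.fst : M ⊞ N ⟶ M).app (op A)).hom (ev q a) = ev p (a ≫ biprod.fst) := by
    rw [← ev_comp_app, biprod.lift_fst, ev_map_comp]
  have h₂ {A : T} (a : A ⟶ Y ⊞ Y') :
      ((biprod.snd : M ⊞ N ⟶ N).app (op A)).hom (ev q a) = ev p' (a ≫ biprod.snd) := by
    rw [← ev_comp_app, biprod.lift_snd, ev_map_comp]
  have hext {A : T} (x y : (M ⊞ N).obj (op A))
      (h : ((biprod.fst : M ⊞ N ⟶ M).app (op A)).hom x = ((biprod.fst : M ⊞ N ⟶ M).app (op A)).hom y)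
      (h' : ((biprod.snd : M ⊞ N ⟶ N).app (op A)).hom x =
        ((biprod.snd : M ⊞ N ⟶ N).app (op A)).hom y) : x = y := by
    have e (z : (M ⊞ N).obj (op A)) : z =
        ((biprod.inl : M ⟶ M ⊞ N).app (op A)).hom (((biprod.fst : M ⊞ N ⟶ M).app (op A)).hom z) +
        ((biprod.inr : N ⟶ M ⊞ N).app (op A)).hom (((biprod.snd : M ⊞ N ⟶ N).app (op A)).hom z) :=
      congrArg (fun f => (f.app (op A)).hom z) (biprod.total (X := M) (Y := N)).symm
    rw [e x, e y, h, h']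
  refine (finPres_iff _).2 ⟨X ⊞ X', Y ⊞ Y', biprod.map f f', q, ?_, ?_⟩
  · intro A m
    obtain ⟨a, ha⟩ := hp.surj (((biprod.fst : M ⊞ N ⟶ M).app (op A)).hom m)
    obtain ⟨a', ha'⟩ := hp'.surj (((biprod.snd : M ⊞ N ⟶ N).app (op A)).hom m)
    refine ⟨biprod.lift a a', hext _ _ ?_ ?_⟩
    · rw [h₁, biprod.lift_fst, ha]
    · rw [h₂, biprod.lift_snd, ha']
  · intro A a
    constructor
    · intro h
      obtain ⟨b, hb⟩ := (hp.exact (a ≫ biprod.fst)).1 (by rw [← h₁, h, map_zero])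
      obtain ⟨b', hb'⟩ := (hp'.exact (a ≫ biprod.snd)).1 (by rw [← h₂, h, map_zero])
      exact ⟨biprod.lift b b', by apply biprod.hom_ext <;> simp [hb, hb']⟩
    · rintro ⟨b, rfl⟩
      refine hext _ _ ?_ ?_
      · rw [h₁, map_zero, (hp.exact _).2 ⟨b ≫ biprod.fst, by simp⟩]
      · rw [h₂, map_zero, (hp'.exact _).2 ⟨b ≫ biprod.snd, by simp⟩]

instance : (finPres k T).IsClosedUnderBinaryProducts where
  limitsOfShape_le := by
    rintro P ⟨d⟩
    let M := d.diag.obj ⟨WalkingPair.left⟩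
    let N := d.diag.obj ⟨WalkingPair.right⟩
    let e : d.diag ≅ pair M N := diagramIsoPair _
    have h : IsLimit ((Cone.postcompose e.hom).obj d.cone) :=
      (IsLimit.postcomposeHomEquiv e _).symm d.isLimit
    exact (finPres k T).prop_of_iso (h.conePointUniqueUpToIso (BinaryBiproduct.isLimit M N)).symm
      (finPres_biprod (d.prop_diag_obj _) (d.prop_diag_obj _))

instance : (finPres k T).IsClosedUnderFiniteProducts := .mk'

end Abelian

end

section

open Opposite Pretriangulated

/-! ### Representables as generators of `mod T`. -/

section Yoneda

variable (k : Type w) [Field k] {T : Type u} [Category.{v} T] [Preadditive T] [Linear k T]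

/-- The Yoneda embedding of `T` into `mod T`. -/
def yon : T ⥤ ModCat k T := (finPres k T).lift (linearYoneda k T) (finPres_linearYoneda k)

instance : (yon k : T ⥤ ModCat k T).Full :=
  inferInstanceAs ((finPres k T).lift (linearYoneda k T) _).Full

instance : (yon k : T ⥤ ModCat k T).Faithful :=
  inferInstanceAs ((finPres k T).lift (linearYoneda k T) _).Faithful

instance : (yon k : T ⥤ ModCat k T).Additive where
  map_add {X Y f g} := by
    ext A a
    exact Preadditive.comp_add (A.unop) X Y a f g

instance : (yon k : T ⥤ ModCat k T).Linear k where
  map_smul {X Y} f c := by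
    ext A a
    exact Linear.comp_smul (A.unop) X Y a c f

variable {k}

lemma exists_presentation (F : ModCat k T) : ∃ (X Y : T) (f : X ⟶ Y) (p : (yon k).obj Y ⟶ F),
    Epi p ∧ (yon k).map f ≫ p = 0 ∧
      ∀ {A : T} (a : A ⟶ Y), (yon k).map a ≫ p = 0 → ∃ b, b ≫ f = a := by
  obtain ⟨X, Y, f, p, hp⟩ := (finPres_iff F.obj).1 F.property
  have key {A : T} (a : A ⟶ Y) : (linearYoneda k T).map a ≫ p = 0 ↔ ev p a = 0 := by
    refine ⟨fun h => ?_, fun h => ev_ext ?_⟩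
    · have := congrArg (fun q => ev q (𝟙 A)) h
      rw [ev_map_comp, Category.id_comp] at this
      exact this
    · rw [ev_map_comp, Category.id_comp, h]
      rfl
  refine ⟨X, Y, f, (finPres k T).homMk p, ?_, ?_, fun {A} a ha => ?_⟩
  · have : Epi ((finPres k T).ι.map ((finPres k T).homMk (X := (yon k).obj Y) (Y := F) p)) :=
      epi_iff_app_surjective.2 fun A m => hp.surj m
    exact (finPres k T).ι.epi_of_epi_map this
  · exact (finPres k T).hom_ext ((key f).2 ((hp.exact f).2 ⟨𝟙 X, Category.id_comp f⟩))
  · exact (hp.exact a).1 ((key a).1 (congrArg (fun q => q.hom) ha))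

lemma exists_epi_yon (F : ModCat k T) : ∃ (Y : T) (p : (yon k).obj Y ⟶ F), Epi p := by
  obtain ⟨X, Y, f, p, hp, -⟩ := exists_presentation F
  exact ⟨Y, p, hp⟩

lemma hom_ext_yon {F G : ModCat k T} {f g : F ⟶ G}
    (h : ∀ (A : T) (x : (yon k).obj A ⟶ F), x ≫ f = x ≫ g) : f = g := by
  obtain ⟨Y, p, hp⟩ := exists_epi_yon F
  exact (cancel_epi p).1 (h Y p)

lemma mono_of_yon {F G : ModCat k T} (f : F ⟶ G)
    (h : ∀ (A : T) (x : (yon k).obj A ⟶ F), x ≫ f = 0 → x = 0) : Mono f :=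
  Preadditive.mono_of_cancel_zero _ fun {F'} g hg => hom_ext_yon fun A x => by
    rw [comp_zero, h A (x ≫ g) (by rw [Category.assoc, hg, comp_zero])]

lemma exists_retract_of_projective (P : ModCat k T) [Projective P] :
    ∃ (Y : T) (i : P ⟶ (yon k).obj Y) (r : (yon k).obj Y ⟶ P), i ≫ r = 𝟙 P := by
  obtain ⟨Y, p, hp⟩ := exists_epi_yon P
  exact ⟨Y, Projective.factorThru (𝟙 P) p, p, Projective.factorThru_comp _ _⟩

end Yoneda

/-! ### The Frobenius property of `mod T`. -/

section Frobenius

variable {k : Type w} [Field k] {T : Type u} [Category.{v} T] [Preadditive T] [Linear k T]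
variable [HasZeroObject T] [HasShift T ℤ] [∀ n : ℤ, (shiftFunctor T n).Additive]
  [Pretriangulated T]

section

variable {X Y Z : T} {f : X ⟶ Y} {g : Y ⟶ Z} {h : Z ⟶ X⟦(1 : ℤ)⟧}

lemma dist_zero (hd : Triangle.mk f g h ∈ distTriang T) : f ≫ g = 0 :=
  comp_distTriang_mor_zero₁₂ _ hd

lemma dist_lift (hd : Triangle.mk f g h ∈ distTriang T) {A : T} (a : A ⟶ Y) (ha : a ≫ g = 0) :
    ∃ b : A ⟶ X, b ≫ f = a := by
  obtain ⟨b, hb⟩ := Triangle.coyoneda_exact₂ _ hd a ha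
  exact ⟨b, hb.symm⟩

lemma dist_desc (hd : Triangle.mk f g h ∈ distTriang T) {A : T} (a : Y ⟶ A) (ha : f ≫ a = 0) :
    ∃ b : Z ⟶ A, g ≫ b = a := by
  obtain ⟨b, hb⟩ := Triangle.yoneda_exact₂ _ hd a ha
  exact ⟨b, hb.symm⟩

end

instance (Y : T) : Projective ((yon k).obj Y) where
  factors {M N} f e he := by
    -- Epimorphisms of `mod T` remain epimorphisms among all functors, so they are pointwise
    -- surjective and Yoneda's lemma provides the lift.
    have := (finPres k T).preservesEpimorphisms_ι_of_isNormalMonoCategory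
    have he' : Epi ((finPres k T).ι.map e) := inferInstance
    obtain ⟨m, hm⟩ := epi_iff_app_surjective.1 he' Y (ev f.hom (𝟙 Y))
    obtain ⟨p, hp⟩ := exists_ev_id_eq M.property m
    refine ⟨(finPres k T).homMk p, (finPres k T).hom_ext (ev_ext ?_)⟩
    exact (ev_comp_app p e.hom (𝟙 Y)).trans ((congrArg _ hp).trans hm)

lemma exact_of_presentation {F : ModCat k T} {X Y : T} {e : X ⟶ Y} {p : (yon k).obj Y ⟶ F}
    (hep : (yon k).map e ≫ p = 0)
    (hexact : ∀ {A : T} (a : A ⟶ Y), (yon k).map a ≫ p = 0 → ∃ b, b ≫ e = a) :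
    (ShortComplex.mk ((yon k).map e) p hep).Exact := by
  rw [ShortComplex.exact_iff_exact_up_to_refinements]
  intro F' x hx
  obtain ⟨A, π, hπ⟩ := exists_epi_yon F'
  obtain ⟨a, ha⟩ := (yon k).map_surjective (π ≫ x)
  obtain ⟨b, rfl⟩ := hexact a (by
    rw [ha, Category.assoc]
    exact (congrArg (π ≫ ·) hx).trans comp_zero)
  exact ⟨_, π, hπ, (yon k).map b, by rw [← ha, Functor.map_comp]⟩

/-- Every object is the image of a morphism in a distinguished triangle. -/
lemma exists_image (F : ModCat k T) : ∃ (Y Z W : T) (f : Y ⟶ Z) (g : Z ⟶ W)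
    (h : W ⟶ Y⟦(1 : ℤ)⟧) (p : (yon k).obj Y ⟶ F) (i : F ⟶ (yon k).obj Z),
    Triangle.mk f g h ∈ distTriang T ∧ Epi p ∧ Mono i ∧ p ≫ i = (yon k).map f := by
  obtain ⟨X, Y, e, p, hp, hep, hexact⟩ := exists_presentation F
  -- `Hom(-, X) ⟶ Hom(-, Y) ⟶ Hom(-, Z)` is exact, so the cokernel `F` of the first map embeds into
  -- the third term; rotation then puts `f` in first position.
  obtain ⟨Z, f, g, hd⟩ := distinguished_cocone_triangle e
  have hef : e ≫ f = 0 := dist_zero hd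
  have hS := exact_of_presentation hep hexact
  have : Epi (ShortComplex.mk ((yon k).map e) p hep).g := hp
  have hk : (yon k).map e ≫ (yon k).map f = 0 := by
    rw [← Functor.map_comp, hef, Functor.map_zero]
  have hi : p ≫ hS.desc ((yon k).map f) hk = (yon k).map f := hS.g_desc _ hk
  refine ⟨Y, Z, _, f, g, _, p, hS.desc ((yon k).map f) hk, rot_of_distTriang _ hd, hp,
    mono_of_yon _ fun A x hx => ?_, hi⟩
  obtain ⟨b, hb⟩ := (yon k).map_surjective (Projective.factorThru x p)
  have hb' : (yon k).map b ≫ p = x := by rw [hb, Projective.factorThru_comp]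
  have hbf : b ≫ f = 0 := (yon k).map_injective (by
    rw [Functor.map_comp, ← hi, reassoc_of% hb', hx, Functor.map_zero])
  obtain ⟨c, rfl⟩ := dist_lift hd b hbf
  rw [← hb', Functor.map_comp, Category.assoc, hep, comp_zero]

lemma exists_mono_yon (F : ModCat k T) : ∃ (Z : T) (i : F ⟶ (yon k).obj Z), Mono i := by
  obtain ⟨Y, Z, W, f, g, h, p, i, -, -, hi, -⟩ := exists_image F
  exact ⟨Z, i, hi⟩

/-- Cover `F` by a representable `Y` and embed `G` into a representable `Z`. The composite `Y ⟶ F ⟶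
G ⟶ Z` is a morphism `g` of `T`, and `φ` restricted to `Y` is some `a : Y ⟶ V` killed by the fibre
of `g`; hence `a` factors through `g`, which extends `φ` to all of `Z`. -/
instance (V : T) : Injective ((yon k).obj V) where
  factors {F G} φ m hm := by
    obtain ⟨Z, i, hi⟩ := exists_mono_yon G
    obtain ⟨Y, p, hp⟩ := exists_epi_yon F
    obtain ⟨g, hg⟩ := (yon k).map_surjective (p ≫ m ≫ i)
    obtain ⟨a, ha⟩ := (yon k).map_surjective (p ≫ φ)
    obtain ⟨X, u, δ, hd⟩ := distinguished_cocone_triangle₁ g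
    have hug : u ≫ g = 0 := dist_zero hd
    have hup : (yon k).map u ≫ p = 0 := by
      rw [← cancel_mono (m ≫ i), Category.assoc, ← hg, ← Functor.map_comp, hug, Functor.map_zero,
        zero_comp]
    have hua : u ≫ a = 0 := (yon k).map_injective (by
      rw [Functor.map_comp, ha, reassoc_of% hup, zero_comp, Functor.map_zero])
    obtain ⟨b, hb⟩ := dist_desc hd a hua
    refine ⟨i ≫ (yon k).map b, ?_⟩
    rw [← cancel_epi p, ← ha, ← hb, Functor.map_comp, hg, Category.assoc, Category.assoc]

lemma exists_retract_of_injective (J : ModCat k T) [Injective J] :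
    ∃ (Y : T) (i : J ⟶ (yon k).obj Y) (r : (yon k).obj Y ⟶ J), i ≫ r = 𝟙 J := by
  obtain ⟨Y, i, hi⟩ := exists_mono_yon J
  exact ⟨Y, i, Injective.factorThru (𝟙 J) i, Injective.comp_factorThru _ _⟩

/-- Both classes consist of the retracts of representables. -/
lemma projective_iff_injective (P : ModCat k T) : Projective P ↔ Injective P := by
  constructor
  · intro
    obtain ⟨Y, i, r, h⟩ := exists_retract_of_projective P
    exact ⟨fun g f hf => ⟨Injective.factorThru (g ≫ i) f ≫ r, by
      rw [Injective.comp_factorThru_assoc, Category.assoc, h, Category.comp_id]⟩⟩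
  · intro
    obtain ⟨Y, i, r, h⟩ := exists_retract_of_injective P
    exact ⟨fun f e he => ⟨i ≫ Projective.factorThru (r ≫ f) e, by
      rw [Category.assoc, Projective.factorThru_comp, reassoc_of% h]⟩⟩

instance isFrobeniusAbelian : IsFrobeniusAbelian (ModCat k T) where
  has_finite_products := inferInstance
  has_kernels := inferInstance
  has_cokernels := inferInstance
  enough_injectives := ⟨fun F => by
    obtain ⟨Z, i, hi⟩ := exists_mono_yon F
    exact ⟨{ J := (yon k).obj Z, f := i, mono := hi }⟩⟩
  enough_projectives := ⟨fun F => by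
    obtain ⟨Y, p, hp⟩ := exists_epi_yon F
    exact ⟨{ p := (yon k).obj Y, f := p, epi := hp }⟩⟩
  projective_iff_injective := projective_iff_injective

end Frobenius

end

section

open Opposite Pretriangulated

/-! ### Endofunctors of `mod T` given by precomposition. -/

section Precomposition

variable {k : Type w} [Field k] {T : Type u} [Category.{v} T] [Preadditive T] [Linear k T]

/-- Precomposition with an endofunctor which preserves finitely presented functors. -/
def precomp (F : T ⥤ T) (hF : ∀ M, finPres k T M → finPres k T (F.op ⋙ M)) :
    ModCat k T ⥤ ModCat k T :=
  (finPres k T).lift ((finPres k T).ι ⋙ (Functor.whiskeringLeft _ _ _).obj F.op)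
    (fun M => hF M.obj M.property)

variable {F G : T ⥤ T} {hF : ∀ M, finPres k T M → finPres k T (F.op ⋙ M)}
  {hG : ∀ M, finPres k T M → finPres k T (G.op ⋙ M)}

instance : (precomp F hF).Additive where
  map_add := rfl

/-- Isomorphic functors give isomorphic precomposition functors. -/
def precompIso (e : F ≅ G) : precomp F hF ≅ precomp G hG :=
  NatIso.ofComponents
    (fun M => (finPres k T).isoMk (Functor.isoWhiskerRight (NatIso.op e.symm) M.obj))
    (fun {M N} f => by
      ext A m
      exact congrArg (fun g => g.hom m) (f.hom.naturality (e.inv.app A.unop).op).symm)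

/-- Precomposition with the identity. -/
def precompId {h : ∀ M, finPres k T M → finPres k T ((𝟭 T).op ⋙ M)} :
    precomp (𝟭 T) h ≅ 𝟭 (ModCat k T) :=
  NatIso.ofComponents (fun M => (finPres k T).isoMk (Iso.refl M.obj)) (fun {M N} f => by
    ext A m
    rfl)

/-- Precomposition with a composition. -/
def precompComp {h : ∀ M, finPres k T M → finPres k T ((F ⋙ G).op ⋙ M)} :
    precomp (F ⋙ G) h ≅ precomp G hG ⋙ precomp F hF :=
  NatIso.ofComponents (fun M => (finPres k T).isoMk (Iso.refl ((F ⋙ G).op ⋙ M.obj)))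
    (fun {M N} f => by
      ext A m
      rfl)

lemma finPres_id_comp (M : Tᵒᵖ ⥤ ModuleCat.{v} k) (hM : finPres k T M) :
    finPres k T ((𝟭 T).op ⋙ M) := hM

end Precomposition

/-! ### The autoequivalences of `mod T` induced by the shifts. -/

section Shift

variable {k : Type w} [Field k] {T : Type u} [Category.{v} T] [Preadditive T] [Linear k T]
variable [HasShift T ℤ] [∀ n : ℤ, (shiftFunctor T n).Additive]
  [∀ n : ℤ, (shiftFunctor T n).Linear k]

variable (T) in
/-- The shift by `-n` is left adjoint to the shift by `n`. -/
def shiftAdj (n : ℤ) : shiftFunctor T (-n) ⊣ shiftFunctor T n :=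
  (shiftEquiv T n).symm.toAdjunction

variable (k) in
/-- `Hom(A[-n], Y) ≅ Hom(A, Y[n])`. -/
def shiftHomEquiv (n : ℤ) (A Y : T) :
    ((shiftFunctor T (-n)).obj A ⟶ Y) ≃ₗ[k] (A ⟶ (shiftFunctor T n).obj Y) where
  __ := (shiftAdj T n).homEquiv A Y
  map_add' a b := by
    change (shiftAdj T n).homEquiv A Y _ =
      (shiftAdj T n).homEquiv A Y _ + (shiftAdj T n).homEquiv A Y _
    simp only [Adjunction.homEquiv_unit, Functor.map_add, Preadditive.comp_add]
  map_smul' c a := by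
    change (shiftAdj T n).homEquiv A Y _ = c • (shiftAdj T n).homEquiv A Y _
    simp only [Adjunction.homEquiv_unit, Functor.map_smul, Linear.comp_smul]

lemma shiftHomEquiv_naturality_left (n : ℤ) {A B Y : T} (b : B ⟶ A)
    (a : (shiftFunctor T (-n)).obj A ⟶ Y) :
    shiftHomEquiv k n B Y ((shiftFunctor T (-n)).map b ≫ a) = b ≫ shiftHomEquiv k n A Y a :=
  (shiftAdj T n).homEquiv_naturality_left b a

lemma shiftHomEquiv_naturality_right (n : ℤ) {A X Y : T} (f : X ⟶ Y)
    (a : (shiftFunctor T (-n)).obj A ⟶ X) :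
    shiftHomEquiv k n A Y (a ≫ f) = shiftHomEquiv k n A X a ≫ (shiftFunctor T n).map f :=
  (shiftAdj T n).homEquiv_naturality_right a f

/-- The shift of a representable functor is representable. -/
def linearYonedaShift (n : ℤ) (Y : T) :
    (shiftFunctor T (-n)).op ⋙ (linearYoneda k T).obj Y ≅
      (linearYoneda k T).obj ((shiftFunctor T n).obj Y) :=
  NatIso.ofComponents (fun A => (shiftHomEquiv k n A.unop Y).toModuleIso) (fun {A B} b => by
    ext a
    exact shiftHomEquiv_naturality_left n b.unop a)

/-- By the adjunction between the shifts by `-n` and `n`, a presentation of `M` by `f` becomes one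
by `f⟦n⟧'`. -/
lemma finPres_shift (n : ℤ) (M : Tᵒᵖ ⥤ ModuleCat.{v} k) (hM : finPres k T M) :
    finPres k T ((shiftFunctor T (-n)).op ⋙ M) := by
  obtain ⟨X, Y, f, p, hp⟩ := (finPres_iff _).1 hM
  let q : (linearYoneda k T).obj ((shiftFunctor T n).obj Y) ⟶ (shiftFunctor T (-n)).op ⋙ M :=
    (linearYonedaShift n Y).inv ≫ Functor.whiskerLeft _ p
  have hq {A : T} (a : (shiftFunctor T (-n)).obj A ⟶ Y) :
      ev q (shiftHomEquiv k n A Y a) = ev p a :=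
    congrArg (ev p) ((shiftHomEquiv k n A Y).symm_apply_apply a)
  refine (finPres_iff _).2 ⟨_, _, (shiftFunctor T n).map f, q, ?_, ?_⟩
  · intro A m
    obtain ⟨a, ha⟩ := hp.surj (A := (shiftFunctor T (-n)).obj A) m
    exact ⟨_, (hq a).trans ha⟩
  · intro A a
    obtain ⟨a, rfl⟩ := (shiftHomEquiv k n A Y).surjective a
    refine (Eq.congr_left (hq a)).trans ((hp.exact a).trans ⟨?_, ?_⟩)
    · rintro ⟨b, rfl⟩
      exact ⟨_, (shiftHomEquiv_naturality_right n f b).symm⟩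
    · rintro ⟨b, hb⟩
      obtain ⟨b, rfl⟩ := (shiftHomEquiv k n A X).surjective b
      rw [← shiftHomEquiv_naturality_right] at hb
      exact ⟨b, (shiftHomEquiv k n A Y).injective hb⟩

variable (k T) in
/-- The autoequivalence of `mod T` induced by the shift by `n`. -/
def shiftMod (n : ℤ) : ModCat k T ⥤ ModCat k T := precomp (shiftFunctor T (-n)) (finPres_shift n)

instance (n : ℤ) : (shiftMod k T n).Additive :=
  inferInstanceAs (precomp (shiftFunctor T (-n)) (finPres_shift n)).Additive

variable (k T) in
/-- The Yoneda embedding commutes with the shifts. -/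
def yonShift (n : ℤ) : yon k ⋙ shiftMod k T n ≅ shiftFunctor T n ⋙ yon k :=
  NatIso.ofComponents (fun Y => (finPres k T).isoMk (linearYonedaShift n Y)) (fun {X Y} f => by
    ext A a
    exact shiftHomEquiv_naturality_right n f a)

variable (k T) in
/-- Shifting by zero is the identity. -/
def shiftModZero (n : ℤ) (hn : n = 0) : shiftMod k T n ≅ 𝟭 (ModCat k T) :=
  precompIso (G := 𝟭 T) (hG := finPres_id_comp) (shiftFunctorZero' T (-n) (by omega)) ≪≫ precompId

lemma finPres_shift_shift (a b : ℤ) (M : Tᵒᵖ ⥤ ModuleCat.{v} k) (hM : finPres k T M) :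
    finPres k T ((shiftFunctor T (-b) ⋙ shiftFunctor T (-a)).op ⋙ M) :=
  finPres_shift b _ (finPres_shift a M hM)

variable (k T) in
/-- Shifting by a sum. -/
def shiftModAdd (a b c : ℤ) (h : a + b = c) :
    shiftMod k T c ≅ shiftMod k T a ⋙ shiftMod k T b :=
  precompIso (hG := finPres_shift_shift a b)
    (shiftFunctorAdd' T (-b) (-a) (-c) (by omega)) ≪≫ precompComp

instance (n : ℤ) : (shiftMod k T n).IsEquivalence :=
  .mk' (shiftMod k T (-n))
    ((shiftModZero k T 0 rfl).symm ≪≫ shiftModAdd k T n (-n) 0 (by omega))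
    ((shiftModAdd k T (-n) n 0 (by omega)).symm ≪≫ shiftModZero k T 0 rfl)

variable (k T) in
/-- A shift which is isomorphic to the identity induces an endofunctor of `mod T` which is
isomorphic to the identity. -/
def shiftModIsoId (n : ℤ) (e : shiftFunctor T (-n) ≅ 𝟭 T) : shiftMod k T n ≅ 𝟭 (ModCat k T) :=
  precompIso (G := 𝟭 T) (hG := finPres_id_comp) e ≪≫ precompId

end Shift

end

section

open Opposite Pretriangulated

/-! ### Threefold connecting morphisms -/

namespace Stable

attribute [local instance] abelian

variable {E : Type u} [Category.{v} E] [Preadditive E] [IsFrobeniusAbelian E]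

/-- The composition of the connecting morphisms of three short exact sequences which splice. -/
def connecting₃ {A B₁ C B₂ D B₃ G : E} (s₁ : SES A B₁ C) (s₂ : SES C B₂ D) (s₃ : SES D B₃ G) :
    (proj E).obj G ⟶
      (suspFunctor E).obj ((suspFunctor E).obj ((suspFunctor E).obj ((proj E).obj A))) :=
  connecting s₃ ≫ (suspFunctor E).map (connecting s₂ ≫ (suspFunctor E).map (connecting s₁))

instance {A B₁ C B₂ D B₃ G : E} (s₁ : SES A B₁ C) (s₂ : SES C B₂ D) (s₃ : SES D B₃ G)
    [Injective B₁] [Injective B₂] [Injective B₃] : IsIso (connecting₃ s₁ s₂ s₃) := by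
  unfold connecting₃
  infer_instance

lemma connecting₃_naturality {A B₁ C B₂ D B₃ G A' B₁' C' B₂' D' B₃' G' : E}
    (s₁ : SES A B₁ C) (s₂ : SES C B₂ D) (s₃ : SES D B₃ G)
    (t₁ : SES A' B₁' C') (t₂ : SES C' B₂' D') (t₃ : SES D' B₃' G')
    {a : A ⟶ A'} {b₁ : B₁ ⟶ B₁'} {c : C ⟶ C'} {b₂ : B₂ ⟶ B₂'} {d : D ⟶ D'} {b₃ : B₃ ⟶ B₃'}
    {e : G ⟶ G'} (h₁ : s₁.f ≫ b₁ = a ≫ t₁.f) (h₁' : s₁.g ≫ c = b₁ ≫ t₁.g)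
    (h₂ : s₂.f ≫ b₂ = c ≫ t₂.f) (h₂' : s₂.g ≫ d = b₂ ≫ t₂.g)
    (h₃ : s₃.f ≫ b₃ = d ≫ t₃.f) (h₃' : s₃.g ≫ e = b₃ ≫ t₃.g) :
    (proj E).map e ≫ connecting₃ t₁ t₂ t₃ = connecting₃ s₁ s₂ s₃ ≫
      (suspFunctor E).map ((suspFunctor E).map ((suspFunctor E).map ((proj E).map a))) := by
  have e₁ := connecting_naturality s₁ t₁ h₁ h₁'
  have e₂ := connecting_naturality s₂ t₂ h₂ h₂'
  have e₃ := connecting_naturality s₃ t₃ h₃ h₃'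
  rw [connecting₃, connecting₃, ← reassoc_of% e₃, ← Functor.map_comp, ← reassoc_of% e₂,
    ← Functor.map_comp, ← e₁, Category.assoc, ← Functor.map_comp, Category.assoc,
    ← Functor.map_comp]

/-- Isolates the sign bookkeeping of `theta_rotate`: one of four composed connecting morphisms is
negated. -/
lemma map_comp_neg_aux {C : Type*} [Category* C] [Preadditive C] (σ : C ⥤ C) [σ.Additive]
    {P A B D G : C} (a : P ⟶ σ.obj A) {b b' : A ⟶ σ.obj B} (hb : b' = -b) (c : B ⟶ σ.obj D)
    (d : D ⟶ σ.obj G) : (a ≫ σ.map (b' ≫ σ.map c)) ≫ σ.map (σ.map (σ.map d)) =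
      -(a ≫ σ.map (b ≫ σ.map (c ≫ σ.map d))) := by
  rw [hb]
  simp only [Functor.map_comp, Functor.map_neg, Preadditive.neg_comp, Preadditive.comp_neg,
    Category.assoc]

/-- The triple suspension. -/
abbrev susp₃ : SFunctor (triData E) :=
  ((SFunctor.susp (triData E)).comp (SFunctor.susp (triData E))).comp (SFunctor.susp (triData E))

lemma susp₃_φ_hom_app (X : StableCat E) : (susp₃ (E := E)).φ.hom.app X =
    -𝟙 ((suspFunctor E).obj ((suspFunctor E).obj ((suspFunctor E).obj
      ((suspFunctor E).obj X)))) := by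
  have : (triData E).S.functor.Additive := inferInstanceAs (suspFunctor E).Additive
  rw [SFunctor.comp_susp_φ_hom_app, SFunctor.comp_susp_φ_hom_app, SFunctor.susp_φ_hom_app]
  let σ := suspFunctor E
  change -σ.map (-σ.map (-𝟙 (σ.obj (σ.obj X)))) = -𝟙 (σ.obj (σ.obj (σ.obj (σ.obj X))))
  rw [σ.map_neg, σ.map_neg, σ.map_neg, σ.map_id, σ.map_id, neg_neg]

end Stable

section

variable {k : Type w} [Field k] {T : Type u} [Category.{v} T] [Preadditive T] [Linear k T]
variable [HasShift T ℤ] [∀ n : ℤ, (shiftFunctor T n).Additive] [HasZeroObject T]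
  [Pretriangulated T]

attribute [local instance] Stable.abelian

/-- If `F` is the image of `f`, exactness at `Y` makes the cokernel of `F ⟶ Y` the image of `g`.
Applied along the rotations of a triangle, this builds the resolution of `F`. -/
lemma exists_mono_of_dist {F F₁ : ModCat k T} {X Y Z : T} {f : X ⟶ Y} {g : Y ⟶ Z}
    {h : Z ⟶ X⟦(1 : ℤ)⟧} (hd : Triangle.mk f g h ∈ distTriang T) (s : SES F ((yon k).obj Y) F₁)
    (p : (yon k).obj X ⟶ F) [Epi p] (hp : p ≫ s.f = (yon k).map f) :
    ∃ j : F₁ ⟶ (yon k).obj Z, Mono j ∧ s.g ≫ j = (yon k).map g := by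
  obtain ⟨j, hj⟩ := s.exists_desc ((yon k).map g) (by
    rw [← cancel_epi p, reassoc_of% hp, ← (yon k).map_comp, dist_zero hd, (yon k).map_zero,
      comp_zero])
  refine ⟨j, mono_of_yon j fun A x hx => ?_, hj⟩
  obtain ⟨a, ha⟩ := (yon k).map_surjective (Projective.factorThru x s.g)
  have hax : (yon k).map a ≫ s.g = x := by rw [ha, Projective.factorThru_comp]
  obtain ⟨b, rfl⟩ := dist_lift hd a ((yon k).map_injective (by
    rw [(yon k).map_comp, ← hj, reassoc_of% hax, hx, (yon k).map_zero]))
  rw [← hax, (yon k).map_comp, ← hp, Category.assoc, Category.assoc, s.w, comp_zero, comp_zero]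

end

/-! ### Resolutions from triangles, and the shift as the triple suspension. -/

section

variable {k : Type w} [Field k] {T : Type u} [Category.{v} T] [Preadditive T] [Linear k T]
variable [HasShift T ℤ] [∀ n : ℤ, (shiftFunctor T n).Additive]
  [∀ n : ℤ, (shiftFunctor T n).Linear k]

variable (k) in
/-- The Yoneda embedding commutes with the shifts, on an object. -/
def yonShiftIso (n : ℤ) (Y : T) : (shiftMod k T n).obj ((yon k).obj Y) ≅ (yon k).obj (Y⟦n⟧) :=
  (yonShift k T n).app Y

lemma yonShiftIso_naturality (n : ℤ) {X Y : T} (f : X ⟶ Y) :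
    (shiftMod k T n).map ((yon k).map f) ≫ (yonShiftIso k n Y).hom =
      (yonShiftIso k n X).hom ≫ (yon k).map (f⟦n⟧') :=
  (yonShift k T n).hom.naturality f

lemma yonShiftIso_inv_naturality (n : ℤ) {X Y : T} (f : X ⟶ Y) :
    (yon k).map (f⟦n⟧') ≫ (yonShiftIso k n Y).inv =
      (yonShiftIso k n X).inv ≫ (shiftMod k T n).map ((yon k).map f) :=
  (yonShift k T n).inv.naturality f

variable [HasZeroObject T] [Pretriangulated T]

attribute [local instance] Stable.abelian

lemma dist_rot {X Y Z : T} {f : X ⟶ Y} {g : Y ⟶ Z} {h : Z ⟶ X⟦(1 : ℤ)⟧}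
    (hd : Triangle.mk f g h ∈ distTriang T) :
    Triangle.mk g h (-f⟦(1 : ℤ)⟧') ∈ distTriang T :=
  rot_of_distTriang _ hd

lemma exists_dist_hom {X Y Z X' Y' Z' : T} {f : X ⟶ Y} {g : Y ⟶ Z} {h : Z ⟶ X⟦(1 : ℤ)⟧}
    {f' : X' ⟶ Y'} {g' : Y' ⟶ Z'} {h' : Z' ⟶ X'⟦(1 : ℤ)⟧}
    (hd : Triangle.mk f g h ∈ distTriang T) (hd' : Triangle.mk f' g' h' ∈ distTriang T)
    (a : X ⟶ X') (b : Y ⟶ Y') (hab : f ≫ b = a ≫ f') :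
    ∃ d : Z ⟶ Z', g ≫ d = b ≫ g' ∧ h ≫ a⟦(1 : ℤ)⟧' = d ≫ h' :=
  complete_distinguished_triangle_morphism _ _ hd hd' a b hab

/-- Short exact sequences which splice to the exact sequence of representable functors given by
a distinguished triangle. -/
structure TriResolution (F F₁ F₂ : ModCat k T) where
  /-- the first object of the triangle -/
  Y : T
  /-- the second object of the triangle -/
  Z : T
  /-- the third object of the triangle -/
  W : T
  /-- the first morphism of the triangle -/
  f : Y ⟶ Z
  /-- the second morphism of the triangle -/
  g : Z ⟶ W
  /-- the third morphism of the triangle -/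
  h : W ⟶ Y⟦(1 : ℤ)⟧
  dist : Triangle.mk f g h ∈ distTriang T
  /-- the augmentation -/
  p : (yon k).obj Y ⟶ F
  epi : Epi p
  /-- the first short exact sequence -/
  s₁ : SES F ((yon k).obj Z) F₁
  /-- the second short exact sequence -/
  s₂ : SES F₁ ((yon k).obj W) F₂
  /-- the third short exact sequence -/
  s₃ : SES F₂ ((yon k).obj (Y⟦(1 : ℤ)⟧)) ((shiftMod k T 1).obj F)
  hf : p ≫ s₁.f = (yon k).map f
  hg : s₁.g ≫ s₂.f = (yon k).map g
  hh : s₂.g ≫ s₃.f = (yon k).map h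
  hp : s₃.g = (yonShiftIso k 1 Y).inv ≫ (shiftMod k T 1).map p

lemma exists_triResolution (F : ModCat k T) : ∃ F₁ F₂, Nonempty (TriResolution F F₁ F₂) := by
  obtain ⟨Y, Z, W, f, g, h, p, i, hd, hp, hi, hpi⟩ := exists_image F
  let s₁ := SES.ofMono i
  obtain ⟨j, hj, hg⟩ := exists_mono_of_dist hd s₁ p hpi
  let s₂ := SES.ofMono j
  obtain ⟨l, hl, hh⟩ := exists_mono_of_dist (dist_rot hd) s₂ s₁.g hg
  let q : (yon k).obj (Y⟦(1 : ℤ)⟧) ⟶ (shiftMod k T 1).obj F :=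
    (yonShiftIso k 1 Y).inv ≫ (shiftMod k T 1).map p
  have hq : q ≫ (shiftMod k T 1).map i ≫ (yonShiftIso k 1 Z).hom = (yon k).map (f⟦(1 : ℤ)⟧') := by
    rw [Category.assoc, ← Functor.map_comp_assoc, hpi, ← Category.assoc,
      ← yonShiftIso_inv_naturality, Category.assoc, Iso.inv_hom_id, Category.comp_id]
  have hhf : h ≫ f⟦(1 : ℤ)⟧' = 0 := by
    have := dist_zero (dist_rot (dist_rot hd))
    rwa [Preadditive.comp_neg, neg_eq_zero] at this
  -- Since `F[1] ⟶ Z[1]` is a monomorphism, `q` has the same kernel as `f⟦1⟧'`, and that kernel is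
  -- the image of `h`.
  have hlq : l ≫ q = 0 := by
    rw [← cancel_epi s₂.g, ← cancel_mono ((shiftMod k T 1).map i ≫ (yonShiftIso k 1 Z).hom),
      Category.assoc, Category.assoc, hq, reassoc_of% hh, ← (yon k).map_comp, hhf,
      (yon k).map_zero, comp_zero, zero_comp]
  have hS : (ShortComplex.mk l q hlq).ShortExact := by
    refine ShortComplex.ShortExact.mk' ?_ hl (inferInstanceAs (Epi (_ ≫ _)))
    rw [ShortComplex.exact_iff_exact_up_to_refinements]
    intro G x hx
    obtain ⟨A, π, hπ⟩ := exists_epi_yon G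
    obtain ⟨a, ha⟩ := (yon k).map_surjective (π ≫ x)
    have hxq : x ≫ q = 0 := hx
    obtain ⟨b, rfl⟩ := dist_lift (dist_rot (dist_rot hd)) a ((yon k).map_injective (by
      rw [Preadditive.comp_neg, (yon k).map_neg, (yon k).map_comp, ha, ← hq, Category.assoc,
        reassoc_of% hxq, zero_comp, comp_zero, neg_zero, (yon k).map_zero]))
    refine ⟨_, π, hπ, (yon k).map b ≫ s₂.g, ?_⟩
    rw [← ha, (yon k).map_comp, ← hh, Category.assoc]
  exact ⟨_, _, ⟨⟨Y, Z, W, f, g, h, hd, p, hp, s₁, s₂, ⟨l, q, hlq, hS⟩, hpi, hg, hh, rfl⟩⟩⟩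

namespace TriResolution

attribute [instance] TriResolution.epi

variable {F F₁ F₂ F' F₁' F₂' : ModCat k T}

open Stable

/-- The isomorphism from the shift to the triple suspension given by a resolution. -/
def theta (R : TriResolution F F₁ F₂) :
    (stabFunctor (shiftMod k T 1)).obj ((proj (ModCat k T)).obj F) ⟶
      (suspFunctor (ModCat k T)).obj ((suspFunctor (ModCat k T)).obj
        ((suspFunctor (ModCat k T)).obj ((proj (ModCat k T)).obj F))) :=
  connecting₃ R.s₁ R.s₂ R.s₃

instance (R : TriResolution F F₁ F₂) : IsIso R.theta :=
  inferInstanceAs (IsIso (connecting₃ R.s₁ R.s₂ R.s₃))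

/-- The isomorphism `theta`, as an isomorphism. -/
def thetaIso (R : TriResolution F F₁ F₂) := asIso R.theta

lemma theta_naturality (R : TriResolution F F₁ F₂) (R' : TriResolution F' F₁' F₂') (c : F ⟶ F') :
    (stabFunctor (shiftMod k T 1)).map ((proj (ModCat k T)).map c) ≫ R'.theta =
      R.theta ≫ (suspFunctor (ModCat k T)).map ((suspFunctor (ModCat k T)).map
        ((suspFunctor (ModCat k T)).map ((proj (ModCat k T)).map c))) := by
  -- `c` lifts to `a` on `Y` by projectivity and extends to `b` on `Z` by injectivity. The square
  -- commutes, so the triangle axioms give `d` on `W`, and the induced map on the last term is the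
  -- shift of `c`.
  obtain ⟨a, ha⟩ := (yon k).map_surjective (Projective.factorThru (R.p ≫ c) R'.p)
  obtain ⟨b, hb⟩ := (yon k).map_surjective (Injective.factorThru (c ≫ R'.s₁.f) R.s₁.f)
  replace ha : (yon k).map a ≫ R'.p = R.p ≫ c := by rw [ha, Projective.factorThru_comp]
  replace hb : R.s₁.f ≫ (yon k).map b = c ≫ R'.s₁.f := by rw [hb, Injective.comp_factorThru]
  have hab : R.f ≫ b = a ≫ R'.f := (yon k).map_injective (by
    rw [(yon k).map_comp, (yon k).map_comp, ← R.hf, ← R'.hf, Category.assoc, hb,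
      reassoc_of% ha])
  obtain ⟨d, hd₁, hd₂⟩ := exists_dist_hom R.dist R'.dist a b hab
  obtain ⟨c₁, hc₁⟩ := R.s₁.exists_desc ((yon k).map b ≫ R'.s₁.g) (by
    rw [reassoc_of% hb, R'.s₁.w, comp_zero])
  have hc₁' : R.s₂.f ≫ (yon k).map d = c₁ ≫ R'.s₂.f := by
    rw [← cancel_epi R.s₁.g, reassoc_of% hc₁, reassoc_of% R.hg, R'.hg, ← (yon k).map_comp,
      ← (yon k).map_comp, hd₁]
  obtain ⟨c₂, hc₂⟩ := R.s₂.exists_desc ((yon k).map d ≫ R'.s₂.g) (by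
    rw [reassoc_of% hc₁', R'.s₂.w, comp_zero])
  have hc₂' : R.s₃.f ≫ (yon k).map (a⟦(1 : ℤ)⟧') = c₂ ≫ R'.s₃.f := by
    rw [← cancel_epi R.s₂.g, reassoc_of% hc₂, reassoc_of% R.hh, R'.hh, ← (yon k).map_comp,
      ← (yon k).map_comp, hd₂]
  have hc₃ : R.s₃.g ≫ (shiftMod k T 1).map c = (yon k).map (a⟦(1 : ℤ)⟧') ≫ R'.s₃.g := by
    rw [R.hp, R'.hp, Category.assoc, ← Functor.map_comp, ← ha, Functor.map_comp,
      ← reassoc_of% yonShiftIso_inv_naturality]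
  exact connecting₃_naturality R.s₁ R.s₂ R.s₃ R'.s₁ R'.s₂ R'.s₃ hb hc₁ hc₁' hc₂ hc₂' hc₃

/-- The rotation of a resolution. -/
def rotate (R : TriResolution F F₁ F₂) : TriResolution F₁ F₂ ((shiftMod k T 1).obj F) where
  Y := R.Z
  Z := R.W
  W := R.Y⟦(1 : ℤ)⟧
  f := R.g
  g := R.h
  h := -R.f⟦(1 : ℤ)⟧'
  dist := dist_rot R.dist
  p := R.s₁.g
  epi := inferInstance
  s₁ := R.s₂
  -- The change of sign accounts for the morphism `-R.f⟦1⟧'` of the rotated triangle in the field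
  -- `hh`.
  s₂ := R.s₃.neg
  s₃ := (R.s₁.map (shiftMod k T 1)).changeMiddle (yonShiftIso k 1 R.Z)
  hf := R.hg
  hg := R.hh
  hh := by
    change (-R.s₃.g) ≫ (shiftMod k T 1).map R.s₁.f ≫ (yonShiftIso k 1 R.Z).hom = _
    rw [Preadditive.neg_comp, R.hp, Category.assoc, ← Functor.map_comp_assoc, R.hf,
      yonShiftIso_naturality, Iso.inv_hom_id_assoc, (yon k).map_neg]
  hp := rfl

/-- Both sides compose the connecting morphisms of `s₁[1]`, `s₃`, `s₂`, `s₁`; on the left `s₃`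
enters with changed sign. This is the sign `(-1)³` in the commutation of the triple suspension. -/
lemma theta_rotate (R : TriResolution F F₁ F₂) :
    R.rotate.theta ≫ (suspFunctor (ModCat k T)).map ((suspFunctor (ModCat k T)).map
        ((suspFunctor (ModCat k T)).map (connecting R.s₁))) =
      -(stabConnecting (shiftMod k T 1) R.s₁ ≫ (suspFunctor (ModCat k T)).map R.theta) := by
  have h₁ : connecting R.rotate.s₃ = stabConnecting (shiftMod k T 1) R.s₁ :=
    connecting_changeMiddle _ _
  have h₂ : connecting R.rotate.s₂ = -connecting R.s₃ := connecting_neg R.s₃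
  refine (map_comp_neg_aux (suspFunctor (ModCat k T)) (connecting R.rotate.s₃)
    (b := connecting R.s₃) h₂ (connecting R.s₂) (connecting R.s₁)).trans ?_
  rw [h₁]
  rfl

end TriResolution

open Stable

variable (k T) in
/-- The shift of `mod T` induces the triple suspension of the stable category. -/
def stabShiftIso : stabFunctor (shiftMod k T 1) ≅ (susp₃ (E := ModCat k T)).F :=
  Quotient.natIsoLift (rel (ModCat k T)) (F := stabFunctor (shiftMod k T 1))
    (G := (susp₃ (E := ModCat k T)).F)
    (NatIso.ofComponents (fun F =>
      (exists_triResolution F).choose_spec.choose_spec.some.thetaIso)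
      (fun c => TriResolution.theta_naturality _ _ c))

/-- Naturality of `theta` at the identity shows independence of the resolution, so `R.rotate` may be
used for `F₁`. -/
lemma stabShiftIso_hom_app {F F₁ F₂ : ModCat k T} (R : TriResolution F F₁ F₂) :
    (stabShiftIso k T).hom.app ((proj _).obj F) = R.theta := by
  let R' := (exists_triResolution F).choose_spec.choose_spec.some
  have h := R'.theta_naturality R (𝟙 F)
  rw [(proj _).map_id, (stabFunctor (shiftMod k T 1)).map_id, (suspFunctor _).map_id,
    (suspFunctor _).map_id, (suspFunctor _).map_id, Category.id_comp, Category.comp_id] at h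
  exact h.symm

lemma stab_shiftMod_one : (stab (shiftMod k T 1)).Isomorphic (susp₃ (E := ModCat k T)) := by
  refine ⟨stabShiftIso k T, fun X => ?_⟩
  obtain ⟨X⟩ := X
  rw [susp₃_φ_hom_app]
  let E := ModCat k T
  let σ := suspFunctor E
  obtain ⟨F₁, F₂, ⟨R⟩⟩ := exists_triResolution X
  -- The square concerns the standard sequence of `X`, while `theta_rotate` concerns `R.s₁`; the
  -- comparison map `c` transfers one to the other.
  obtain ⟨b, c, hb, hc⟩ := (std X).exists_extend R.s₁ (𝟙 X)
  rw [Category.id_comp] at hb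
  have e₁ := connecting_naturality_id (std X) R.s₁ hb hc
  have e₂ : stabConnecting (shiftMod k T 1) (std X) =
      (stabFunctor (shiftMod k T 1)).map ((proj E).map c) ≫
        stabConnecting (shiftMod k T 1) R.s₁ :=
    connecting_naturality_id ((std X).map _) (R.s₁.map _) (b := (shiftMod k T 1).map b)
      (c := (shiftMod k T 1).map c) (((shiftMod k T 1).map_comp _ _).symm.trans (congrArg _ hb))
      (((shiftMod k T 1).map_comp _ _).symm.trans
        ((congrArg _ hc).trans ((shiftMod k T 1).map_comp _ _)))
  have e₃ := (stabShiftIso k T).hom.naturality ((proj E).map c)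
  refine comm_of_connecting (stabShiftIso k T).hom X (stabComm_spec (shiftMod k T 1) (std X))
    ((Preadditive.comp_neg _ _).trans (congrArg Neg.neg (Category.comp_id _))) ?_
  let t : (stabFunctor (shiftMod k T 1)).obj ((proj E).obj (cosyzygy X)) ⟶
    σ.obj (σ.obj (σ.obj ((proj E).obj (cosyzygy X)))) := (stabShiftIso k T).hom.app _
  have e₃' : (stabFunctor (shiftMod k T 1)).map ((proj E).map c) ≫ R.rotate.theta =
      t ≫ σ.map (σ.map (σ.map ((proj E).map c))) := by
    rw [← stabShiftIso_hom_app]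
    exact e₃
  rw [stabShiftIso_hom_app R]
  change stabConnecting (shiftMod k T 1) (std X) ≫ σ.map R.theta =
    t ≫ (-σ.map (σ.map (σ.map (connecting (std X)))))
  rw [e₂, e₁, Preadditive.comp_neg, Functor.map_comp, Functor.map_comp, Functor.map_comp,
    ← reassoc_of% e₃', R.theta_rotate, Preadditive.comp_neg, neg_neg, Category.assoc]

instance : (triData (ModCat k T)).S.functor.Additive :=
  inferInstanceAs (suspFunctor (ModCat k T)).Additive

/-- The left side turns sums of integers into products, and its value at `1` is the cube of the unit
`u`; induction in both directions does the rest. -/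
lemma cls_stab_shiftMod (n : ℤ) : (stab (shiftMod k T n)).cls =
    ((SFunctor.suspUnit (triData (ModCat k T)) ^ (3 * n) : (SFunctor.IsoClass _)ˣ) :
      SFunctor.IsoClass (triData (ModCat k T))) := by
  let u := SFunctor.suspUnit (triData (ModCat k T))
  let A (n : ℤ) := (stab (shiftMod k T n)).cls
  have hadd (a b c : ℤ) (h : a + b = c) : A c = A a * A b := by
    rw [← SFunctor.cls_comp]
    exact SFunctor.cls_eq_iff.2 ((stab_isomorphic (shiftModAdd k T a b c h)).trans (stab_comp _ _))
  have hzero : A 0 = 1 := by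
    rw [← SFunctor.cls_id]
    exact SFunctor.cls_eq_iff.2 ((stab_isomorphic (shiftModZero k T 0 rfl)).trans stab_id)
  have hone : A 1 = ((u ^ (3 : ℤ) : (SFunctor.IsoClass _)ˣ) : SFunctor.IsoClass _) := by
    refine (SFunctor.cls_eq_iff.2 stab_shiftMod_one).trans ?_
    rw [show (3 : ℤ) = ((3 : ℕ) : ℤ) from rfl, zpow_natCast, Units.val_pow_eq_pow_val, pow_succ,
      pow_two]
    rfl
  change A n = _
  induction n with
  | zero => rw [hzero, mul_zero, zpow_zero, Units.val_one]
  | succ n ih =>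
    rw [hadd n 1 _ rfl, ih, hone, mul_add, zpow_add, Units.val_mul]
    rfl
  | pred n ih =>
    have h := hadd (-n - 1) 1 (-n) (by omega)
    rw [ih, hone] at h
    rw [mul_sub, mul_one, zpow_sub, Units.val_mul, Units.eq_mul_inv_iff_mul_eq]
    exact h.symm

end

end

section

/-! ### Serre functors from pairings -/

section Pairing

variable (k : Type w) [Field k] {C : Type u} [Category.{v} C] [Preadditive C] [Linear k C]

/-- Perfect natural pairings between `Hom(M X, Y)` and `Hom(Y, F X)`. -/
structure NatPairing (M F : C ⥤ C) where
  /-- the pairings -/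
  B : ∀ X Y : C, (Y ⟶ F.obj X) →ₗ[k] Module.Dual k (M.obj X ⟶ Y)
  bijective : ∀ X Y : C, Function.Bijective (B X Y)
  comp_right : ∀ {X Y Y' : C} (q : Y' ⟶ F.obj X) (c : M.obj X ⟶ Y) (y : Y ⟶ Y'),
    B X Y' q (c ≫ y) = B X Y (y ≫ q) c
  comp_left : ∀ {X X' Y : C} (q : Y ⟶ F.obj X) (a : X ⟶ X') (c : M.obj X' ⟶ Y),
    B X' Y (q ≫ F.map a) c = B X Y q (M.map a ≫ c)

variable {k}

/-- A perfect natural pairing between `Hom(X, Y)` and `Hom(Y, F X)` makes `F` a Serre functor. -/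
def NatPairing.serreIso {F : C ⥤ C} (t : NatPairing k (𝟭 C) F) : SerreIso k F where
  e X Y := (LinearEquiv.ofBijective (t.B X Y) (t.bijective X Y)).symm
  naturality_right {X Y Y'} g ξ := by
    obtain ⟨q, rfl⟩ := (LinearEquiv.ofBijective (t.B X Y) (t.bijective X Y)).surjective ξ
    rw [LinearEquiv.symm_apply_apply, LinearEquiv.eq_symm_apply]
    ext c
    exact (t.comp_right q c g).symm
  naturality_left {X X' Y} a ξ := by
    obtain ⟨q, rfl⟩ := (LinearEquiv.ofBijective (t.B X Y) (t.bijective X Y)).surjective ξ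
    rw [LinearEquiv.symm_apply_apply, LinearEquiv.eq_symm_apply]
    ext c
    exact t.comp_left q a c

/-- Transport of a pairing along an equivalence. -/
def NatPairing.unshift (S : C ≌ C) {F : C ⥤ C} (t : NatPairing k S.functor F) :
    NatPairing k (𝟭 C) (S.inverse ⋙ F) where
  B X Y := (Linear.leftComp k Y (S.counit.app X)).dualMap ∘ₗ t.B (S.inverse.obj X) Y
  bijective X Y := by
    have h : Function.Bijective (Linear.leftComp k Y (S.counit.app X)) :=
      ⟨fun a b h => (cancel_epi (S.counit.app X)).1 h,
        fun a => ⟨S.counitInv.app X ≫ a, by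
          change S.counit.app X ≫ S.counitInv.app X ≫ a = a
          rw [← Category.assoc, S.counitIso.hom_inv_id_app]
          exact Category.id_comp a⟩⟩
    have h' : Function.Bijective (Linear.leftComp k Y (S.counit.app X)).dualMap :=
      (LinearEquiv.ofBijective _ h).dualMap.bijective
    exact h'.comp (t.bijective _ _)
  comp_right {X Y Y'} q c y := by
    change t.B _ _ q (S.counit.app X ≫ c ≫ y) = t.B _ _ (y ≫ q) (S.counit.app X ≫ c)
    rw [← Category.assoc, t.comp_right]
  comp_left {X X' Y} q a c := by
    change t.B _ _ (q ≫ F.map (S.inverse.map a)) (S.counit.app X' ≫ c) =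
      t.B _ _ q (S.counit.app X ≫ a ≫ c)
    rw [t.comp_left, ← Category.assoc, ← Category.assoc]
    exact congrArg (fun z => t.B _ _ q (z ≫ c)) (S.counit.naturality a)

/-- The compatibility with the suspension of a pairing twisted by the suspension. -/
lemma NatPairing.isCompatible {𝒯 : TriData C} [𝒯.S.functor.Additive] {A : SFunctor 𝒯}
    [A.F.Additive] (t : NatPairing k 𝒯.S.functor A.F)
    (h : ∀ (X Y : C) (q : Y ⟶ A.F.obj X) (c : 𝒯.S.functor.obj X ⟶ Y),
      t.B (𝒯.S.functor.obj X) (𝒯.S.functor.obj Y) (𝒯.S.functor.map q ≫ A.φ.inv.app X)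
        (𝒯.S.functor.map c) = t.B X Y q c) :
    SerreIso.IsCompatible k (ν := (SFunctor.suspInv 𝒯).comp A) (t.unshift 𝒯.S).serreIso := by
  intro X Y f g
  let S := 𝒯.S.functor
  let R := 𝒯.S.inverse
  have e₁ : ((SFunctor.suspInv 𝒯).comp A).φ.inv.app X =
      A.φ.inv.app (R.obj X) ≫ A.F.map ((SFunctor.suspInv 𝒯).φ.inv.app X) := by
    simp [SFunctor.comp]
    rfl
  let η : X ⟶ R.obj (S.obj X) := 𝒯.S.unit.app X
  let ε : S.obj (R.obj X) ⟶ X := 𝒯.S.counit.app X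
  let ε' : S.obj (R.obj (S.obj X)) ⟶ S.obj X := 𝒯.S.counit.app (S.obj X)
  let ρ : S.obj (R.obj X) ⟶ R.obj (S.obj X) := (SFunctor.suspInv 𝒯).φ.inv.app X
  -- The sign in the commutation of `suspInv` enters here; it is the only source of the `-1` in the
  -- conclusion.
  have e₂ : ρ = -(ε ≫ η) := by
    change (SFunctor.suspInv 𝒯).φ.inv.app X = _
    simp [SFunctor.suspInv, SFunctor.negIso]
    rfl
  have e₃ : S.map η ≫ ε' = 𝟙 _ := 𝒯.S.functor_unitIso_comp X
  let q : S.obj Y ⟶ A.F.obj (S.obj (R.obj X)) := S.map g ≫ A.φ.inv.app (R.obj X)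
  have e₄ : S.map g ≫ ((SFunctor.suspInv 𝒯).comp A).φ.inv.app X = q ≫ A.F.map ρ :=
    (congrArg (S.map g ≫ ·) e₁).trans (Category.assoc _ _ _).symm
  have e₅ : S.map ρ ≫ ε' ≫ S.map f = -S.map (ε ≫ f) := by
    rw [e₂, S.map_neg, Preadditive.neg_comp, S.map_comp, Category.assoc, reassoc_of% e₃, S.map_comp]
  change t.B (R.obj (S.obj X)) (S.obj Y)
    (S.map g ≫ ((SFunctor.suspInv 𝒯).comp A).φ.inv.app X) (ε' ≫ S.map f) =
      -(t.B (R.obj X) Y g (ε ≫ f))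
  have := h (R.obj X) Y g (ε ≫ f)
  refine (congrArg (fun z => t.B (R.obj (S.obj X)) (S.obj Y) z (ε' ≫ S.map f)) e₄).trans ?_
  refine (t.comp_left q ρ _).trans ?_
  refine (congrArg (t.B _ _ q) e₅).trans ?_
  rw [LinearMap.map_neg]
  exact congrArg Neg.neg this

end Pairing

namespace Stable

attribute [local instance] abelian

variable {k : Type w} [Field k] {E : Type u} [Category.{v} E] [Preadditive E] [Linear k E]

/-! ### Traces on the injective objects -/

variable (k) in
/-- Nondegenerate traces `Hom(P, N P) ⟶ k` for the injective objects `P`. -/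
structure Trace (N : E ⥤ E) where
  /-- the traces -/
  tr : ∀ (P : E) [Injective P], (P ⟶ N.obj P) →ₗ[k] k
  cyclic : ∀ {P Q : E} [Injective P] [Injective Q] (u : P ⟶ Q) (x : Q ⟶ N.obj P),
    tr P (u ≫ x) = tr Q (x ≫ N.map u)
  eq_zero : ∀ {P G : E} [Injective P] (x : G ⟶ N.obj P),
    (∀ u : P ⟶ G, tr P (u ≫ x) = 0) → x = 0
  exists_repr : ∀ {P G : E} [Injective P] (ψ : (P ⟶ G) →ₗ[k] k),
    ∃ x : G ⟶ N.obj P, ∀ u : P ⟶ G, tr P (u ≫ x) = ψ u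

/-- Over a field, the image of the dual map of `L` is the whole annihilator of the kernel of `L`; no
finiteness is needed. -/
lemma exists_extend_functional {V W : Type*} [AddCommGroup V] [Module k V] [AddCommGroup W]
    [Module k W] (L : V →ₗ[k] W) (χ : V →ₗ[k] k) (h : ∀ v, L v = 0 → χ v = 0) :
    ∃ ψ : W →ₗ[k] k, ∀ v, ψ (L v) = χ v := by
  have : χ ∈ LinearMap.range L.dualMap := by
    rw [LinearMap.range_dualMap_eq_dualAnnihilator_ker, Submodule.mem_dualAnnihilator]
    exact fun v hv => h v hv
  obtain ⟨ψ, rfl⟩ := this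
  exact ⟨ψ, fun _ => rfl⟩

namespace Trace

variable {N : E ⥤ E} (t : Trace k N)

section

variable {F I C G F' I' C' G' : E} [Injective I] [Injective I']

/-- The pairing between `Hom(C, G)` and `Hom(G, N F)` for a short exact sequence
`0 ⟶ F ⟶ I ⟶ C ⟶ 0` with injective middle term. -/
def pair (s : SES F I C) (c : C ⟶ G) (q : G ⟶ N.obj F) : k := t.tr I (s.g ≫ c ≫ q ≫ N.map s.f)

lemma pair_comp (s : SES F I C) (c : C ⟶ G) (y : G ⟶ G') (q : G' ⟶ N.obj F) :
    t.pair s (c ≫ y) q = t.pair s c (y ≫ q) := by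
  simp only [pair, Category.assoc]

lemma pair_naturality (s : SES F I C) (s' : SES F' I' C') {a : F ⟶ F'} {b : I ⟶ I'} {c : C ⟶ C'}
    (h₁ : s.f ≫ b = a ≫ s'.f) (h₂ : s.g ≫ c = b ≫ s'.g) (y : C' ⟶ G) (q : G ⟶ N.obj F) :
    t.pair s (c ≫ y) q = t.pair s' y (q ≫ N.map a) := by
  simp only [pair, Category.assoc]
  rw [reassoc_of% h₂, t.cyclic, Category.assoc, Category.assoc, Category.assoc, ← N.map_comp, h₁,
    N.map_comp]

/-- Cyclicity moves the trace from `I` to `J`, where `s.f` and `s.g` meet and compose to zero. Hence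
the pairing descends to the stable category. -/
lemma pair_of_injective [N.PreservesZeroMorphisms] (s : SES F I C) {J : E} [Injective J]
    (a : C ⟶ J) (x : J ⟶ N.obj F) : t.tr I (s.g ≫ a ≫ x ≫ N.map s.f) = 0 := by
  rw [← Category.assoc, t.cyclic, Category.assoc, ← N.map_comp, ← Category.assoc s.f, s.w,
    zero_comp, N.map_zero, comp_zero, LinearMap.map_zero]

lemma pair_add_left (s : SES F I C) (c c' : C ⟶ G) (q : G ⟶ N.obj F) :
    t.pair s (c + c') q = t.pair s c q + t.pair s c' q := by
  simp only [pair, Preadditive.add_comp, Preadditive.comp_add, map_add]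

lemma pair_add_right (s : SES F I C) (c : C ⟶ G) (q q' : G ⟶ N.obj F) :
    t.pair s c (q + q') = t.pair s c q + t.pair s c q' := by
  simp only [pair, Preadditive.add_comp, Preadditive.comp_add, map_add]

lemma pair_smul_left (s : SES F I C) (r : k) (c : C ⟶ G) (q : G ⟶ N.obj F) :
    t.pair s (r • c) q = r * t.pair s c q := by
  simp only [pair, Linear.smul_comp, Linear.comp_smul, map_smul, smul_eq_mul]

lemma pair_smul_right (s : SES F I C) (r : k) (c : C ⟶ G) (q : G ⟶ N.obj F) :
    t.pair s c (r • q) = r * t.pair s c q := by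
  simp only [pair, Linear.smul_comp, Linear.comp_smul, map_smul, smul_eq_mul]

end

variable [IsFrobeniusAbelian E]

section

variable {F I C G F' I' C' G' : E} [Injective I] [Injective I']

variable [N.Additive]

lemma pair_congr (s : SES F I C) {c c' : C ⟶ G} {q q' : G ⟶ N.obj F}
    (hc : (proj E).map c = (proj E).map c') (hq : (proj E).map q = (proj E).map q') :
    t.pair s c q = t.pair s c' q' := by
  obtain ⟨J, hJ, a, b, h⟩ := (Quotient.functor_map_eq_iff _ _ _).1 hc
  obtain ⟨J', hJ', a', b', h'⟩ := (Quotient.functor_map_eq_iff _ _ _).1 hq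
  rw [sub_eq_iff_eq_add] at h h'
  rw [h, h', pair_add_left, pair_add_right, pair_add_right]
  have e₁ (x : G ⟶ N.obj F) : t.pair s (a ≫ b) x = 0 := by
    rw [pair, ← t.pair_of_injective s a (b ≫ x)]
    simp only [Category.assoc]
  have e₂ : t.pair s c' (a' ≫ b') = 0 := by
    rw [pair, ← t.pair_of_injective s (c' ≫ a') b']
    simp only [Category.assoc]
  rw [e₁, e₁, e₂, zero_add, zero_add, zero_add]

variable [N.IsEquivalence]

/-- The functional `u ↦ tr (u ≫ q ≫ N s.f)` on `Hom(I, G)` vanishes on maps which are zero on `F`,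
since these come from `C`. It therefore depends only on the restriction of `u` to a projective cover
`P ⟶ F`, where it is represented by some `r : G ⟶ N P`. Nondegeneracy forces `q = r ≫ N π`, a
factorization through the injective object `N P`. -/
lemma proj_map_eq_zero_of_pair (s : SES F I C) (q : G ⟶ N.obj F)
    (h : ∀ c : C ⟶ G, t.pair s c q = 0) : (proj E).map q = 0 := by
  let π := Projective.π F
  have : Injective (Projective.over F) :=
    (IsFrobeniusAbelian.projective_iff_injective _).1 inferInstance
  obtain ⟨ψ, hψ⟩ := exists_extend_functional (Linear.leftComp k G (π ≫ s.f))
    (t.tr I ∘ₗ Linear.rightComp k I (q ≫ N.map s.f)) (fun u hu => by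
      replace hu : (π ≫ s.f) ≫ u = 0 := hu
      rw [Category.assoc] at hu
      obtain ⟨c, rfl⟩ := s.exists_desc u (zero_of_epi_comp π hu)
      exact (congrArg (t.tr I) (Category.assoc _ _ _)).trans (h c))
  obtain ⟨r, hr⟩ := t.exists_repr ψ
  have e : q ≫ N.map s.f = r ≫ N.map (π ≫ s.f) := by
    rw [← sub_eq_zero]
    refine t.eq_zero _ fun u => ?_
    have h₁ : t.tr I (u ≫ q ≫ N.map s.f) = t.tr _ (((π ≫ s.f) ≫ u) ≫ r) :=
      ((hr _).trans (hψ u)).symm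
    rw [Preadditive.comp_sub, map_sub, h₁, Category.assoc, t.cyclic, Category.assoc, sub_self]
  have e' : q = r ≫ N.map π := by
    rw [← cancel_mono (N.map s.f), e, N.map_comp, Category.assoc]
  rw [← (proj E).map_zero, Quotient.functor_map_eq_iff]
  exact ⟨N.obj (Projective.over F), injective_obj N _, r, N.map π, by rw [sub_zero, e']⟩

/-- Extend `ψ` to `Hom(I, G)` and represent it by `x : G ⟶ N I`. Because `ψ` kills maps factoring
through injectives, `x` dies in `N C`, so it lifts to `G ⟶ N F`. -/
lemma exists_pair_eq (s : SES F I C) (ψ : (C ⟶ G) →ₗ[k] k)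
    (h : ∀ c : C ⟶ G, (proj E).map c = 0 → ψ c = 0) :
    ∃ q : G ⟶ N.obj F, ∀ c, t.pair s c q = ψ c := by
  obtain ⟨ψ', hψ'⟩ := exists_extend_functional (Linear.leftComp k G s.g) ψ
    (fun c hc => by rw [zero_of_epi_comp s.g hc, map_zero])
  obtain ⟨x, hx⟩ := t.exists_repr ψ'
  have hx' (c : C ⟶ G) : t.tr I (s.g ≫ c ≫ x) = ψ c := by
    rw [← Category.assoc, hx]
    exact hψ' c
  let π := Projective.π G
  let j := Injective.ι C
  have e : x ≫ (s.map N).g = 0 := by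
    -- Embedding `C` into an injective makes the trace available: the test values become `ψ (j ≫ u ≫
    -- π)`, and `j ≫ u ≫ π` is stably zero.
    rw [← cancel_mono (N.map j), ← cancel_epi π, zero_comp, comp_zero]
    refine t.eq_zero _ fun u => ?_
    have : u ≫ π ≫ (x ≫ (s.map N).g) ≫ N.map j = (u ≫ π ≫ x) ≫ N.map (s.g ≫ j) := by
      rw [N.map_comp]
      simp only [Category.assoc]
      rfl
    rw [this, ← t.cyclic]
    have e' := hx' (j ≫ u ≫ π)
    simp only [Category.assoc] at e' ⊢
    rw [e']
    refine h _ ?_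
    rw [← (proj E).map_zero, Quotient.functor_map_eq_iff]
    exact ⟨_, inferInstance, j, u ≫ π, by rw [sub_zero]⟩
  obtain ⟨q, hq⟩ := (s.map N).exists_lift x e
  refine ⟨q, fun c => ?_⟩
  rw [← hx', ← hq]
  rfl

end

/-! ### The pairings of the stable category -/

section

variable [N.IsEquivalence] [N.Additive] {F I C F' I' C' : E} [Injective I] [Injective I']

/-- The pairing induced by `pair` on the stable category. -/
def stabPair (s : SES F I C) {Y : StableCat E} (q : Y ⟶ (stabFunctor N).obj ((proj E).obj F))
    (c : (proj E).obj C ⟶ Y) : k :=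
  t.pair s ((proj E).map_surjective (Y := Y.as) c).choose
    ((proj E).map_surjective (X := Y.as) (Y := N.obj F) q).choose

lemma stabPair_map (s : SES F I C) {G : E} (q : G ⟶ N.obj F) (c : C ⟶ G) :
    t.stabPair s ((proj E).map q) ((proj E).map c) = t.pair s c q :=
  t.pair_congr s ((proj E).map_surjective (Y := G) ((proj E).map c)).choose_spec
    ((proj E).map_surjective (X := G) (Y := N.obj F) ((proj E).map q)).choose_spec

lemma stabPair_comp (s : SES F I C) {Y Y' : StableCat E}
    (q : Y' ⟶ (stabFunctor N).obj ((proj E).obj F)) (c : (proj E).obj C ⟶ Y) (y : Y ⟶ Y') :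
    t.stabPair s q (c ≫ y) = t.stabPair s (y ≫ q) c := by
  obtain ⟨G⟩ := Y
  obtain ⟨G'⟩ := Y'
  obtain ⟨q, rfl⟩ := (proj E).map_surjective (X := G') (Y := N.obj F) q
  obtain ⟨c, rfl⟩ := (proj E).map_surjective (Y := G) c
  obtain ⟨y, rfl⟩ := (proj E).map_surjective (X := G) (Y := G') y
  refine (congrArg (t.stabPair s _) ((proj E).map_comp c y).symm).trans ?_
  refine Eq.trans ?_ (congrArg (t.stabPair s · _) ((proj E).map_comp y q))
  exact (t.stabPair_map s q (c ≫ y)).trans ((t.pair_comp s c y q).trans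
    (t.stabPair_map s (y ≫ q) c).symm)

lemma stabPair_naturality (s : SES F I C) (s' : SES F' I' C') {a : F ⟶ F'} {b : I ⟶ I'}
    {c : C ⟶ C'} (h₁ : s.f ≫ b = a ≫ s'.f) (h₂ : s.g ≫ c = b ≫ s'.g) {Y : StableCat E}
    (y : (proj E).obj C' ⟶ Y) (q : Y ⟶ (stabFunctor N).obj ((proj E).obj F)) :
    t.stabPair s q ((proj E).map c ≫ y) =
      t.stabPair s' (q ≫ (stabFunctor N).map ((proj E).map a)) y := by
  obtain ⟨G⟩ := Y
  obtain ⟨q, rfl⟩ := (proj E).map_surjective (X := G) (Y := N.obj F) q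
  obtain ⟨y, rfl⟩ := (proj E).map_surjective (Y := G) y
  refine (congrArg (t.stabPair s _) ((proj E).map_comp c y).symm).trans ?_
  refine Eq.trans ?_ (congrArg (t.stabPair s' · _) ((proj E).map_comp q (N.map a)))
  exact (t.stabPair_map s q (c ≫ y)).trans ((t.pair_naturality s s' h₁ h₂ y q).trans
    (t.stabPair_map s' (q ≫ N.map a) y).symm)

instance : (proj E).Linear k := Quotient.linear_functor k _ _

/-- The pairing as a bilinear map. -/
def stabPairing (s : SES F I C) (Y : StableCat E) :
    (Y ⟶ (stabFunctor N).obj ((proj E).obj F)) →ₗ[k] Module.Dual k ((proj E).obj C ⟶ Y) :=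
  LinearMap.mk₂ k (t.stabPair s)
    (fun q q' c => by
      obtain ⟨G⟩ := Y
      obtain ⟨q, rfl⟩ := (proj E).map_surjective (X := G) (Y := N.obj F) q
      obtain ⟨q', rfl⟩ := (proj E).map_surjective (X := G) (Y := N.obj F) q'
      obtain ⟨c, rfl⟩ := (proj E).map_surjective (Y := G) c
      refine (congrArg (t.stabPair s · _) (proj E).map_add.symm).trans ?_
      refine (t.stabPair_map s (q + q') c).trans ((t.pair_add_right s c q q').trans ?_)
      exact congrArg₂ _ (t.stabPair_map s q c).symm (t.stabPair_map s q' c).symm)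
    (fun r q c => by
      obtain ⟨G⟩ := Y
      obtain ⟨q, rfl⟩ := (proj E).map_surjective (X := G) (Y := N.obj F) q
      obtain ⟨c, rfl⟩ := (proj E).map_surjective (Y := G) c
      refine (congrArg (t.stabPair s · _) ((proj E).map_smul r q).symm).trans ?_
      refine (t.stabPair_map s (r • q) c).trans ((t.pair_smul_right s r c q).trans ?_)
      exact congrArg (r * ·) (t.stabPair_map s q c).symm)
    (fun q c c' => by
      obtain ⟨G⟩ := Y
      obtain ⟨q, rfl⟩ := (proj E).map_surjective (X := G) (Y := N.obj F) q
      obtain ⟨c, rfl⟩ := (proj E).map_surjective (Y := G) c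
      obtain ⟨c', rfl⟩ := (proj E).map_surjective (Y := G) c'
      refine (congrArg (t.stabPair s _) (proj E).map_add.symm).trans ?_
      refine (t.stabPair_map s q (c + c')).trans ((t.pair_add_left s c c' q).trans ?_)
      exact congrArg₂ _ (t.stabPair_map s q c).symm (t.stabPair_map s q c').symm)
    (fun r q c => by
      obtain ⟨G⟩ := Y
      obtain ⟨q, rfl⟩ := (proj E).map_surjective (X := G) (Y := N.obj F) q
      obtain ⟨c, rfl⟩ := (proj E).map_surjective (Y := G) c
      refine (congrArg (t.stabPair s _) ((proj E).map_smul r c).symm).trans ?_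
      refine (t.stabPair_map s q (r • c)).trans ((t.pair_smul_left s r c q).trans ?_)
      exact congrArg (r * ·) (t.stabPair_map s q c).symm)

lemma stabPairing_bijective (s : SES F I C) (Y : StableCat E) :
    Function.Bijective (t.stabPairing s Y) := by
  obtain ⟨G⟩ := Y
  constructor
  · rw [injective_iff_map_eq_zero]
    intro q hq
    obtain ⟨q, rfl⟩ := (proj E).map_surjective (X := G) (Y := N.obj F) q
    exact t.proj_map_eq_zero_of_pair s q fun c =>
      (t.stabPair_map s q c).symm.trans (LinearMap.congr_fun hq ((proj E).map c))
  · intro ψ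
    obtain ⟨q, hq⟩ := t.exists_pair_eq (G := G) s
      ((ψ : ((proj E).obj C ⟶ (proj E).obj G) →ₗ[k] k) ∘ₗ
        ((proj E).mapLinearMap k : (C ⟶ G) →ₗ[k] _))
      (fun c hc => (congrArg ψ hc).trans (map_zero ψ))
    refine ⟨(proj E).map q, LinearMap.ext fun c => ?_⟩
    obtain ⟨c, rfl⟩ := (proj E).map_surjective (Y := G) c
    exact (t.stabPair_map s q c).trans (hq c)

/-- The natural pairing on the stable category given by a trace. -/
def natPairing : NatPairing k (suspFunctor E) (stabFunctor N) where
  B X Y := t.stabPairing (std X.as) Y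
  bijective X Y := t.stabPairing_bijective (std X.as) Y
  comp_right {X Y Y'} q c y := t.stabPair_comp (std X.as) q c y
  comp_left {X X' Y} q a c := by
    obtain ⟨X⟩ := X
    obtain ⟨X'⟩ := X'
    obtain ⟨a, rfl⟩ := (proj E).map_surjective (X := X) (Y := X') a
    obtain ⟨b, d, hb, hd⟩ := (std X).exists_extend (std X') a
    have e := connecting_naturality (std X) (std X') hb hd
    rw [connecting_std, connecting_std] at e
    have e' : (suspFunctor E).map ((proj E).map a) = (proj E).map d :=
      (Category.id_comp _).symm.trans (e.trans (Category.comp_id _))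
    refine ((t.stabPair_naturality (std X) (std X') hb hd c q).symm.trans ?_)
    exact congrArg (fun z => t.stabPair (std X) q (z ≫ c)) e'.symm

/-- Representing the suspensions of `c` and `q` by morphisms of short exact sequences, cyclicity
carries the trace over `hull (cosyzygy F)` to the one over `hull F`; no sign appears. -/
lemma natPairing_suspend {F G : E} (q : G ⟶ N.obj F) (c : cosyzygy F ⟶ G)
    (r : (suspFunctor E).obj ((proj E).obj G) ⟶ (stabFunctor N).obj ((proj E).obj (cosyzygy F)))
    (hr : r ≫ stabConnecting N (std F) = (suspFunctor E).map ((proj E).map q)) :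
    t.stabPair (std (cosyzygy F)) r
      (connecting (std (cosyzygy F)) ≫ (suspFunctor E).map ((proj E).map c)) =
        t.pair (std F) c q := by
  obtain ⟨b, c', hb, hc⟩ := (std (cosyzygy F)).exists_extend (std G) c
  obtain ⟨d, q', hd, hq⟩ := (std G).exists_extend ((std F).map N) q
  have e₁ := connecting_naturality _ _ hb hc
  let q₁ : (proj E).obj (cosyzygy G) ⟶ (stabFunctor N).obj ((proj E).obj (cosyzygy F)) :=
    (proj E).map q'
  have e₂ : connecting (std G) ≫ (suspFunctor E).map ((proj E).map q) =
    q₁ ≫ stabConnecting N (std F) := connecting_naturality _ _ hd hq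
  have e₃ : connecting (std G) ≫ r = q₁ := by
    rw [← cancel_mono (stabConnecting N (std F)), Category.assoc]
    exact (congrArg (connecting (std G) ≫ ·) hr).trans e₂
  rw [e₁, t.stabPair_comp, e₃]
  refine (t.stabPair_map _ _ _).trans ?_
  change t.tr _ _ = t.tr _ _
  replace hd : (std G).f ≫ d = q ≫ N.map (std F).f := hd
  replace hq : (std G).g ≫ q' = d ≫ N.map (std F).g := hq
  rw [reassoc_of% hc, reassoc_of% hq, ← N.map_comp, ← Category.assoc, ← t.cyclic,
    Category.assoc, reassoc_of% hb, hd]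

lemma natPairing_compatible (X Y : StableCat E) (q : Y ⟶ (stabFunctor N).obj X)
    (c : (suspFunctor E).obj X ⟶ Y) :
    t.natPairing.B ((suspFunctor E).obj X) ((suspFunctor E).obj Y)
      ((suspFunctor E).map q ≫ (stab N).φ.inv.app X) ((suspFunctor E).map c) =
        t.natPairing.B X Y q c := by
  obtain ⟨F⟩ := X
  obtain ⟨G⟩ := Y
  obtain ⟨q, rfl⟩ := (proj E).map_surjective (X := G) (Y := N.obj F) q
  obtain ⟨c, rfl⟩ := (proj E).map_surjective (X := cosyzygy F) (Y := G) c
  refine Eq.trans ?_ ((t.natPairing_suspend q c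
    ((suspFunctor E).map ((proj E).map q) ≫ (stabComm N F).inv) ?_).trans
      (t.stabPair_map _ _ _).symm)
  · rw [connecting_std]
    exact congrArg (t.stabPair _ _) (Category.id_comp _).symm
  · have e := stabComm_spec N (std F)
    rw [connecting_std] at e
    have e' : (stabComm N F).hom = stabConnecting N (std F) :=
      (Category.id_comp _).symm.trans
        ((congrArg (· ≫ (stabComm N F).hom) ((stabFunctor N).map_id _).symm).trans e)
    refine (Category.assoc _ _ _).trans ?_
    refine (congrArg (_ ≫ ·) ((congrArg ((stabComm N F).inv ≫ ·) e'.symm).trans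
      (stabComm N F).inv_hom_id)).trans (Category.comp_id _)

end

end Trace

end Stable

end

section

open Opposite Pretriangulated Stable

/-! ### The trace given by a Serre functor -/

section Transport

variable {k : Type w} [Field k] {C : Type u} [Category.{v} C] [Preadditive C] [Linear k C]

/-- Transport of a Serre functor along an isomorphism of functors. -/
def SerreIso.ofIso {F G : C ⥤ C} (s : SerreIso k F) (α : F ≅ G) : SerreIso k G where
  e X Y := s.e X Y ≪≫ₗ Linear.homCongr k (Iso.refl Y) (α.app X)
  naturality_right {X Y Y'} g ξ := by
    simp [Linear.homCongr, ← s.naturality_right]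
  naturality_left {X X' Y} u ξ := by
    simp [Linear.homCongr, ← s.naturality_left]

variable {F : C ⥤ C} (s : SerreIso k F)

lemma SerreIso.symm_comp_left {X Y Y' : C} (g : Y' ⟶ Y) (x : Y ⟶ F.obj X) (f : X ⟶ Y') :
    (s.e X Y').symm (g ≫ x) f = (s.e X Y).symm x (f ≫ g) := by
  obtain ⟨ξ, rfl⟩ := (s.e X Y).surjective x
  rw [s.naturality_right, LinearEquiv.symm_apply_apply, LinearEquiv.symm_apply_apply]
  rfl

lemma SerreIso.symm_comp_right {X X' Y : C} (u : X ⟶ X') (x : Y ⟶ F.obj X) (f : X' ⟶ Y) :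
    (s.e X' Y).symm (x ≫ F.map u) f = (s.e X Y).symm x (u ≫ f) := by
  obtain ⟨ξ, rfl⟩ := (s.e X Y).surjective x
  rw [s.naturality_left, LinearEquiv.symm_apply_apply, LinearEquiv.symm_apply_apply]
  rfl

end Transport

section

variable {k : Type w} [Field k] {T : Type u} [Category.{v} T] [Preadditive T] [Linear k T]
variable [HasShift T ℤ] [∀ n : ℤ, (shiftFunctor T n).Additive] [HasZeroObject T]
  [Pretriangulated T]

attribute [local instance] Stable.abelian

lemma finite_hom (h : ∀ X Y : T, Module.Finite k (X ⟶ Y)) (F G : StableCat (ModCat k T)) :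
    Module.Finite k (F ⟶ G) := by
  obtain ⟨F⟩ := F
  obtain ⟨G⟩ := G
  obtain ⟨Y, p, hp⟩ := exists_epi_yon F
  obtain ⟨A, q, hq⟩ := exists_epi_yon G
  have h₁ : Module.Finite k ((yon k).obj Y ⟶ G) :=
    have := h Y A
    Module.Finite.of_surjective (Linear.rightComp k _ q ∘ₗ (yon k).mapLinearMap k)
      fun u => by
        obtain ⟨v, hv⟩ := (yon k).map_surjective (Projective.factorThru u q)
        exact ⟨v, (congrArg (· ≫ q) hv).trans (Projective.factorThru_comp u q)⟩
  have h₂ : Module.Finite k (F ⟶ G) :=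
    Module.Finite.of_injective (Linear.leftComp k G p) fun a b hab => (cancel_epi p).1 hab
  exact Module.Finite.of_surjective ((proj (ModCat k T)).mapLinearMap k : (F ⟶ G) →ₗ[k] _)
    (proj (ModCat k T)).map_surjective

end

variable {k : Type w} [Field k] {T : Type u} [Category.{v} T] [Preadditive T] [Linear k T]
variable [HasShift T ℤ] [∀ n : ℤ, (shiftFunctor T n).Additive]
  [∀ n : ℤ, (shiftFunctor T n).Linear k]

section Trace

variable {d : ℤ} (s : SerreIso k (shiftFunctor T d))

/-- The trace on a representable functor. -/
def yonTrace (Y : T) : ((yon k).obj Y ⟶ (shiftMod k T d).obj ((yon k).obj Y)) →ₗ[k] k where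
  toFun x := (s.e Y Y).symm ((yon k).preimage (x ≫ (yonShiftIso k d Y).hom)) (𝟙 Y)
  map_add' x y := by
    have : (yon k).preimage ((x + y) ≫ (yonShiftIso k d Y).hom) =
        (yon k).preimage (x ≫ (yonShiftIso k d Y).hom) +
          (yon k).preimage (y ≫ (yonShiftIso k d Y).hom) :=
      (yon k).map_injective (by simp)
    rw [this, map_add, LinearMap.add_apply]
  map_smul' c x := by
    have : (yon k).preimage ((c • x) ≫ (yonShiftIso k d Y).hom) =
        c • (yon k).preimage (x ≫ (yonShiftIso k d Y).hom) :=
      (yon k).map_injective (by simp [(yon k).map_smul])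
    rw [this, map_smul, LinearMap.smul_apply, RingHom.id_apply]

lemma yonTrace_map_comp {Y Z : T} (v : Y ⟶ Z) (a : Z ⟶ Y⟦d⟧) :
    yonTrace s Y ((yon k).map v ≫ (yon k).map a ≫ (yonShiftIso k d Y).inv) =
      (s.e Y Z).symm a v := by
  have : (yon k).preimage (((yon k).map v ≫ (yon k).map a ≫ (yonShiftIso k d Y).inv) ≫
      (yonShiftIso k d Y).hom) = v ≫ a := (yon k).map_injective (by simp)
  refine (congrArg (fun z => (s.e Y Y).symm z (𝟙 Y)) this).trans ?_
  rw [s.symm_comp_left, Category.id_comp]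

lemma exists_map_comp_inv {A Y : T} (x : (yon k).obj A ⟶ (shiftMod k T d).obj ((yon k).obj Y)) :
    ∃ a : A ⟶ Y⟦d⟧, (yon k).map a ≫ (yonShiftIso k d Y).inv = x :=
  ⟨(yon k).preimage (x ≫ (yonShiftIso k d Y).hom), by simp⟩

/-- Both traces equal the Serre pairing of the same two morphisms of `T`, by naturality in each
variable. -/
lemma yonTrace_cyclic {Y Z : T} (u : (yon k).obj Y ⟶ (yon k).obj Z)
    (x : (yon k).obj Z ⟶ (shiftMod k T d).obj ((yon k).obj Y)) :
    yonTrace s Y (u ≫ x) = yonTrace s Z (x ≫ (shiftMod k T d).map u) := by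
  obtain ⟨u, rfl⟩ := (yon k).map_surjective u
  obtain ⟨a, rfl⟩ := exists_map_comp_inv x
  have e : ((yon k).map a ≫ (yonShiftIso k d Y).inv) ≫ (shiftMod k T d).map ((yon k).map u) =
      (yon k).map (𝟙 Z) ≫ (yon k).map (a ≫ u⟦d⟧') ≫ (yonShiftIso k d Z).inv := by
    rw [Category.assoc, ← yonShiftIso_inv_naturality, (yon k).map_id, Category.id_comp,
      (yon k).map_comp, Category.assoc]
  rw [yonTrace_map_comp, e, yonTrace_map_comp, s.symm_comp_right, Category.comp_id]

lemma yonTrace_eq_zero {Y A : T} (x : (yon k).obj A ⟶ (shiftMod k T d).obj ((yon k).obj Y))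
    (h : ∀ u, yonTrace s Y (u ≫ x) = 0) : x = 0 := by
  obtain ⟨a, rfl⟩ := exists_map_comp_inv x
  have : (s.e Y A).symm a = 0 := LinearMap.ext fun v =>
    (yonTrace_map_comp s v a).symm.trans (h ((yon k).map v))
  rw [(LinearEquiv.map_eq_zero_iff _).1 this, (yon k).map_zero, zero_comp]

lemma yonTrace_exists_repr {Y A : T} (ψ : ((yon k).obj Y ⟶ (yon k).obj A) →ₗ[k] k) :
    ∃ x : (yon k).obj A ⟶ (shiftMod k T d).obj ((yon k).obj Y), ∀ u,
      yonTrace s Y (u ≫ x) = ψ u := by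
  refine ⟨(yon k).map (s.e Y A (ψ ∘ₗ (yon k).mapLinearMap k)) ≫ (yonShiftIso k d Y).inv,
    fun u => ?_⟩
  obtain ⟨u, rfl⟩ := (yon k).map_surjective u
  rw [yonTrace_map_comp, LinearEquiv.symm_apply_apply]
  rfl

variable [HasZeroObject T] [Pretriangulated T]

attribute [local instance] Stable.abelian

/-- The trace on an injective object. -/
def injTrace (P : ModCat k T) [Injective P] : (P ⟶ (shiftMod k T d).obj P) →ₗ[k] k :=
  yonTrace s (exists_retract_of_injective P).choose ∘ₗ
    Linear.leftComp k _ (exists_retract_of_injective P).choose_spec.choose_spec.choose ∘ₗ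
    Linear.rightComp k _ ((shiftMod k T d).map
      (exists_retract_of_injective P).choose_spec.choose)

lemma injTrace_eq (P : ModCat k T) [Injective P] :
    ∃ (V : T) (i : P ⟶ (yon k).obj V) (r : (yon k).obj V ⟶ P), i ≫ r = 𝟙 P ∧
      ∀ x, injTrace s P x = yonTrace s V (r ≫ x ≫ (shiftMod k T d).map i) :=
  ⟨_, _, _, (exists_retract_of_injective P).choose_spec.choose_spec.choose_spec, fun _ => rfl⟩

lemma injTrace_cyclic {P Q : ModCat k T} [Injective P] [Injective Q] (u : P ⟶ Q)
    (x : Q ⟶ (shiftMod k T d).obj P) :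
    injTrace s P (u ≫ x) = injTrace s Q (x ≫ (shiftMod k T d).map u) := by
  obtain ⟨V, i, r, hir, h⟩ := injTrace_eq s P
  obtain ⟨V', i', r', hir', h'⟩ := injTrace_eq s Q
  have e := yonTrace_cyclic s (r ≫ u ≫ i') (r' ≫ x ≫ (shiftMod k T d).map i)
  simp only [Category.assoc, reassoc_of% hir'] at e
  rw [← Functor.map_comp, reassoc_of% hir] at e
  rw [h, h', Category.assoc, e, Category.assoc, ← Functor.map_comp]

/-- The chosen retraction does not matter, because the traces on representables are cyclic. -/
lemma injTrace_yon (Y : T) (x : (yon k).obj Y ⟶ (shiftMod k T d).obj ((yon k).obj Y)) :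
    injTrace s _ x = yonTrace s Y x := by
  obtain ⟨V, i, r, hir, h⟩ := injTrace_eq s ((yon k).obj Y)
  rw [h, yonTrace_cyclic, Category.assoc, ← Functor.map_comp, hir, (shiftMod k T d).map_id,
    Category.comp_id]

lemma injTrace_eq_zero {P G : ModCat k T} [Injective P] (x : G ⟶ (shiftMod k T d).obj P)
    (h : ∀ u : P ⟶ G, injTrace s P (u ≫ x) = 0) : x = 0 := by
  obtain ⟨V, i, r, hir, -⟩ := injTrace_eq s P
  refine hom_ext_yon fun A z => ?_
  have e : (z ≫ x) ≫ (shiftMod k T d).map i = 0 := by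
    refine yonTrace_eq_zero s _ fun v => ?_
    rw [← injTrace_yon, ← Category.assoc, ← Category.assoc, ← injTrace_cyclic, ← h (i ≫ v ≫ z)]
    simp only [Category.assoc]
  have e' : (z ≫ x) ≫ (shiftMod k T d).map (i ≫ r) = 0 := by
    rw [Functor.map_comp, ← Category.assoc, e, zero_comp]
  rw [hir, (shiftMod k T d).map_id, Category.comp_id] at e'
  rw [e', comp_zero]

/-- The functional is represented on a representable cover of `G`; nondegeneracy shows that the
representing map kills the relations, so it descends to `G`. -/
lemma yonTrace_exists_repr' {Y : T} {G : ModCat k T} (ψ : ((yon k).obj Y ⟶ G) →ₗ[k] k) :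
    ∃ x : G ⟶ (shiftMod k T d).obj ((yon k).obj Y), ∀ u, yonTrace s Y (u ≫ x) = ψ u := by
  obtain ⟨X, A, f, p, hp, hfp, hex⟩ := exists_presentation G
  obtain ⟨y, hy⟩ := yonTrace_exists_repr s (ψ ∘ₗ Linear.rightComp k _ p)
  replace hy (v : (yon k).obj Y ⟶ (yon k).obj A) : yonTrace s Y (v ≫ y) = ψ (v ≫ p) := hy v
  have hS := exact_of_presentation hfp hex
  have : Epi (ShortComplex.mk ((yon k).map f) p hfp).g := hp
  have hfy : (yon k).map f ≫ y = 0 := yonTrace_eq_zero s _ fun v => by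
    rw [← Category.assoc, hy, Category.assoc, hfp, comp_zero, map_zero]
  have hx : p ≫ hS.desc y hfy = y := hS.g_desc y hfy
  refine ⟨hS.desc y hfy, fun u => ?_⟩
  obtain ⟨v, rfl⟩ : ∃ v, v ≫ p = u := ⟨Projective.factorThru u p, Projective.factorThru_comp u p⟩
  rw [Category.assoc, hx, hy]

/-- The trace on the injective objects of `mod T` given by a Serre functor of `T` which is a
power of the shift. -/
def serreTrace : Stable.Trace k (shiftMod k T d) where
  tr P _ := injTrace s P
  cyclic := injTrace_cyclic s
  eq_zero := injTrace_eq_zero s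
  exists_repr {P G _} ψ := by
    obtain ⟨V, i, r, hir, -⟩ := injTrace_eq s P
    obtain ⟨x, hx⟩ := yonTrace_exists_repr' s (ψ ∘ₗ Linear.leftComp k G i)
    refine ⟨x ≫ (shiftMod k T d).map r, fun u => ?_⟩
    have e := injTrace_cyclic s r (u ≫ x)
    rw [injTrace_yon, ← Category.assoc, hx] at e
    rw [← Category.assoc, ← e]
    change ψ (i ≫ r ≫ u) = ψ u
    rw [reassoc_of% hir]

end Trace

/-! ### Assembly of the Calabi-Yau and order statements. -/

section Main

variable [HasZeroObject T] [Pretriangulated T]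

attribute [local instance] Stable.abelian

lemma npow_iso_shiftFunctor (A : SFunctor (TriData.ofPretriangulated T)) (a : ℤ)
    (e : A.F ≅ shiftFunctor T a) (n : ℕ) : Nonempty ((A.npow n).F ≅ shiftFunctor T (n * a)) := by
  induction n with
  | zero => exact ⟨(shiftFunctorZero' T _ (by simp)).symm⟩
  | succ n ih =>
    obtain ⟨f⟩ := ih
    exact ⟨Functor.isoWhiskerRight f A.F ≪≫ Functor.isoWhiskerLeft _ e ≪≫
      (shiftFunctorAdd' T _ _ _ (by push_cast; ring)).symm⟩

lemma suspPow_iso_shiftFunctor (d : ℤ) :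
    Nonempty ((SFunctor.suspPow (TriData.ofPretriangulated T) d).F ≅ shiftFunctor T d) := by
  cases d with
  | ofNat n =>
    obtain ⟨e⟩ := npow_iso_shiftFunctor (SFunctor.susp (TriData.ofPretriangulated T)) 1
      (Iso.refl _) n
    rw [mul_one] at e
    exact ⟨e⟩
  | negSucc n =>
    obtain ⟨e⟩ := npow_iso_shiftFunctor (SFunctor.suspInv (TriData.ofPretriangulated T)) (-1)
      (Iso.refl _) (n + 1)
    rw [show ((n + 1 : ℕ) : ℤ) * -1 = Int.negSucc n by rw [Int.negSucc_eq]; push_cast; ring] at e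
    exact ⟨e⟩

lemma isWeaklyCalabiYau_of_isCalabiYau {C : Type u} [Category.{v} C] [Preadditive C] [Linear k C]
    {𝒯 : TriData C} {d : ℤ} (h : IsCalabiYau k 𝒯 d) : IsWeaklyCalabiYau k 𝒯 d := by
  obtain ⟨hf, ν, s, ht, -, he, hi⟩ := h
  exact ⟨hf, ν, s, ht, he, hi⟩

instance {E : Type u} [Category.{v} E] [Preadditive E] [IsFrobeniusAbelian E] (Φ : E ⥤ E)
    [Φ.IsEquivalence] [Φ.Additive] : (stabFunctor Φ).IsEquivalence :=
  have : Φ.asEquivalence.functor.Additive := inferInstanceAs Φ.Additive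
  have : Φ.inv.Additive := Φ.asEquivalence.inverse_additive
  .mk' (stabFunctor Φ.inv)
    (stabFunctorId.symm ≪≫ stabFunctorIso (Ψ := Φ ⋙ Φ.inv) Φ.asEquivalence.unitIso ≪≫ stabFunctorComp Φ Φ.inv)
    ((stabFunctorComp Φ.inv Φ).symm ≪≫ stabFunctorIso (Φ := Φ.inv ⋙ Φ) Φ.asEquivalence.counitIso ≪≫ stabFunctorId)

/-- Only the plain isomorphism between `ν` and the shift by `d` enters, so the weak hypothesis
suffices for the strong conclusion. -/
lemma isCalabiYau_stable {d : ℤ} (h : IsWeaklyCalabiYau k (TriData.ofPretriangulated T) d) :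
    IsCalabiYau k (triData (ModCat k T)) (3 * d - 1) := by
  obtain ⟨hf, ν, s, -, -, ⟨α, -⟩⟩ := h
  obtain ⟨β⟩ := suspPow_iso_shiftFunctor (T := T) d
  let t := serreTrace (s.ofIso (α ≪≫ β))
  let 𝒯 := triData (ModCat k T)
  let A := stab (shiftMod k T d)
  have : A.F.Additive := inferInstanceAs (stabFunctor (shiftMod k T d)).Additive
  have : A.F.IsEquivalence := inferInstanceAs (stabFunctor (shiftMod k T d)).IsEquivalence
  let n : NatPairing k 𝒯.S.functor A.F := t.natPairing
  let ν' := (SFunctor.suspInv 𝒯).comp A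
  let u := SFunctor.suspUnit 𝒯
  have hν' : ν'.cls = ((u ^ (3 * d - 1) : (SFunctor.IsoClass 𝒯)ˣ) : SFunctor.IsoClass 𝒯) := by
    have : ν'.cls = ((u⁻¹ : (SFunctor.IsoClass 𝒯)ˣ) : SFunctor.IsoClass 𝒯) * A.cls := rfl
    rw [this, cls_stab_shiftMod, ← Units.val_mul, ← zpow_neg_one, ← zpow_add, neg_add_eq_sub]
  -- Since `3d - 1 = 2 + 3(d - 1)`, the class of `ν'` is also a product of factors known to be
  -- triangle functors, which avoids treating `suspInv`.
  let B := ((SFunctor.susp 𝒯).comp (SFunctor.susp 𝒯)).comp (stab (shiftMod k T (d - 1)))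
  have hB : B.cls = ν'.cls := by
    have : B.cls = ((u * u : (SFunctor.IsoClass 𝒯)ˣ) : SFunctor.IsoClass 𝒯) *
      (stab (shiftMod k T (d - 1))).cls := rfl
    rw [this, cls_stab_shiftMod, ← Units.val_mul, hν', ← pow_two, ← zpow_natCast, ← zpow_add]
    congr 2
    push_cast
    ring
  have hBt : B.IsTriangle := (susp_isTriangle.comp susp_isTriangle).comp (stab_isTriangle _)
  refine ⟨finite_hom hf, ν', (n.unshift 𝒯.S).serreIso,
    hBt.of_isomorphic (SFunctor.cls_eq_iff.1 hB),
    n.isCompatible t.natPairing_compatible,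
    inferInstanceAs (𝒯.S.inverse ⋙ A.F).IsEquivalence,
    SFunctor.cls_eq_iff.1 (hν'.trans (SFunctor.cls_suspPow 𝒯 _).symm)⟩

lemma suspPow_stable_isomorphic_id {n : ℕ}
    (h : Nonempty ((SFunctor.suspPow (TriData.ofPretriangulated T) n).F ≅ 𝟭 T)) :
    (SFunctor.suspPow (triData (ModCat k T)) ((3 * n : ℕ) : ℤ)).Isomorphic (SFunctor.id _) := by
  obtain ⟨α⟩ := h
  obtain ⟨β⟩ := suspPow_iso_shiftFunctor (T := T) n
  -- `shiftMod n` is precomposition with the shift by `-n`, so it is this shift that has to be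
  -- trivialized.
  let e : shiftFunctor T (-(n : ℤ)) ≅ 𝟭 T :=
    (Functor.rightUnitor _).symm ≪≫ Functor.isoWhiskerLeft _ (α.symm ≪≫ β) ≪≫
      (shiftFunctorAdd' T (-(n : ℤ)) n 0 (by omega)).symm ≪≫ shiftFunctorZero T ℤ
  rw [← SFunctor.cls_eq_iff, SFunctor.cls_suspPow]
  push_cast
  rw [← cls_stab_shiftMod, SFunctor.cls_eq_iff]
  exact (stab_isomorphic (shiftModIsoId k T n e)).trans stab_id

end Main

end

end CYMod

end

theorem mainTheorem9 (k : Type w) [Field k] (T : Type u) [Category.{v} T] [Preadditive T]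
    [HasZeroObject T] [HasShift T ℤ] [∀ n : ℤ, (shiftFunctor T n).Additive]
    [Pretriangulated T] [IsTriangulated T] [Linear k T]
    [∀ n : ℤ, (shiftFunctor T n).Linear k] :
    ∃ _ : CYMod.IsFrobeniusAbelian (CYMod.ModCat k T),
      (∀ d : ℤ, CYMod.IsCalabiYau k (CYMod.TriData.ofPretriangulated T) d →
        CYMod.IsCalabiYau k (CYMod.Stable.triData (CYMod.ModCat k T)) (3 * d - 1)) ∧
      (∀ d : ℤ, CYMod.IsWeaklyCalabiYau k (CYMod.TriData.ofPretriangulated T) d →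
        CYMod.IsWeaklyCalabiYau k (CYMod.Stable.triData (CYMod.ModCat k T)) (3 * d - 1)) ∧
      (∀ n : ℕ, CYMod.HasSuspensionOrder (CYMod.TriData.ofPretriangulated T) n →
        ∃ m : ℕ, CYMod.HasSuspensionOrder (CYMod.Stable.triData (CYMod.ModCat k T)) m ∧
          m ∣ 3 * n) ∧
      (∀ n : ℕ, CYMod.HasPlainSuspensionOrder (CYMod.TriData.ofPretriangulated T) n →
        ∃ m : ℕ, CYMod.HasPlainSuspensionOrder (CYMod.Stable.triData (CYMod.ModCat k T)) m ∧
          m ∣ 3 * n) := by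
  refine ⟨CYMod.isFrobeniusAbelian,
    fun d h => CYMod.isCalabiYau_stable (CYMod.isWeaklyCalabiYau_of_isCalabiYau h),
    fun d h => CYMod.isWeaklyCalabiYau_of_isCalabiYau (CYMod.isCalabiYau_stable h),
    fun n h => ?_, fun n h => ?_⟩
  · obtain ⟨⟨hn, α, -⟩, -⟩ := h
    exact CYMod.HasSuspensionOrder.exists_of_isomorphic _ (by omega)
      (CYMod.suspPow_stable_isomorphic_id ⟨α⟩)
  · obtain ⟨⟨hn, h⟩, -⟩ := h
    obtain ⟨α, -⟩ := CYMod.suspPow_stable_isomorphic_id (k := k) h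
    exact CYMod.HasPlainSuspensionOrder.exists_of_iso _ (by omega) ⟨α⟩
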